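/- **Setting.** Let $k\ge 2$, $m\ge 1$, $n=k+m$, $L=\{1,\dots,k\}$, $R=\{k+1,\dots,n\}$, and fix a cyclic colour order of $\{1,\dots,n\}$, with $a+1$ the successor of $a$. External data are spinors $\lambda_a,\tilde\lambda_a\in\mathbb C^2$ and Grassmann generators $\eta_a^r$, $r=1,\dots,\mathcal N$. Write $(a\,b)=\sigma_{a1}\sigma_{b0}-\sigma_{a0}\sigma_{b1}$ for $\sigma_a,\sigma_b\in\mathbb C^2$, and $\delta^{0|\mathcal N}(\psi)=\psi^1\cdots\psi^{\mathcal N}$. Marked points are pairwise distinct points of the Riemann sphere, and the scales $t_a$ in (R) are non-zero. Consider three formulae. (A) The four-dimensional ambitwistor-string formula, with $(\lambda(\sigma),\chi(\sigma))=\sum_{i\in L}\frac{(\lambda_i,\eta_i)}{(\sigma\,\sigma_i)}$ and $\tilde\lambda(\sigma)=\sum_{p\in R}\frac{\tilde\lambda_p}{(\sigma\,\sigma_p)}$: $$\mathcal A^{\mathcal N}=\int\frac{1}{\mathrm{Vol}\,\mathrm{GL}(2,\mathbb C)}\prod_{a=1}^n\frac{d^2\sigma_a}{(a\,a{+}1)}\prod_{i\in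 L}\bar\delta^2(\tilde\lambda_i-\tilde\lambda(\sigma_i))\prod_{p\in R}\bar\delta^{2|\mathcal N}(\lambda_p-\lambda(\sigma_p)\,|\,\eta_p-\chi(\sigma_p)).$$ (W) Witten's ambidextrous formula $$\mathcal M=\int\frac{d^{2k}P\,d^{2m}T}{\mathrm{Vol}\,\mathrm{GL}(2,\mathbb C)}\prod_{a}\frac{d^2u_a}{(u_a\,u_{a+1})}\prod_{a}\prod_{b\ne a}\frac1{(u_b\,u_a)^2}\prod_{l\in L}\bar\delta^2\Big(\lambda_l-\tfrac{P(u_l)}{\prod_{b\ne l}(u_b u_l)}\Big)\bar\delta^2(\tilde\lambda_l-T(u_l))\prod_{r\in R}\bar\delta^2(\lambda_r-P(u_r))\,\bar\delta^2\Big(\tilde\lambda_r-\tfrac{T(u_r)}{\prod_{b\ne r}(u_b u_r)}\Big),$$ where $P,T$ are $\mathbb C^2$-valued homogeneous polynomials of degrees $k-1$ and $m-1$, and $d^{2k}P=\prod_{l\in L} d^2P(u_l)$, $d^{2m}T=\prod_{r\in R}d^2T(u_r)$. (R) The RSVW twistor-string formula for $\mathcal N=4$ super Yang–Mills: with $d=k-1$,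 $\sigma_a=(1,x_a)$ and $(\lambda,\mu,\chi)(\sigma)=\sum_{r=0}^dZ_r\,\sigma_0^{d-r}\sigma_1^r$, $$\mathcal A_{\rm RSVW}=\int\frac{\prod_{r=0}^dd^{4|4}Z_r}{\mathrm{Vol}\,\mathrm{GL}(2,\mathbb C)}\prod_{a=1}^n\frac{dx_a}{(a\,a{+}1)}\frac{dt_a}{t_a}\,\bar\delta^{2|4}(\lambda_a-t_a\lambda(\sigma_a)\,|\,\eta_a-t_a\chi(\sigma_a))\,e^{it_a[\mu(\sigma_a)\,\tilde\lambda_a]}.$$ **Meaning of the integrals.** The integral over $\mu_r$ is the Fourier representation $\int d^2\mu\,e^{i\mu\cdot X}=\bar\delta^2(X)$; fermionic integrals are Berezin integrals. Each remaining integral has the form $\int\frac{d^Mx}{\mathrm{Vol}\,\mathrm{GL}(2)}\,I(x)\,\bar\delta^M(F(\kappa,x))$, with $\kappa=(\lambda_a,\tilde\lambda_a)_a$. Here $\mathrm{GL}(2)$ stands for its double cover $\mathrm{SL}(2)\times\mathrm{GL}(1)$: $\mathrm{SL}(2)$ acts linearly on $\sigma_a,u_a$ and by Möbius transformations on $x_a$,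 with the induced action on $t_a$ and the map moduli; $c\in\mathrm{GL}(1)$ acts with weight $+1$ on $\sigma_l,u_l$ ($l\in L$) and $-1$ on $\sigma_r,u_r$ ($r\in R$), and on the moduli of (W) by $P(u_l)\mapsto c^{2(k-1)}P(u_l)$, $T(u_r)\mapsto c^{-2(m-1)}T(u_r)$; in (R) it acts by $t_a\mapsto ct_a$, $Z_r\mapsto c^{-1}Z_r$. The integral equals $v\,\delta^4(\sum_a\lambda_a\tilde\lambda_a)$ with $v=\sum I(x)/J(x)$, summed over the gauge orbits of solutions of $F(\kappa,x)=0$. Here $J$ is the gauge-fixed (Faddeev–Popov) Jacobian with the momentum-conserving delta function removed: for every linear $\Gamma:\mathbb C^M\to\mathbb C^4$ (a gauge fixing) and every four-parameter variation $B$ of $\kappa$, $$\det\begin{pmatrix}\partial_xF&\partial_\kappa F\cdot B\\\Gamma&0\end{pmatrix}=J\,\det(\Gamma\circ g)\,\det\big(d(\textstyle\sum_a\lambda_a\tilde\lambda_a)\circ B\big),$$ $g$ being the infinitesimal gauge action at $x$. The integral *has the value $v$* at $\kappa$ if there are finitely many orbits of solutions and at each of them $d(\sum_a\lambda_a\tilde\lambda_a)$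 is surjective, $g$ is injective, $J$ exists and $J\ne0$. **Theorem.** For all $\kappa$: 1. On the support of the delta functions of (A), the refined scattering equations $[\tilde\lambda_i\,\tilde\lambda(\sigma_i)]=0$ ($i\in L$) and $\langle\lambda_p\,\lambda(\sigma_p)\rangle=0$ ($p\in R$) hold. 2. If moreover $m\ge2$, then $\mathcal M=(-1)^{n-1}\mathcal A^{\mathcal N=0}$. 3. $\mathcal A_{\rm RSVW}=(-1)^k\mathcal A^{\mathcal N=4}$, and the $\mathcal N=3$ form of the RSVW formula is the ambitwistor-string formula at $\mathcal N=3$: $$\mathcal A^{\mathcal N=3}=(-1)^n\Big[\int d\eta_{k+1}^4\cdots d\eta_n^4\,\mathcal A_{\rm RSVW}\Big]_{\eta^4_1=\dots=\eta^4_k=0}.$$ In each case one side has a value at $\kappa$ if and only if the other does, and the values are related as stated. The signs only reflect the chosen orientations and orders of integration. -/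

import Mathlib

noncomputable section

namespace Ambitwistor

/-! ### Spinors and kinematics -/

/-- Two-component complex spinors; also homogeneous coordinates on the Riemann sphere. -/
abbrev Spinor := Fin 2 → ℂ

/-- The skew bracket `(a b)`. For `a = s⁻¹ (1, x)` and `b = t⁻¹ (1, y)` it is `(x - y) / (s t)`.
It is also used for `⟨λ λ'⟩` and for `[λ̃ λ̃']`. -/
def br (a b : Spinor) : ℂ := a 1 * b 0 - a 0 * b 1

/-- The `n = k + m` external particles: `inl i` are the particles `1, …, k` (the set `L`),
`inr p` are the particles `k + 1, …, n` (the set `R`). -/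
abbrev Particle (k m : ℕ) := Fin k ⊕ Fin m

/-- External data: `κ.1 a` is `λ_a` and `κ.2 a` is `λ̃_a`. -/
abbrev Kinematics (k m : ℕ) := (Particle k m → Spinor) × (Particle k m → Spinor)

/-- The components of the total momentum `∑ a, λ_a λ̃_a`. -/
def totalMomentum {k m : ℕ} (κ : Kinematics k m) : Fin 4 → ℂ :=
  let P : Matrix (Fin 2) (Fin 2) ℂ := ∑ a, Matrix.vecMulVec (κ.1 a) (κ.2 a)
  ![P 0 0, P 0 1, P 1 0, P 1 1]

/-- The Parke–Taylor denominator `∏ (a a+1)` for the cyclic colour order `ω`. -/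
def parkeTaylor {k m : ℕ} (ω : Fin (k + m) ≃ Particle k m) (σ : Particle k m → Spinor) : ℂ :=
  ∏ a, br (σ (ω a)) (σ (ω (finRotate (k + m) a)))

/-! ### Grassmann algebras and Berezin integration -/

/-- The complex Grassmann algebra on generators indexed by `S`. -/
abbrev Grassmann (S : Type) := ExteriorAlgebra ℂ (S → ℂ)

/-- The generator with index `s`. -/
def θ {S : Type} [DecidableEq S] (s : S) : Grassmann S := ExteriorAlgebra.ι ℂ (Pi.single s 1)

/-- The Berezin integral `∫ dθ_s`, that is, the left derivative with respect to `θ_s`. -/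
def berezin₁ {S : Type} (s : S) : Grassmann S →ₗ[ℂ] Grassmann S :=
  CliffordAlgebra.contractLeft (Q := (0 : QuadraticForm ℂ (S → ℂ)))
    (LinearMap.proj s : (S → ℂ) →ₗ[ℂ] ℂ)

/-- The iterated integral `∫ dθ_{s₁} dθ_{s₂} ⋯`, the last variable of the list being integrated
first. -/
def berezin {S : Type} (l : List S) : Grassmann S →ₗ[ℂ] Grassmann S :=
  l.foldr (fun s f => (berezin₁ s).comp f) LinearMap.id

/-- The fermionic delta function `δ^{0|N}(ψ) = ψ¹ ψ² ⋯ ψᴺ`. -/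
def fermiDelta {S : Type} {N : ℕ} (ψ : Fin N → Grassmann S) : Grassmann S := (List.ofFn ψ).prod

/-! ### Holomorphic delta-function integrals modulo `GL(2, ℂ)`

The integrals have the form
`∫ (1 / Vol GL(2)) ∏ d²x_j · I(x) · ∏ δ̄²(F_j(κ, x))`, with as many two-component integration
variables `x_j` as two-component delta functions `F_j`. -/

/-- The data of a holomorphic integral over `ι → Spinor`. -/
structure DeltaIntegral (k m : ℕ) (ι : Type) (V : Type) where
  /-- the non-singular configurations -/
  domain : Set (ι → Spinor)
  /-- the integrand, delta functions removed -/
  integrand : (ι → Spinor) → V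
  /-- the arguments of the delta functions -/
  args : Kinematics k m → (ι → Spinor) → (ι → Spinor)
  /-- the action of `(h, c)`, `h ∈ SL(2)`, `c ∈ GL(1)` -/
  act : Matrix (Fin 2) (Fin 2) ℂ → ℂ → (ι → Spinor) → (ι → Spinor)
  /-- whether `h` acts on `x`, that is, moves no marked point out of the coordinate chart -/
  actDefined : Matrix (Fin 2) (Fin 2) ℂ → (ι → Spinor) → Prop

namespace DeltaIntegral

variable {k m : ℕ} {ι V : Type}

/-- The support of the delta functions. -/
def solutions (I : DeltaIntegral k m ι V) (κ : Kinematics k m) : Set (ι → Spinor) :=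
  {x | x ∈ I.domain ∧ I.args κ x = 0}

/-- `y` lies on the gauge orbit of `x`. -/
def GaugeEquiv (I : DeltaIntegral k m ι V) (x y : ι → Spinor) : Prop :=
  ∃ (h : Matrix (Fin 2) (Fin 2) ℂ) (c : ℂ),
    h.det = 1 ∧ c ≠ 0 ∧ I.actDefined h x ∧ y = I.act h c x

variable [Fintype ι]

/-- The infinitesimal gauge action at `x`, for the basis
`diag(1, -1), E₀₁, E₁₀` of `sl(2)` and the basis `1` of `gl(1)`. -/
def generators (I : DeltaIntegral k m ι V) (x : ι → Spinor) :
    (Fin 4 → ℂ) →L[ℂ] (ι → Spinor) :=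
  fderiv ℂ (fun v : Fin 4 → ℂ => I.act (1 + !![v 0, v 1; v 2, -v 0]) (1 + v 3) x) 0

/-- The derivative of the delta-function arguments and of a gauge-fixing function with
differential `R`, with respect to the integration variables `x` and to the parameters of a
four-parameter variation `B` of the kinematics. -/
def bordered (I : DeltaIntegral k m ι V) (κ : Kinematics k m) (x : ι → Spinor)
    (R : (ι → Spinor) →ₗ[ℂ] (Fin 4 → ℂ)) (B : (Fin 4 → ℂ) →ₗ[ℂ] Kinematics k m) :
    ((ι → Spinor) × (Fin 4 → ℂ)) →ₗ[ℂ] ((ι → Spinor) × (Fin 4 → ℂ)) :=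
  LinearMap.prod
    (LinearMap.coprod (fderiv ℂ (fun x' => I.args κ x') x : (ι → Spinor) →ₗ[ℂ] (ι → Spinor))
      ((fderiv ℂ (fun κ' => I.args κ' x) κ : Kinematics k m →ₗ[ℂ] (ι → Spinor)).comp B))
    (R.comp (LinearMap.fst ℂ (ι → Spinor) (Fin 4 → ℂ)))

/-- `J` is the Jacobian with which the delta functions localise the gauge-fixed integral at the
solution `x`, once the overall `δ⁴(∑ λ_a λ̃_a)` has been stripped off.

Inserting `det (R ∘ generators) · δ⁴(gauge fixing)` for `1 / Vol GL(2)`, and smearing the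
kinematics along `B`, the delta functions contribute
`det (R ∘ generators) / det (bordered R B)`, while `δ⁴(∑ λ_a λ̃_a)` smeared along `B` is
`1 / det (d totalMomentum ∘ B)`. The quotient of the two is `1 / J`, for every choice of the gauge
fixing `R` and of `B`. The gauge action is required to be locally free at `x`, momentum
conservation to be a non-degenerate condition at `κ`, and `x` to be a simple solution
(`J ≠ 0`). -/
def HasJacobian (I : DeltaIntegral k m ι V) (κ : Kinematics k m) (x : ι → Spinor) (J : ℂ) :
    Prop :=
  J ≠ 0 ∧
  Function.Injective (I.generators x) ∧
  Function.Surjective (fderiv ℂ (totalMomentum (k := k) (m := m)) κ) ∧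
  ∀ (R : (ι → Spinor) →ₗ[ℂ] (Fin 4 → ℂ)) (B : (Fin 4 → ℂ) →ₗ[ℂ] Kinematics k m),
    LinearMap.det (I.bordered κ x R B) =
      J * (LinearMap.det (R.comp (I.generators x : (Fin 4 → ℂ) →ₗ[ℂ] (ι → Spinor))) *
        LinearMap.det ((fderiv ℂ (totalMomentum (k := k) (m := m)) κ :
          Kinematics k m →ₗ[ℂ] (Fin 4 → ℂ)).comp B))

/-- The integral localises at `κ` on finitely many gauge orbits of simple solutions, and
`v = ∑ I(x) / J(x)`, the sum over one representative `x` of each orbit: the integral is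
`v · δ⁴(∑ λ_a λ̃_a)`. -/
def HasValue [AddCommGroup V] [Module ℂ V] (I : DeltaIntegral k m ι V) (κ : Kinematics k m)
    (v : V) : Prop :=
  ∃ (s : Finset (ι → Spinor)) (J : (ι → Spinor) → ℂ),
    (∀ x ∈ s, x ∈ I.solutions κ ∧ I.HasJacobian κ x (J x)) ∧
    (∀ y ∈ I.solutions κ, ∃! x, x ∈ s ∧ I.GaugeEquiv x y) ∧
    v = ∑ x ∈ s, (J x)⁻¹ • I.integrand x

end DeltaIntegral

/-! ### The ambitwistor-string formula -/

variable {k m : ℕ}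

/-- `λ(σ) = ∑ i, λ_i / (σ σ_i)`, the sum over `i = 1, …, k`. -/
def lamField (κ : Kinematics k m) (σ : Particle k m → Spinor) (u : Spinor) : Spinor :=
  ∑ i : Fin k, (br u (σ (Sum.inl i)))⁻¹ • κ.1 (Sum.inl i)

/-- `λ̃(σ) = ∑ p, λ̃_p / (σ σ_p)`, the sum over `p = k + 1, …, n`. -/
def lamTildeField (κ : Kinematics k m) (σ : Particle k m → Spinor) (u : Spinor) : Spinor :=
  ∑ p : Fin m, (br u (σ (Sum.inr p)))⁻¹ • κ.2 (Sum.inr p)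

/-- `χ(σ) = ∑ i, η_i / (σ σ_i)`, the sum over `i = 1, …, k`. -/
def chiField (N : ℕ) (σ : Particle k m → Spinor) (u : Spinor) (r : Fin N) :
    Grassmann (Particle k m × Fin N) :=
  ∑ i : Fin k, (br u (σ (Sum.inl i)))⁻¹ • θ (Sum.inl i, r)

/-- `SL(2)` acts linearly on all `σ_a`, and `c ∈ GL(1)` with weight `1` on the particles
`1, …, k` and `-1` on the others. -/
def actPoints (h : Matrix (Fin 2) (Fin 2) ℂ) (c : ℂ) (σ : Particle k m → Spinor) :
    Particle k m → Spinor
  | Sum.inl i => c • h.mulVec (σ (Sum.inl i))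
  | Sum.inr p => c⁻¹ • h.mulVec (σ (Sum.inr p))

/-- The ambitwistor-string formula
`∫ 1 / Vol GL(2) ∏ d²σ_a / (a a+1) ∏_i δ̄²(λ̃_i - λ̃(σ_i))
  ∏_p δ̄^{2|N}(λ_p - λ(σ_p), η_p - χ(σ_p))`. -/
def ambitwistor (k m N : ℕ) (ω : Fin (k + m) ≃ Particle k m) :
    DeltaIntegral k m (Particle k m) (Grassmann (Particle k m × Fin N)) where
  domain := {σ | ∀ a b, a ≠ b → br (σ a) (σ b) ≠ 0}
  integrand σ := (parkeTaylor ω σ)⁻¹ •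
    (List.ofFn fun p : Fin m => fermiDelta fun r : Fin N =>
      θ (Sum.inr p, r) - chiField N σ (σ (Sum.inr p)) r).prod
  args κ σ
    | Sum.inl i => κ.2 (Sum.inl i) - lamTildeField κ σ (σ (Sum.inl i))
    | Sum.inr p => κ.1 (Sum.inr p) - lamField κ σ (σ (Sum.inr p))
  act := actPoints
  actDefined _ _ := True

/-! ### Witten's parity-invariant formula -/

/-- `∏_{b ≠ a} (u_b u_a)`. -/
def prodOthers (u : Particle k m → Spinor) (a : Particle k m) : ℂ :=
  ∏ b ∈ Finset.univ.erase a, br (u b) (u a)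

/-- The map `∑_l v_l C_l(u)` with `C_l(u) = ∏_{j ≠ l} (w_j u) / (w_j w_l)`; `v_l` is its value at
`u = w_l`. -/
def lagrangeMap {q : ℕ} (w v : Fin q → Spinor) (u : Spinor) : Spinor :=
  ∑ l, (∏ j ∈ Finset.univ.erase l, br (w j) u / br (w j) (w l)) • v l

/-- Witten's ambidextrous formula
`∫ 1 / Vol GL(2) d^{2k}P d^{2(n-k)}T ∏ d²u_a / (u_a u_{a+1}) ∏_{b ≠ a} 1 / (u_b u_a)²`
`∏_{l ∈ L} δ̄²(λ_l - P(u_l) / ∏_{b ≠ l} (u_b u_l)) ∏_{r ∈ R} δ̄²(λ_r - P(u_r))`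
`∏_{r ∈ R} δ̄²(λ̃_r - T(u_r) / ∏_{b ≠ r} (u_b u_r)) ∏_{l ∈ L} δ̄²(λ̃_l - T(u_l))`.

`P` and `T` are homogeneous of degree `k - 1` and `n - k - 1`; the moduli `x (inl (inl l))` and
`x (inl (inr r))` are the values `P(u_l)`, `l ∈ L`, and `T(u_r)`, `r ∈ R`, which determine them,
and `x (inr a)` is `u_a`. The product over `b ≠ a` runs over ordered pairs. -/
def witten (k m : ℕ) (ω : Fin (k + m) ≃ Particle k m) :
    DeltaIntegral k m (Particle k m ⊕ Particle k m) ℂ where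
  domain := {x | ∀ a b, a ≠ b → br (x (Sum.inr a)) (x (Sum.inr b)) ≠ 0}
  integrand x :=
    let u : Particle k m → Spinor := fun a => x (Sum.inr a)
    (parkeTaylor ω u)⁻¹ * ∏ a, ∏ b ∈ Finset.univ.erase a, (br (u b) (u a) ^ 2)⁻¹
  args κ x :=
    let u : Particle k m → Spinor := fun a => x (Sum.inr a)
    let P : Spinor → Spinor :=
      lagrangeMap (fun l => u (Sum.inl l)) (fun l => x (Sum.inl (Sum.inl l)))
    let T : Spinor → Spinor :=
      lagrangeMap (fun r => u (Sum.inr r)) (fun r => x (Sum.inl (Sum.inr r)))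
    fun j => match j with
    | Sum.inl (Sum.inl l) =>
        κ.1 (Sum.inl l) - (prodOthers u (Sum.inl l))⁻¹ • P (u (Sum.inl l))
    | Sum.inl (Sum.inr r) =>
        κ.2 (Sum.inr r) - (prodOthers u (Sum.inr r))⁻¹ • T (u (Sum.inr r))
    | Sum.inr (Sum.inl l) => κ.2 (Sum.inl l) - T (u (Sum.inl l))
    | Sum.inr (Sum.inr r) => κ.1 (Sum.inr r) - P (u (Sum.inr r))
  act h c x
    | Sum.inl (Sum.inl l) => c ^ (2 * (k - 1)) • x (Sum.inl (Sum.inl l))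
    | Sum.inl (Sum.inr r) => c⁻¹ ^ (2 * (m - 1)) • x (Sum.inl (Sum.inr r))
    | Sum.inr a => actPoints h c (fun b => x (Sum.inr b)) a
  actDefined _ _ := True

/-! ### The RSVW formula for `N = 4` super Yang–Mills -/

/-- The homogeneous coordinates `(1, x)` of the marked point `x`. -/
def affinePoint (x : ℂ) : Spinor := ![1, x]

/-- The map `∑_r v_r σ₀^{d-r} σ₁^r` of degree `d = k - 1`. -/
def monomialMap (v : Fin k → Spinor) (σ : Spinor) : Spinor :=
  ∑ r : Fin k, (σ 0 ^ (k - 1 - (r : ℕ)) * σ 1 ^ (r : ℕ)) • v r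

/-- The exponent `∑_a t_a [μ(σ_a) λ̃_a]`; `y a = (x_a, t_a)` holds the marked point and the scale
of particle `a`. -/
def rsvwPhase (κ : Kinematics k m) (μ : Fin k → Spinor) (y : Particle k m → Spinor) : ℂ :=
  ∑ a, y a 1 * br (monomialMap μ (affinePoint (y a 0))) (κ.2 a)

/-- `η_a - t_a χ(σ_a)`, with the fermionic moduli `χ_r` as generators `inl (r, A)` and the external
`η_a` as generators `inr (a, A)`. -/
def rsvwFermi (y : Particle k m → Spinor) (a : Particle k m) (A : Fin 4) :
    Grassmann (Fin k × Fin 4 ⊕ Particle k m × Fin 4) :=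
  θ (Sum.inr (a, A)) -
    y a 1 • ∑ r : Fin k, (y a 0) ^ (r : ℕ) • θ (Sum.inl (r, A))

/-- `∫ ∏_r d^{0|4}χ_r ∏_a δ^{0|4}(η_a - t_a χ(σ_a))`. -/
def rsvwFermiIntegral (y : Particle k m → Spinor) : Grassmann (Particle k m × Fin 4) :=
  ExteriorAlgebra.map (LinearMap.funLeft ℂ ℂ Sum.inr)
    (berezin (((List.finRange k).product (List.finRange 4)).map Sum.inl)
      ((List.ofFn fun i : Fin k => fermiDelta (rsvwFermi y (Sum.inl i))).prod *
        (List.ofFn fun p : Fin m => fermiDelta (rsvwFermi y (Sum.inr p))).prod))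

/-- The RSVW formula
`∫ ∏_{r=0}^{d} d^{4|4}Z_r / Vol GL(2) ∏ dx_a / (a a+1)`
`∏ ∫ dt_a / t_a δ̄^{2|4}(λ_a - t_a λ(σ_a) | η_a - t_a χ(σ_a)) exp(i t_a [μ(σ_a) λ̃_a])`,
`d = k - 1`, with `σ_a = (1, x_a)` and `(λ, μ, χ)(σ) = ∑_r Z_r σ₀^{d-r} σ₁^r`.

The exponent is linear in the moduli `μ_r`, which enter nowhere else; the integral over them is
the Fourier representation `∫ d²μ_r exp(i μ_r · X_r) = δ̄²(X_r)`, `X_r` being the coefficient of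
`μ_r` in the exponent. The other bosonic variables are `x (inl r) = ρ_r`, the `λ`-part of `Z_r`,
and `x (inr a) = (x_a, t_a)`. `SL(2)` acts by Möbius transformations of the marked points together
with the induced linear transformation of the moduli, and `c ∈ GL(1)` by
`t_a ↦ c t_a`, `Z_r ↦ c⁻¹ Z_r`. -/
def rsvw (k m : ℕ) (ω : Fin (k + m) ≃ Particle k m) :
    DeltaIntegral k m (Fin k ⊕ Particle k m) (Grassmann (Particle k m × Fin 4)) where
  domain := {x | (∀ a b : Particle k m, a ≠ b → x (Sum.inr a) 0 ≠ x (Sum.inr b) 0) ∧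
    ∀ a : Particle k m, x (Sum.inr a) 1 ≠ 0}
  integrand x :=
    ((parkeTaylor ω fun a => affinePoint (x (Sum.inr a) 0))⁻¹ *
      ∏ a : Particle k m, (x (Sum.inr a) 1)⁻¹) •
      rsvwFermiIntegral fun a => x (Sum.inr a)
  args κ x
    | Sum.inl r => fun α =>
        rsvwPhase κ (Pi.single r (Pi.single α 1)) fun a => x (Sum.inr a)
    | Sum.inr a => κ.1 a - x (Sum.inr a) 1 •
        monomialMap (fun r => x (Sum.inl r)) (affinePoint (x (Sum.inr a) 0))
  act h c x
    | Sum.inl r => c⁻¹ • ∑ s : Fin k,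
        Polynomial.coeff
          ((Polynomial.C (h 1 1) - Polynomial.C (h 0 1) * Polynomial.X) ^ (k - 1 - (s : ℕ)) *
            (Polynomial.C (h 0 0) * Polynomial.X - Polynomial.C (h 1 0)) ^ (s : ℕ)) (r : ℕ) •
          x (Sum.inl s)
    | Sum.inr a =>
        let w := h.mulVec (affinePoint (x (Sum.inr a) 0))
        ![w 1 / w 0, c * w 0 ^ (k - 1) * x (Sum.inr a) 1]
  actDefined h x := ∀ a : Particle k m, h.mulVec (affinePoint (x (Sum.inr a) 0)) 0 ≠ 0

/-- Passing from `N = 4` to `N = 3` superfields: integrate out `η_p⁴` for the particles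
`p = k + 1, …, n` and set `η_i⁴ = 0` for the particles `i = 1, …, k`. -/
def fourToThree (k m : ℕ) :
    Grassmann (Particle k m × Fin 4) →ₗ[ℂ] Grassmann (Particle k m × Fin 3) :=
  (ExteriorAlgebra.map (LinearMap.funLeft ℂ ℂ
      (Prod.map id Fin.castSucc : Particle k m × Fin 3 → Particle k m × Fin 4))).toLinearMap.comp
    (berezin ((List.finRange m).map fun p => (Sum.inr p, Fin.last 3)))

end Ambitwistor

end

/-! The refined scattering equations are immediate: on the support, λ̃_i equals λ̃(σ_i) and λ_p
equals λ(σ_p), and a spinor has zero bracket with itself. The comparisons with (W) and (R) share one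
mechanism. Those formulae carry auxiliary moduli, and part of their delta functions fix the moduli
linearly in terms of the marked points and κ. Once the moduli are eliminated, the remaining delta
functions are those of (A), after an invertible linear change, evaluated at points σ that are an
explicit function of the remaining variables. The underlying fact is Lagrange interpolation: a
polynomial of degree k-1 is a combination of its values at the points of L, and the interpolation
coefficients become the propagators 1/(σ_p σ_i) once the homogeneous coordinates are suitably
rescaled (`lagrange_coeff_inl`, `lagrange_coeff_inr`, `rsvw_interpolation`).

It follows that solutions, gauge orbits and Jacobians can all be compared along the map to σ. For
the Jacobians, `hasJacobian_iff_of_factorization` shows that the Faddeev–Popov Jacobian changes by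
the product of three determinants: the change of delta functions, the derivative of the map of
marked points, and the derivative of the moduli conditions in the moduli. It rests on a Schur
complement (`linJacobian_lift`) and a change of variables (`linJacobian_change`). `Correspondence`
handles the sum over orbits: if every orbit of (A) has d orbits above it, each contributing 1/d of
the expected residue, then one integral has a value exactly when the other does.

For (W), σ_a is u_a rescaled by a factor γ_a. The Jacobian of u ↦ σ is (-1)^(n-1) d ∏γ_a², by
`det_scaleDeriv` and `det_one_add_wittenWeightsLinear`, and the fibres have exactly d elements with
the same d = (m-1)^(k-1) (k-1)^(m-1) (n-1), by `exists_wittenFiber`. The factor ∏γ_a² is absorbed by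
the Parke–Taylor denominators, and the moduli produce the product of (u_b u_a)^(-2) present in
Witten's integrand. The d preimages therefore add up to one residue with sign (-1)^(n-1). For k ≥ 2
and m = 1 the degree d vanishes, which is why m ≥ 2 is required.

For (R), the map from (x_a, t_a) to σ is a bijection on gauge orbits, with Jacobian (-1)^k ∏γ_a²
∏1/t_a (`det_rsvwDeriv`). The λ-moduli and the recombination of the μ delta functions each give the
square of the determinant V of the interpolation matrix, and the Berezin integral over the fermionic
moduli gives V⁴ (`rsvwFermiIntegral_eq`). These cancel, leaving (-1)^k. At 𝒩 = 3, the Berezin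
integral over η_p⁴ strips the fourth factor from each fermionic delta function
(`fourToThree_integrand`), while the bosonic data do not depend on 𝒩. -/

noncomputable section

namespace Ambitwistor

/-! ### Linear algebra: bordered determinants and how they change under elimination of variables. -/

section LinearAlgebra

variable {A X W Y : Type*} [AddCommGroup A] [Module ℂ A] [AddCommGroup X] [Module ℂ X]
  [AddCommGroup W] [Module ℂ W] [AddCommGroup Y] [Module ℂ Y]

/-- The linear map with blocks `E`, `P`, `Q`, `Z`. -/
def blocks (E : A →ₗ[ℂ] A) (P : X →ₗ[ℂ] A) (Q : A →ₗ[ℂ] X) (Z : X →ₗ[ℂ] X) :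
    A × X →ₗ[ℂ] A × X :=
  (E.coprod P).prod (Q.coprod Z)

theorem blocks_apply (E : A →ₗ[ℂ] A) (P : X →ₗ[ℂ] A) (Q : A →ₗ[ℂ] X) (Z : X →ₗ[ℂ] X) (a : A)
    (x : X) : blocks E P Q Z (a, x) = (E a + P x, Q a + Z x) := by
  simp [blocks]

/-- The linear algebra of `DeltaIntegral.HasJacobian`. -/
def LinJacobian (D : X →ₗ[ℂ] X) (K : Y →ₗ[ℂ] X) (g : W →ₗ[ℂ] X) (P : Y →ₗ[ℂ] W) (J : ℂ) : Prop :=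
  J ≠ 0 ∧ Function.Injective g ∧ Function.Surjective P ∧
    ∀ (R : X →ₗ[ℂ] W) (B : W →ₗ[ℂ] Y), LinearMap.det (blocks D (K ∘ₗ B) R 0) =
      J * (LinearMap.det (R ∘ₗ g) * LinearMap.det (P ∘ₗ B))

/-- Taking the gauge fixing to be a left inverse of the gauge action and the variation to be a right
inverse of the differential of momentum makes both determinants on the right equal to 1. -/
theorem LinJacobian.unique [FiniteDimensional ℂ W] {D : X →ₗ[ℂ] X} {K : Y →ₗ[ℂ] X} {g : W →ₗ[ℂ] X} {P : Y →ₗ[ℂ] W}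
    {J₁ J₂ : ℂ} (h₁ : LinJacobian D K g P J₁) (h₂ : LinJacobian D K g P J₂) : J₁ = J₂ := by
  obtain ⟨R, hR⟩ := LinearMap.exists_leftInverse_of_injective g (LinearMap.ker_eq_bot.2 h₁.2.1)
  obtain ⟨B, hB⟩ := LinearMap.exists_rightInverse_of_surjective P
    (LinearMap.range_eq_top.2 h₁.2.2.1)
  have := (h₁.2.2.2 R B).symm.trans (h₂.2.2.2 R B)
  simpa [hR, hB] using this

variable [FiniteDimensional ℂ A] [FiniteDimensional ℂ X] [FiniteDimensional ℂ W]

/-- The Weinstein–Aronszajn identity for linear maps. -/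
theorem det_one_add_comp_comm (U : A →ₗ[ℂ] X) (V : X →ₗ[ℂ] A) :
    LinearMap.det (LinearMap.id + U ∘ₗ V) = LinearMap.det (LinearMap.id + V ∘ₗ U) := by
  classical
  let b := Module.finBasis ℂ A
  let c := Module.finBasis ℂ X
  rw [← LinearMap.det_toMatrix c, ← LinearMap.det_toMatrix b, map_add, map_add,
    LinearMap.toMatrix_comp c b c, LinearMap.toMatrix_comp b c b, LinearMap.toMatrix_id,
    LinearMap.toMatrix_id, Matrix.det_one_add_mul_comm]

/-- Elementary row and column operations are of this form, since U ∘ V then squares to zero. This is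
how block determinants are reduced throughout. -/
theorem det_one_add_comp_of_comp_eq_zero (U : A →ₗ[ℂ] X) (V : X →ₗ[ℂ] A) (h : V ∘ₗ U = 0) :
    LinearMap.det (LinearMap.id + U ∘ₗ V) = 1 := by
  rw [det_one_add_comp_comm, h, add_zero, LinearMap.det_id]

theorem det_blocks_upper (E : A →ₗ[ℂ] A) (P : X →ₗ[ℂ] A) (Z : X →ₗ[ℂ] X) :
    LinearMap.det (blocks E P 0 Z) = LinearMap.det E * LinearMap.det Z := by
  have h1 : blocks E P 0 Z = (LinearMap.id.prodMap Z) ∘ₗ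
      (LinearMap.id + (LinearMap.inl ℂ A X) ∘ₗ (P ∘ₗ LinearMap.snd ℂ A X)) ∘ₗ
        (E.prodMap LinearMap.id) := by
    refine LinearMap.ext fun ⟨a, x⟩ => ?_
    simp [blocks_apply]
  rw [h1, LinearMap.det_comp, LinearMap.det_comp, LinearMap.det_prodMap, LinearMap.det_prodMap,
    det_one_add_comp_of_comp_eq_zero, LinearMap.det_id, LinearMap.det_id]
  · ring
  · exact LinearMap.ext fun a => by simp

/-- Clearing the lower left block by row operations leaves the Schur complement of E. -/
theorem det_blocks (E : A ≃ₗ[ℂ] A) (P : X →ₗ[ℂ] A) (Q : A →ₗ[ℂ] X) (Z : X →ₗ[ℂ] X) :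
    LinearMap.det (blocks (E : A →ₗ[ℂ] A) P Q Z) =
      LinearMap.det (E : A →ₗ[ℂ] A) *
        LinearMap.det (Z - Q ∘ₗ (E.symm : A →ₗ[ℂ] A) ∘ₗ P) := by
  have h1 : blocks (E : A →ₗ[ℂ] A) P Q Z =
      (LinearMap.id + (LinearMap.inr ℂ A X) ∘ₗ
        (Q ∘ₗ (E.symm : A →ₗ[ℂ] A) ∘ₗ LinearMap.fst ℂ A X)) ∘ₗ
      blocks (E : A →ₗ[ℂ] A) P 0 (Z - Q ∘ₗ (E.symm : A →ₗ[ℂ] A) ∘ₗ P) := by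
    refine LinearMap.ext fun ⟨a, x⟩ => ?_
    simp [blocks_apply]
    abel
  rw [h1, LinearMap.det_comp, det_one_add_comp_of_comp_eq_zero, one_mul, det_blocks_upper]
  exact LinearMap.ext fun a => by simp

theorem det_eq_zero_of_apply_eq_zero (F : X →ₗ[ℂ] X) (x : X) (hx : x ≠ 0) (h : F x = 0) :
    LinearMap.det F = 0 := by
  by_contra hd
  have := LinearMap.equivOfDetNeZero F hd
  have hi : Function.Injective F :=
    (LinearMap.equivOfDetNeZero F hd).injective
  exact hx (hi (by rw [h, map_zero]))

/-- The lower right block of a bordered matrix is irrelevant if the kernel of the upper left block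
contains an injective image of the bordering space. -/
theorem det_blocks_corner (D : X →ₗ[ℂ] X) (K : W →ₗ[ℂ] X) (R : X →ₗ[ℂ] W) (S : W →ₗ[ℂ] W)
    (g : W →ₗ[ℂ] X) (hg : Function.Injective g) (hD : D ∘ₗ g = 0) :
    LinearMap.det (blocks D K R S) = LinearMap.det (blocks D K R 0) := by
  have hD' : ∀ w, D (g w) = 0 := fun w => LinearMap.congr_fun hD w
  -- If R ∘ g is singular, some nonzero gauge direction is killed by both D and R, so both
  -- determinants vanish.
  by_cases h : LinearMap.det (R ∘ₗ g) = 0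
  · have : ¬ Function.Injective (R ∘ₗ g) := fun hi => by
      have hb : LinearMap.det ((LinearEquiv.ofInjectiveEndo _ hi : W ≃ₗ[ℂ] W) : W →ₗ[ℂ] W) ≠ 0 :=
        (LinearEquiv.isUnit_det' _).ne_zero
      exact hb h
    rw [injective_iff_map_eq_zero] at this
    push Not at this
    obtain ⟨w, hw, hw0⟩ := this
    have hne : ((g w, 0) : X × W) ≠ 0 := fun h0 => hw0 (hg (by
      rw [map_zero]; exact congrArg Prod.fst h0))
    have hw' : R (g w) = 0 := hw
    rw [det_eq_zero_of_apply_eq_zero _ _ hne, det_eq_zero_of_apply_eq_zero _ _ hne] <;>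
      simp [blocks_apply, hD', hw']
  · let e := LinearMap.equivOfDetNeZero (R ∘ₗ g) h
    have he : ∀ w, R (g (e.symm w)) = w := fun w => e.apply_symm_apply w
    -- Otherwise S is removed by a column operation along the gauge directions, which leaves the
    -- upper right block untouched because D kills the image of g.
    have h1 : blocks D K R 0 = blocks D K R S ∘ₗ (LinearMap.id + (LinearMap.inl ℂ X W) ∘ₗ
        (-(g ∘ₗ (e.symm : W →ₗ[ℂ] W) ∘ₗ S) ∘ₗ LinearMap.snd ℂ X W)) := by
      refine LinearMap.ext fun ⟨x, w⟩ => ?_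
      simp [blocks_apply, hD', he]
    rw [h1, LinearMap.det_comp, det_one_add_comp_of_comp_eq_zero, mul_one]
    exact LinearMap.ext fun a => by simp

/-- The variables in A are determined by their own equations, with invertible derivative E, and may
be eliminated. The Schur complement turns a gauge fixing on A × X into one on X and leaves a
spurious lower right block, which `det_blocks_corner` discards. The hypothesis on g₁ says that the
gauge action on A is induced from that on X. -/
theorem linJacobian_lift (E : A →ₗ[ℂ] A) (hE : LinearMap.det E ≠ 0) (N : X →ₗ[ℂ] A)
    (D : X →ₗ[ℂ] X) (K₁ : Y →ₗ[ℂ] A) (K : Y →ₗ[ℂ] X) (g₁ : W →ₗ[ℂ] A) (g : W →ₗ[ℂ] X)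
    (P : Y →ₗ[ℂ] W) (hg₁ : E ∘ₗ g₁ + N ∘ₗ g = 0) (hg : D ∘ₗ g = 0) (J : ℂ) :
    LinJacobian (blocks E N 0 D) (K₁.prod K) (g₁.prod g) P (LinearMap.det E * J) ↔
      LinJacobian D K g P J := by
  let e := LinearMap.equivOfDetNeZero E hE
  have he : (e : A →ₗ[ℂ] A) = E := rfl
  have hes : ∀ a, e.symm (E a) = a := fun a => e.symm_apply_apply a
  have hg₁' : ∀ w, g₁ w = - e.symm (N (g w)) := fun w => by
    have h1 : E (g₁ w) + N (g w) = 0 := LinearMap.congr_fun hg₁ w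
    rw [← hes (g₁ w), eq_neg_of_add_eq_zero_left h1, map_neg]
  have hinj : Function.Injective (g₁.prod g) ↔ Function.Injective g := by
    rw [injective_iff_map_eq_zero, injective_iff_map_eq_zero]
    refine forall_congr' fun w => ⟨fun h h0 => h ?_, fun h h0 => h (congrArg Prod.snd h0)⟩
    simp [hg₁', h0]
  -- Reassociating (A × X) × W as A × (X × W) exhibits E as a pivot. The corner comes from the
  -- response of the A-variables to the kinematics.
  have key : ∀ (R : A × X →ₗ[ℂ] W) (B : W →ₗ[ℂ] Y),
      LinearMap.det (blocks (blocks E N 0 D) (K₁.prod K ∘ₗ B) R 0) = LinearMap.det E *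
        LinearMap.det (blocks D (K ∘ₗ B)
          (R ∘ₗ LinearMap.inr ℂ A X - (R ∘ₗ LinearMap.inl ℂ A X) ∘ₗ (e.symm : A →ₗ[ℂ] A) ∘ₗ N)
          (-((R ∘ₗ LinearMap.inl ℂ A X) ∘ₗ (e.symm : A →ₗ[ℂ] A) ∘ₗ K₁ ∘ₗ B))) := by
    intro R B
    let s := LinearEquiv.prodAssoc ℂ A X W
    rw [← LinearMap.det_conj _ s]
    have h2 : (s : (A × X) × W →ₗ[ℂ] A × X × W) ∘ₗ
        blocks (blocks E N 0 D) (K₁.prod K ∘ₗ B) R 0 ∘ₗ (s.symm : A × X × W →ₗ[ℂ] (A × X) × W) =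
        blocks (e : A →ₗ[ℂ] A) (N.coprod (K₁ ∘ₗ B))
          ((LinearMap.inr ℂ X W) ∘ₗ R ∘ₗ LinearMap.inl ℂ A X)
          (blocks D (K ∘ₗ B) (R ∘ₗ LinearMap.inr ℂ A X) 0) := by
      refine LinearMap.ext fun ⟨a, x, w⟩ => ?_
      have hR : R (a, x) = R (a, 0) + R (0, x) := by rw [← map_add]; simp
      have hs : s.symm (a, x, w) = ((a, x), w) := rfl
      have hs' : ∀ v : (A × X) × W, s v = (v.1.1, v.1.2, v.2) := fun _ => rfl
      simp [blocks_apply, hs, hs', he, hR, add_assoc]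
    rw [h2, det_blocks, he]
    congr 2
    refine LinearMap.ext fun ⟨x, w⟩ => ?_
    have hR : ∀ a b : A, R (a + b, 0) = R (a, 0) + R (b, 0) := fun a b => by
      rw [← map_add]; simp
    simp [blocks_apply, hR]
    abel
  have hR' : ∀ R : A × X →ₗ[ℂ] W, (R ∘ₗ LinearMap.inr ℂ A X -
      (R ∘ₗ LinearMap.inl ℂ A X) ∘ₗ (e.symm : A →ₗ[ℂ] A) ∘ₗ N) ∘ₗ g = R ∘ₗ g₁.prod g := by
    intro R
    refine LinearMap.ext fun w => ?_
    have : R (g₁ w, g w) = R (0, g w) + R (g₁ w, 0) := by rw [← map_add]; simp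
    have h3 : ∀ a, R (-a, 0) = - R (a, 0) := fun a => by rw [← map_neg]; simp
    rw [hg₁', h3] at this
    simp [hg₁', this, sub_eq_add_neg]
  refine and_congr (by simp [hE]) ?_
  rw [hinj]
  refine and_congr_right fun hgi => and_congr_right fun _ => ⟨fun h R B => ?_, fun h R B => ?_⟩
  -- A gauge fixing of the reduced problem is tested through the one that ignores A, for which the
  -- induced gauge fixing is R itself.
  · have h1 := h (R ∘ₗ LinearMap.snd ℂ A X) B
    rw [key, det_blocks_corner _ _ _ _ g hgi hg, ← hR'] at h1
    have h4 : (R ∘ₗ LinearMap.snd ℂ A X) ∘ₗ LinearMap.inr ℂ A X -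
      ((R ∘ₗ LinearMap.snd ℂ A X) ∘ₗ LinearMap.inl ℂ A X) ∘ₗ (e.symm : A →ₗ[ℂ] A) ∘ₗ N = R :=
        LinearMap.ext fun w => by simp
    rw [h4, mul_assoc] at h1
    exact mul_left_cancel₀ hE h1
  · rw [key, det_blocks_corner _ _ _ _ g hgi hg, h, hR', mul_assoc]

/-- A linear change M of the equations and a change of variables C multiply the bordered determinant
by their determinants. A change U of basis of the gauge algebra is invisible because it has
determinant 1, and the identification e enters only through conjugation. -/
theorem linJacobian_change {X' : Type*} [AddCommGroup X'] [Module ℂ X'] [FiniteDimensional ℂ X']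
    (M : X →ₗ[ℂ] X) (C : X ≃ₗ[ℂ] X) (U : W ≃ₗ[ℂ] W) (e : X' ≃ₗ[ℂ] X)
    (hM : LinearMap.det M ≠ 0) (hU : LinearMap.det (U : W →ₗ[ℂ] W) = 1)
    (D : X →ₗ[ℂ] X) (K : Y →ₗ[ℂ] X) (g : W →ₗ[ℂ] X) (P : Y →ₗ[ℂ] W)
    (D' : X' →ₗ[ℂ] X') (K' : Y →ₗ[ℂ] X') (g' : W →ₗ[ℂ] X')
    (hD : ∀ x, e (D' x) = M (D (C (e x)))) (hK : ∀ y, e (K' y) = M (K y))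
    (hg : ∀ w, C (e (g' w)) = g (U w)) (J : ℂ) :
    LinJacobian D' K' g' P (LinearMap.det M * LinearMap.det (C : X →ₗ[ℂ] X) * J) ↔
      LinJacobian D K g P J := by
  have hC : LinearMap.det (C : X →ₗ[ℂ] X) ≠ 0 := (LinearEquiv.isUnit_det' _).ne_zero
  have hinj : Function.Injective g' ↔ Function.Injective g := by
    have h1 : g' = e.symm ∘ C.symm ∘ g ∘ U := funext fun w => by simp [← hg]
    rw [h1, e.symm.injective.of_comp_iff, C.symm.injective.of_comp_iff]
    exact U.injective_comp g
  have key : ∀ (R : X →ₗ[ℂ] W) (B : W →ₗ[ℂ] Y),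
      LinearMap.det (blocks D' (K' ∘ₗ B) (R ∘ₗ (C : X →ₗ[ℂ] X) ∘ₗ (e : X' →ₗ[ℂ] X)) 0) =
        LinearMap.det M * LinearMap.det (C : X →ₗ[ℂ] X) *
          LinearMap.det (blocks D (K ∘ₗ B) R 0) := by
    intro R B
    rw [← LinearMap.det_conj _ (e.prodCongr (LinearEquiv.refl ℂ W))]
    have h1 : ((e.prodCongr (LinearEquiv.refl ℂ W) : (X' × W) ≃ₗ[ℂ] X × W) :
        X' × W →ₗ[ℂ] X × W) ∘ₗ
        blocks D' (K' ∘ₗ B) (R ∘ₗ (C : X →ₗ[ℂ] X) ∘ₗ (e : X' →ₗ[ℂ] X)) 0 ∘ₗ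
        ((e.prodCongr (LinearEquiv.refl ℂ W)).symm : X × W →ₗ[ℂ] X' × W) =
        (M.prodMap LinearMap.id) ∘ₗ blocks D (K ∘ₗ B) R 0 ∘ₗ
          ((C : X →ₗ[ℂ] X).prodMap LinearMap.id) := by
      refine LinearMap.ext fun ⟨x, w⟩ => ?_
      simp [blocks_apply, hD, hK]
    rw [h1, LinearMap.det_comp, LinearMap.det_comp, LinearMap.det_prodMap, LinearMap.det_prodMap,
      LinearMap.det_id]
    ring
  have hRg : ∀ R : X →ₗ[ℂ] W,
      LinearMap.det ((R ∘ₗ (C : X →ₗ[ℂ] X) ∘ₗ (e : X' →ₗ[ℂ] X)) ∘ₗ g') =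
        LinearMap.det (R ∘ₗ g) := by
    intro R
    have : (R ∘ₗ (C : X →ₗ[ℂ] X) ∘ₗ (e : X' →ₗ[ℂ] X)) ∘ₗ g' = (R ∘ₗ g) ∘ₗ (U : W →ₗ[ℂ] W) :=
      LinearMap.ext fun w => by simp [hg]
    rw [this, LinearMap.det_comp, hU, mul_one]
  refine and_congr (by simp [hM, hC]) (and_congr hinj (and_congr_right fun _ =>
    ⟨fun h R B => ?_, fun h R B => ?_⟩))
  · have h1 := h (R ∘ₗ (C : X →ₗ[ℂ] X) ∘ₗ (e : X' →ₗ[ℂ] X)) B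
    rw [key, hRg, mul_assoc _ J] at h1
    exact mul_left_cancel₀ (mul_ne_zero hM hC) h1
  -- Every gauge fixing of the primed problem is pulled back from the other, as C and e are
  -- invertible.
  · obtain ⟨R, rfl⟩ : ∃ R₀ : X →ₗ[ℂ] W, R = R₀ ∘ₗ (C : X →ₗ[ℂ] X) ∘ₗ (e : X' →ₗ[ℂ] X) :=
      ⟨R ∘ₗ (e.symm : X →ₗ[ℂ] X') ∘ₗ (C.symm : X →ₗ[ℂ] X), LinearMap.ext fun x => by simp⟩
    rw [key, hRg, h]
    ring

end LinearAlgebra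

end Ambitwistor

/-! ### Calculus: differentiating a product at a zero of one factor. -/

namespace Ambitwistor

open Filter Topology

/-- The derivative of `z ↦ M z (w z)` at a zero of `w` only involves the value of `M` there. -/
theorem hasFDerivAt_apply_of_eq_zero {Z Q T : Type*} [NormedAddCommGroup Z] [NormedSpace ℂ Z]
    [NormedAddCommGroup Q] [NormedSpace ℂ Q] [FiniteDimensional ℂ Q]
    [NormedAddCommGroup T] [NormedSpace ℂ T]
    (M : Z → Q →ₗ[ℂ] T) (w : Z → Q) (w' : Z →L[ℂ] Q) (x : Z) (hw : HasFDerivAt w w' x)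
    (h0 : w x = 0) (hM : ∀ v, ContinuousAt (fun z => M z v) x) :
    HasFDerivAt (fun z => M z (w z)) ((LinearMap.toContinuousLinearMap (M x)) ∘L w') x := by
  let b := Module.finBasis ℂ Q
  let c : Fin (Module.finrank ℂ Q) → Q →L[ℂ] ℂ := fun i =>
    LinearMap.toContinuousLinearMap (b.coord i)
  have hsum : ∀ z v, M z v = ∑ i, c i v • M z (b i) := fun z v => by
    conv_lhs => rw [← b.sum_repr v, map_sum]
    simp [c]
  have h1 : ∀ i, HasFDerivAt (fun z => c i (w z) • M z (b i))
      (((c i) ∘L w').smulRight (M x (b i))) x := by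
    intro i
    have hc : HasFDerivAt (fun z => c i (w z)) ((c i) ∘L w') x := (c i).hasFDerivAt.comp x hw
    have hc0 : c i (w x) = 0 := by rw [h0, map_zero]
    rw [hasFDerivAt_iff_isLittleO_nhds_zero] at hc ⊢
    have hcO : (fun h => c i (w (x + h))) =O[𝓝 0] fun h => h := by
      have := hc.isBigO.add (((c i) ∘L w').isBigO_id (𝓝 0))
      refine this.congr_left fun h => ?_
      simp [hc0]
    have hMo : (fun h => M (x + h) (b i) - M x (b i)) =o[𝓝 0] fun _ => (1 : ℝ) := by
      rw [Asymptotics.isLittleO_one_iff]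
      have : Tendsto (fun h => M (x + h) (b i)) (𝓝 0) (𝓝 (M x (b i))) := by
        have h2 : Tendsto (fun h => x + h) (𝓝 0) (𝓝 x) := by
          have : ContinuousAt (fun h : Z => x + h) 0 := by fun_prop
          simpa [ContinuousAt] using this
        exact (hM (b i)).tendsto.comp h2
      simpa using this.sub_const (M x (b i))
    -- Continuity of M suffices: the coefficient is O(h) because w vanishes at x, and the increment
    -- of M is o(1).
    have e1 : (fun h => c i (w (x + h)) • (M (x + h) (b i) - M x (b i))) =o[𝓝 0] fun h => h := by
      have h3 := (hcO.norm_norm.smul_isLittleO hMo)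
      refine Asymptotics.IsLittleO.of_norm_left ?_
      have h4 := hcO.norm_left.norm_right.smul_isLittleO hMo
      have h5 := h4.norm_left
      refine (h5.congr (fun h => ?_) (fun h => ?_)).of_norm_right (g' := fun h => h)
      · simp [norm_smul]
      · simp
    have e2 : (fun h => (c i (w (x + h)) - c i (w x) - ((c i) ∘L w') h) • M x (b i))
        =o[𝓝 0] fun h => h := by
      have := hc.norm_norm
      refine Asymptotics.IsLittleO.of_norm_norm ?_
      refine (this.const_mul_left ‖M x (b i)‖).congr_left fun h => ?_
      rw [norm_smul, mul_comm]
    refine (e1.add e2).congr_left fun h => ?_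
    simp only [hc0, ContinuousLinearMap.smulRight_apply]
    module
  have h2 := HasFDerivAt.fun_sum (u := Finset.univ) fun i _ => h1 i
  have h3 : (fun z => M z (w z)) = fun z => ∑ i, c i (w z) • M z (b i) :=
    funext fun z => hsum z _
  rw [h3]
  refine h2.congr_fderiv (ContinuousLinearMap.ext fun z => ?_)
  simp [hsum x (w' z)]

theorem hasFDerivAt_comp_of_eq {X Y Z : Type*} [NormedAddCommGroup X] [NormedSpace ℂ X]
    [NormedAddCommGroup Y] [NormedSpace ℂ Y] [NormedAddCommGroup Z] [NormedSpace ℂ Z]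
    {g : Y → Z} {f : X → Y} {g' : Y →L[ℂ] Z} {f' : X →L[ℂ] Y} (x : X) {y : Y}
    (hg : HasFDerivAt g g' y) (hf : HasFDerivAt f f' x) (h : f x = y) :
    HasFDerivAt (fun z => g (f z)) (g' ∘L f') x := by
  subst h
  exact hg.comp x hf

/-! ### Jacobians of delta-function integrals, the gauge action, and elimination of moduli. -/

namespace DeltaIntegral

variable {k m : ℕ} {α β ι V V' : Type}

theorem hasJacobian_iff (I : DeltaIntegral k m ι V) (κ : Kinematics k m) (x : ι → Spinor) (J : ℂ) :
    I.HasJacobian κ x J ↔ LinJacobian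
      (fderiv ℂ (fun x' => I.args κ x') x : (ι → Spinor) →ₗ[ℂ] (ι → Spinor))
      (fderiv ℂ (fun κ' => I.args κ' x) κ : Kinematics k m →ₗ[ℂ] (ι → Spinor))
      (I.generators x : (Fin 4 → ℂ) →ₗ[ℂ] (ι → Spinor))
      (fderiv ℂ (totalMomentum (k := k) (m := m)) κ : Kinematics k m →ₗ[ℂ] (Fin 4 → ℂ)) J := by
  have : ∀ R B, I.bordered κ x R B = blocks
      (fderiv ℂ (fun x' => I.args κ x') x : (ι → Spinor) →ₗ[ℂ] (ι → Spinor))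
      ((fderiv ℂ (fun κ' => I.args κ' x) κ : Kinematics k m →ₗ[ℂ] (ι → Spinor)) ∘ₗ B) R 0 := by
    intro R B
    refine LinearMap.ext fun ⟨a, b⟩ => ?_
    simp [bordered, blocks_apply]
  simp only [HasJacobian, LinJacobian, this]
  rfl

theorem HasJacobian.unique {I : DeltaIntegral k m ι V} {κ : Kinematics k m} {x : ι → Spinor}
    {J₁ J₂ : ℂ} (h₁ : I.HasJacobian κ x J₁) (h₂ : I.HasJacobian κ x J₂) : J₁ = J₂ :=
  ((I.hasJacobian_iff _ _ _).1 h₁).unique ((I.hasJacobian_iff _ _ _).1 h₂)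

variable [Fintype α] [Fintype β] [Fintype ι]

/-! ### The infinitesimal gauge action -/

/-- The element of `sl(2) × gl(1)` with given coordinates. -/
def lieElement : (Fin 4 → ℂ) →ₗ[ℂ] (Fin 2 → Fin 2 → ℂ) × ℂ where
  toFun v := (![![v 0, v 1], ![v 2, -v 0]], v 3)
  map_add' v w := by
    ext i j
    · fin_cases i <;> fin_cases j <;> simp [add_comm]
    · simp
  map_smul' c v := by
    ext i j
    · fin_cases i <;> fin_cases j <;> simp
    · simp

/-- A map into `SL(2)` with differential `lieElement` at the origin. -/
def slCurve (v : Fin 4 → ℂ) : Fin 2 → Fin 2 → ℂ :=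
  ![![1 + v 0, v 1], ![v 2, (1 + v 1 * v 2) / (1 + v 0)]]

theorem slCurve_zero : slCurve 0 = (1 : Matrix (Fin 2) (Fin 2) ℂ) := by
  ext i j
  fin_cases i <;> fin_cases j <;> simp [slCurve]

theorem eventually_one_add_ne_zero (i : Fin 4) : ∀ᶠ v : Fin 4 → ℂ in 𝓝 0, 1 + v i ≠ 0 := by
  have : ContinuousAt (fun v : Fin 4 → ℂ => 1 + v i) 0 :=
    (continuous_const.add (continuous_apply i)).continuousAt
  exact this.eventually_ne (by simp)

/-- `generators` differentiates along 1 + X, which leaves SL(2) at second order, whereas invariance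
of the delta functions is known only for determinant one. Correcting the lower right entry gives a
curve inside SL(2) with the same first-order behaviour, defined near the origin, where 1 + v 0 is
nonzero. -/
theorem eventually_det_slCurve : ∀ᶠ v in 𝓝 0, (Matrix.of (slCurve v)).det = 1 := by
  filter_upwards [eventually_one_add_ne_zero 0] with v hv
  simp [slCurve, Matrix.det_fin_two]
  field_simp
  ring

theorem hasFDerivAt_slCurve :
    HasFDerivAt slCurve ((ContinuousLinearMap.fst ℂ (Fin 2 → Fin 2 → ℂ) ℂ) ∘L
      (LinearMap.toContinuousLinearMap lieElement)) 0 := by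
  have hp : ∀ i : Fin 4, HasFDerivAt (fun v : Fin 4 → ℂ => v i)
      (ContinuousLinearMap.proj (R := ℂ) (φ := fun _ : Fin 4 => ℂ) i) 0 :=
    fun i => hasFDerivAt_apply i 0
  rw [hasFDerivAt_pi']
  intro i
  rw [hasFDerivAt_pi']
  intro j
  fin_cases i <;> fin_cases j
  · refine ((hp 0).const_add 1).congr_fderiv ?_
    ext v; simp [lieElement]
  · refine (hp 1).congr_fderiv ?_
    ext v; simp [lieElement]
  · refine (hp 2).congr_fderiv ?_
    ext v; simp [lieElement]
  · have := ((((hp 1).mul (hp 2)).const_add 1).mul ((hasDerivAt_inv (x := (1 : ℂ)) (by simp)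
      |>.comp_hasFDerivAt_of_eq 0 ((hp 0).const_add 1) (by simp))))
    refine (this.congr_fderiv ?_)
    ext v; simp [lieElement]

/-- The gauge action is differentiable in the group element at the identity. -/
def ActDifferentiable (I : DeltaIntegral k m ι V) (x : ι → Spinor) : Prop :=
  DifferentiableAt ℂ (fun p : (Fin 2 → Fin 2 → ℂ) × ℂ => I.act (Matrix.of p.1) p.2 x)
    ((1 : Matrix (Fin 2) (Fin 2) ℂ), 1)

/-- Only the first-order jet of the group element matters, by the chain rule. The map U accommodates
a reparametrisation of the gauge group, needed when two integrals carry differently parametrised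
actions. -/
theorem hasFDerivAt_act_comp {I : DeltaIntegral k m ι V} {x : ι → Spinor}
    (hx : I.ActDifferentiable x) (U : (Fin 4 → ℂ) →L[ℂ] (Fin 4 → ℂ))
    (p : (Fin 4 → ℂ) → (Fin 2 → Fin 2 → ℂ) × ℂ) (hp0 : p 0 = ((1 : Matrix (Fin 2) (Fin 2) ℂ), 1))
    (hp : HasFDerivAt p ((LinearMap.toContinuousLinearMap lieElement) ∘L U) 0) :
    HasFDerivAt (fun v => I.act (Matrix.of (p v).1) (p v).2 x) (I.generators x ∘L U) 0 := by
  have key : I.generators x = (fderiv ℂ (fun p : (Fin 2 → Fin 2 → ℂ) × ℂ =>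
      I.act (Matrix.of p.1) p.2 x) ((1 : Matrix (Fin 2) (Fin 2) ℂ), 1)) ∘L
        (LinearMap.toContinuousLinearMap lieElement) := by
    have h1 : HasFDerivAt (fun v : Fin 4 → ℂ => (((1 : Matrix (Fin 2) (Fin 2) ℂ), (1 : ℂ)) :
        (Fin 2 → Fin 2 → ℂ) × ℂ) + (LinearMap.toContinuousLinearMap lieElement) v)
        (LinearMap.toContinuousLinearMap lieElement) 0 :=
      (ContinuousLinearMap.hasFDerivAt _).const_add _
    refine (hasFDerivAt_comp_of_eq (0 : Fin 4 → ℂ) hx.hasFDerivAt h1 (by simp)).fderiv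
  rw [key]
  exact hasFDerivAt_comp_of_eq (0 : Fin 4 → ℂ) hx.hasFDerivAt hp hp0

theorem hasFDerivAt_slCurve_prod : HasFDerivAt (fun v : Fin 4 → ℂ => (slCurve v, 1 + v 3))
    ((LinearMap.toContinuousLinearMap lieElement) ∘L ContinuousLinearMap.id ℂ _) 0 := by
  refine (hasFDerivAt_slCurve.prodMk ((hasFDerivAt_apply (3 : Fin 4) (0 : Fin 4 → ℂ)).const_add
    (1 : ℂ))).congr_fderiv ?_
  ext v <;> simp [lieElement]

theorem hasFDerivAt_act_slCurve {I : DeltaIntegral k m ι V} {x : ι → Spinor}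
    (hx : I.ActDifferentiable x) :
    HasFDerivAt (fun v => I.act (Matrix.of (slCurve v)) (1 + v 3) x) (I.generators x) 0 := by
  simpa using hasFDerivAt_act_comp hx _ _ (by ext <;> simp [slCurve_zero]) hasFDerivAt_slCurve_prod

/-- The delta-function arguments do not change along the gauge orbits. -/
theorem fderiv_args_generators {I : DeltaIntegral k m ι V} {κ : Kinematics k m} {x : ι → Spinor}
    (hx : I.ActDifferentiable x) (h1 : I.act 1 1 x = x) (hd : DifferentiableAt ℂ (I.args κ) x)
    (h : ∀ᶠ v in 𝓝 0, I.args κ (I.act (Matrix.of (slCurve v)) (1 + v 3) x) = I.args κ x)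
    (v : Fin 4 → ℂ) : fderiv ℂ (I.args κ) x (I.generators x v) = 0 := by
  have h2 := hasFDerivAt_comp_of_eq (0 : Fin 4 → ℂ) hd.hasFDerivAt (hasFDerivAt_act_slCurve hx)
    (by rw [slCurve_zero, Pi.zero_apply, add_zero]; exact h1)
  have h3 : HasFDerivAt (fun _ : Fin 4 → ℂ => I.args κ x) (fderiv ℂ (I.args κ) x ∘L I.generators x)
      0 := h2.congr_of_eventuallyEq (h.mono fun v hv => hv.symm)
  have := h3.unique (hasFDerivAt_const _ _)
  exact DFunLike.congr_fun this v

/-- The derivative along a line on which the function is affine. -/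
theorem fderiv_apply_of_affine {X Y : Type*} [NormedAddCommGroup X] [NormedSpace ℂ X]
    [NormedAddCommGroup Y] [NormedSpace ℂ Y] {f : X → Y} {x v : X} {w : Y}
    (hf : DifferentiableAt ℂ f x) (h : ∀ t : ℂ, f (x + t • v) = f x + t • w) :
    fderiv ℂ f x v = w := by
  have hl : HasDerivAt (fun t : ℂ => x + t • v) v 0 := by
    simpa using ((hasDerivAt_id (0 : ℂ)).smul_const v).const_add x
  have h2 := hf.hasFDerivAt.comp_hasDerivAt_of_eq (0 : ℂ) hl (by simp)
  have h3 : HasDerivAt (fun t : ℂ => f x + t • w) w 0 := by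
    simpa using ((hasDerivAt_id (0 : ℂ)).smul_const w).const_add (f x)
  exact h2.unique (h3.congr_of_eventuallyEq (Eventually.of_forall h))

/-! ### Elimination of auxiliary variables -/

/-- The splitting of the variables into two groups. -/
abbrev splitVars (α β : Type) : (α ⊕ β → Spinor) ≃ₗ[ℂ] (α → Spinor) × (β → Spinor) :=
  LinearEquiv.sumArrowLequivProdArrow α β ℂ Spinor

/-- The arguments of I' are M applied to the moduli conditions G and the arguments of I at ψ of the
remaining variables. At a solution both of these vanish, so the derivative of M drops out and the
linearisation is M times a block-triangular map: E is the derivative of G along the moduli, and the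
second row involves only I and the derivative C of ψ. The gauge actions match through U. Then
`linJacobian_change` removes M and C, and `linJacobian_lift` removes E. -/
theorem hasJacobian_iff_of_factorization
    (I : DeltaIntegral k m β V) (I' : DeltaIntegral k m (α ⊕ β) V') (κ : Kinematics k m)
    (x : α ⊕ β → Spinor) (G : Kinematics k m → (α ⊕ β → Spinor) → (α → Spinor))
    (ψ : (β → Spinor) → (β → Spinor))
    (M : (α ⊕ β → Spinor) → (α → Spinor) × (β → Spinor) →ₗ[ℂ] (α → Spinor) × (β → Spinor))
    (E : (α → Spinor) →ₗ[ℂ] (α → Spinor)) (C : (β → Spinor) →L[ℂ] (β → Spinor))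
    (U : (Fin 4 → ℂ) →L[ℂ] (Fin 4 → ℂ))
    (hfac : ∀ᶠ z in 𝓝 x, ∀ κ', splitVars α β (I'.args κ' z) =
      M z (G κ' z, I.args κ' (ψ (splitVars α β z).2)))
    (hM : ∀ v, ContinuousAt (fun z => M z v) x) (hMd : LinearMap.det (M x) ≠ 0)
    (hzero : I'.args κ x = 0) (hG : DifferentiableAt ℂ (G κ) x)
    (hGE : ∀ a, fderiv ℂ (G κ) x ((splitVars α β).symm (a, 0)) = E a)
    (hEd : LinearMap.det E ≠ 0)
    (hGκ : DifferentiableAt ℂ (fun κ' => G κ' x) κ)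
    (hψ : HasFDerivAt ψ C (splitVars α β x).2)
    (hCd : LinearMap.det (C : (β → Spinor) →ₗ[ℂ] (β → Spinor)) ≠ 0)
    (hF : DifferentiableAt ℂ (I.args κ) (ψ (splitVars α β x).2))
    (hFκ : DifferentiableAt ℂ (fun κ' => I.args κ' (ψ (splitVars α β x).2)) κ)
    (hact : I'.ActDifferentiable x) (hact1 : I'.act 1 1 x = x)
    (hinv : ∀ᶠ v in 𝓝 0, I'.args κ (I'.act (Matrix.of (slCurve v)) (1 + v 3) x) = 0)
    (hactI : I.ActDifferentiable (ψ (splitVars α β x).2))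
    (p : (Fin 4 → ℂ) → (Fin 2 → Fin 2 → ℂ) × ℂ) (hp0 : p 0 = ((1 : Matrix (Fin 2) (Fin 2) ℂ), 1))
    (hp : HasFDerivAt p ((LinearMap.toContinuousLinearMap lieElement) ∘L U) 0)
    (hequi : ∀ᶠ v in 𝓝 0, ψ (splitVars α β (I'.act (Matrix.of (slCurve v)) (1 + v 3) x)).2 =
      I.act (Matrix.of (p v).1) (p v).2 (ψ (splitVars α β x).2))
    (hU : LinearMap.det (U : (Fin 4 → ℂ) →ₗ[ℂ] (Fin 4 → ℂ)) = 1)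
    (hDg : ∀ v, fderiv ℂ (I.args κ) (ψ (splitVars α β x).2)
      (I.generators (ψ (splitVars α β x).2) v) = 0) (J : ℂ) :
    I'.HasJacobian κ x (LinearMap.det (M x) *
      LinearMap.det (C : (β → Spinor) →ₗ[ℂ] (β → Spinor)) * (LinearMap.det E * J)) ↔
      I.HasJacobian κ (ψ (splitVars α β x).2) J := by
  set S := splitVars α β
  set σ := ψ (S x).2 with hσ
  let Sc : (α ⊕ β → Spinor) ≃L[ℂ] (α → Spinor) × (β → Spinor) := S.toContinuousLinearEquiv
  have hSc : ∀ z, Sc z = S z := fun _ => rfl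
  have hMinj : Function.Injective (M x) := (LinearMap.equivOfDetNeZero _ hMd).injective
  -- Vanishing of the unmixed arguments is what makes the derivative insensitive to the variation of
  -- M.
  have hz : (G κ x, I.args κ σ) = 0 := hMinj (by
    rw [map_zero, ← hfac.self_of_nhds κ, hzero, map_zero])
  -- the derivative with respect to the variables
  have hy : HasFDerivAt (fun z => (Sc z).2) ((ContinuousLinearMap.snd ℂ _ _) ∘L
      (Sc : (α ⊕ β → Spinor) →L[ℂ] (α → Spinor) × (β → Spinor))) x :=
    ContinuousLinearMap.hasFDerivAt ((ContinuousLinearMap.snd ℂ _ _) ∘L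
      (Sc : (α ⊕ β → Spinor) →L[ℂ] (α → Spinor) × (β → Spinor)))
  have hFψ := hasFDerivAt_comp_of_eq x hF.hasFDerivAt (hasFDerivAt_comp_of_eq x hψ hy rfl) rfl
  have hD1 := hasFDerivAt_apply_of_eq_zero M _ _ x (hG.hasFDerivAt.prodMk hFψ) hz hM
  have hD2 := Sc.symm.hasFDerivAt.comp x hD1
  have h1 : HasFDerivAt (I'.args κ) _ x := hD2.congr_of_eventuallyEq (hfac.mono fun z hz => by
    have := hz κ
    rw [← hSc] at this
    exact (Sc.eq_symm_apply.2 this))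
  have hDg' : ∀ v, fderiv ℂ (I'.args κ) x (I'.generators x v) = 0 :=
    fderiv_args_generators hact hact1 h1.differentiableAt (hinv.mono fun v hv => by rw [hv, hzero])
  -- Differentiating the equivariance of ψ along the curve in the gauge group intertwines the two
  -- infinitesimal actions.
  have hg : ∀ v, C (S (I'.generators x v)).2 = I.generators σ (U v) := by
    have h0 : I'.act (Matrix.of (slCurve 0)) (1 + (0 : Fin 4 → ℂ) 3) x = x := by
      rw [slCurve_zero, Pi.zero_apply, add_zero]; exact hact1
    have e1 := hasFDerivAt_comp_of_eq (0 : Fin 4 → ℂ) (hasFDerivAt_comp_of_eq x hψ hy rfl)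
      (hasFDerivAt_act_slCurve hact) h0
    have e2 := (hasFDerivAt_act_comp hactI U p hp0 hp).congr_of_eventuallyEq hequi
    exact fun v => DFunLike.congr_fun (e1.unique e2) v
  have hD : ∀ z, S (fderiv ℂ (I'.args κ) x z) =
      M x (fderiv ℂ (G κ) x z, fderiv ℂ (I.args κ) σ (C (S z).2)) := by
    intro z
    rw [h1.fderiv]
    exact Sc.apply_symm_apply _
  have hK : ∀ y, S (fderiv ℂ (fun κ' => I'.args κ' x) κ y) =
      M x (fderiv ℂ (fun κ' => G κ' x) κ y, fderiv ℂ (fun κ' => I.args κ' σ) κ y) := by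
    intro y
    have h1 : (fun κ' => I'.args κ' x) = fun κ' => Sc.symm
        ((LinearMap.toContinuousLinearMap (M x)) (G κ' x, I.args κ' σ)) := by
      funext κ'
      exact Sc.eq_symm_apply.2 (hfac.self_of_nhds κ')
    have h2 := hasFDerivAt_comp_of_eq κ Sc.symm.hasFDerivAt (hasFDerivAt_comp_of_eq κ
      (LinearMap.toContinuousLinearMap (M x)).hasFDerivAt
        (hGκ.hasFDerivAt.prodMk hFκ.hasFDerivAt) rfl) rfl
    rw [h1, HasFDerivAt.fderiv h2]
    exact Sc.apply_symm_apply _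
  let Ce : (β → Spinor) ≃ₗ[ℂ] (β → Spinor) := LinearMap.equivOfDetNeZero _ hCd
  have hCe : ∀ y, Ce y = C y := fun _ => rfl
  let Ue : (Fin 4 → ℂ) ≃ₗ[ℂ] (Fin 4 → ℂ) :=
    LinearMap.equivOfDetNeZero (U : (Fin 4 → ℂ) →ₗ[ℂ] (Fin 4 → ℂ)) (by rw [hU]; exact one_ne_zero)
  have hUe : ∀ y, Ue y = U y := fun _ => rfl
  let N : (β → Spinor) →ₗ[ℂ] (α → Spinor) := (fderiv ℂ (G κ) x : _ →ₗ[ℂ] (α → Spinor)) ∘ₗ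
    (S.symm : _ →ₗ[ℂ] (α ⊕ β → Spinor)) ∘ₗ LinearMap.inr ℂ (α → Spinor) (β → Spinor)
  have hN : ∀ z, fderiv ℂ (G κ) x z = E (S z).1 + N (S z).2 := by
    intro z
    have h1 : z = S.symm ((S z).1, 0) + S.symm (0, (S z).2) := by
      rw [← map_add]
      simp
    conv_lhs => rw [h1, map_add, hGE]
    rfl
  let g₁ : (Fin 4 → ℂ) →ₗ[ℂ] (α → Spinor) := LinearMap.fst ℂ _ _ ∘ₗ
    (S : (α ⊕ β → Spinor) →ₗ[ℂ] (α → Spinor) × (β → Spinor)) ∘ₗ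
      (I'.generators x : (Fin 4 → ℂ) →ₗ[ℂ] (α ⊕ β → Spinor)) ∘ₗ (Ue.symm : _ →ₗ[ℂ] (Fin 4 → ℂ))
  have hdetC : LinearMap.det (((LinearEquiv.refl ℂ (α → Spinor)).prodCongr Ce :
      ((α → Spinor) × (β → Spinor)) ≃ₗ[ℂ] _) : (α → Spinor) × (β → Spinor) →ₗ[ℂ] _) =
      LinearMap.det (C : (β → Spinor) →ₗ[ℂ] (β → Spinor)) := by
    have h1 : (((LinearEquiv.refl ℂ (α → Spinor)).prodCongr Ce :
      ((α → Spinor) × (β → Spinor)) ≃ₗ[ℂ] _) : (α → Spinor) × (β → Spinor) →ₗ[ℂ] _) =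
        LinearMap.id.prodMap (C : (β → Spinor) →ₗ[ℂ] (β → Spinor)) := rfl
    rw [h1, LinearMap.det_prodMap, LinearMap.det_id, one_mul]
  rw [hasJacobian_iff, hasJacobian_iff,
    ← linJacobian_lift E hEd (N ∘ₗ (Ce.symm : (β → Spinor) →ₗ[ℂ] (β → Spinor))) _
      (fderiv ℂ (fun κ' => G κ' x) κ : Kinematics k m →ₗ[ℂ] (α → Spinor)) _ g₁,
    ← linJacobian_change (M x) ((LinearEquiv.refl ℂ (α → Spinor)).prodCongr Ce) Ue S hMd hU,
    hdetC]
  · intro z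
    simp only [ContinuousLinearMap.coe_coe]
    rw [hD, hN]
    congr 1
    have hz' : Ce.symm (C (S z).2) = (S z).2 := by rw [← hCe, LinearEquiv.symm_apply_apply]
    simp [blocks_apply, hCe, hz']
  · intro y
    exact hK y
  · intro v
    have h2 := hg v
    rw [← hUe, ← hCe] at h2
    have h3 : g₁ (Ue v) = (S (I'.generators x v)).1 := by simp [g₁]
    ext1
    · rw [LinearMap.prod_apply, Function.prod_apply, h3]; rfl
    · exact h2
  -- The compatibility required by the elimination is the moduli component of gauge invariance: the
  -- derivative of the arguments of I' kills the generators, and M at x is injective.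
  · refine LinearMap.ext fun w => ?_
    obtain ⟨v, rfl⟩ := Ue.surjective w
    have h3 : g₁ (Ue v) = (S (I'.generators x v)).1 := by simp [g₁]
    have h4 := hD (I'.generators x v)
    rw [hDg', map_zero, hN] at h4
    have h5 := congrArg Prod.fst (hMinj ((map_zero (M x)).trans h4))
    have h6 : Ce.symm (I.generators σ (Ue v)) = (S (I'.generators x v)).2 := by
      rw [LinearEquiv.symm_apply_eq, hCe, hg, hUe]
    simp only [LinearMap.add_apply, LinearMap.comp_apply, h3, ContinuousLinearMap.coe_coe,
      LinearEquiv.coe_coe, h6]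
    exact h5.symm
  · exact LinearMap.ext fun v => hDg v

end DeltaIntegral
end Ambitwistor

/-! ### Transfer of values along finite-to-one correspondences of gauge orbits. -/

namespace Ambitwistor
namespace DeltaIntegral

variable {k m : ℕ} {ι ι' V V' : Type}

open Classical in
/-- The Jacobian at a simple solution. -/
def jacobian (I : DeltaIntegral k m ι V) (κ : Kinematics k m) (x : ι → Spinor) : ℂ :=
  if h : ∃ J, I.HasJacobian κ x J then h.choose else 0

theorem HasJacobian.jacobian_eq {I : DeltaIntegral k m ι V} {κ : Kinematics k m} {x : ι → Spinor}
    {J : ℂ} (h : I.HasJacobian κ x J) : I.jacobian κ x = J := by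
  have h' : ∃ J, I.HasJacobian κ x J := ⟨J, h⟩
  rw [jacobian, dif_pos h']
  exact h'.choose_spec.unique h

variable [AddCommGroup V] [Module ℂ V] [AddCommGroup V'] [Module ℂ V']

/-- The contribution of the solution `x`. -/
def residue (I : DeltaIntegral k m ι V) (κ : Kinematics k m) (x : ι → Spinor) : V :=
  (I.jacobian κ x)⁻¹ • I.integrand x

/-- Jacobians are unique, so the function J chosen together with the set of representatives may be
replaced by one function of the solution. Different choices of representatives can then be compared.
-/
theorem hasValue_iff (I : DeltaIntegral k m ι V) (κ : Kinematics k m) (v : V) :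
    I.HasValue κ v ↔ ∃ s : Finset (ι → Spinor),
      (∀ x ∈ s, x ∈ I.solutions κ ∧ ∃ J, I.HasJacobian κ x J) ∧
      (∀ y ∈ I.solutions κ, ∃! x, x ∈ s ∧ I.GaugeEquiv x y) ∧ v = ∑ x ∈ s, I.residue κ x := by
  constructor
  · rintro ⟨s, J, h1, h2, h3⟩
    refine ⟨s, fun x hx => ⟨(h1 x hx).1, J x, (h1 x hx).2⟩, h2, h3.trans ?_⟩
    exact Finset.sum_congr rfl fun x hx => by rw [residue, (h1 x hx).2.jacobian_eq]
  · rintro ⟨s, h1, h2, h3⟩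
    refine ⟨s, I.jacobian κ, fun x hx => ⟨(h1 x hx).1, ?_⟩, h2, h3⟩
    obtain ⟨J, hJ⟩ := (h1 x hx).2
    rwa [hJ.jacobian_eq]

/-- A gauge-equivariant map from the solutions of `I'` to those of `I`, every fibre of which
consists of `d` gauge orbits, such that the contributions to the two integrals correspond. -/
structure Correspondence (I : DeltaIntegral k m ι V) (I' : DeltaIntegral k m ι' V')
    (κ : Kinematics k m) (f : V →ₗ[ℂ] V') (d : ℕ) where
  /-- the map of configurations -/
  toFun : (ι' → Spinor) → (ι → Spinor)
  /-- representatives of the gauge orbits over a solution -/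
  fiber : (ι → Spinor) → Finset (ι' → Spinor)
  equivalence : Equivalence I.GaugeEquiv
  mem_solutions : ∀ σ τ, σ ∈ I.solutions κ → I.GaugeEquiv σ τ → τ ∈ I.solutions κ
  residue_eq : ∀ σ τ J, σ ∈ I.solutions κ → I.GaugeEquiv σ τ → I.HasJacobian κ σ J →
    ∃ J', I.HasJacobian κ τ J' ∧ J'⁻¹ • I.integrand τ = J⁻¹ • I.integrand σ
  map_mem : ∀ x ∈ I'.solutions κ, toFun x ∈ I.solutions κ
  map_equiv : ∀ x ∈ I'.solutions κ, ∀ y ∈ I'.solutions κ, I'.GaugeEquiv x y →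
    I.GaugeEquiv (toFun x) (toFun y)
  symm' : ∀ x ∈ I'.solutions κ, ∀ y ∈ I'.solutions κ, I'.GaugeEquiv x y → I'.GaugeEquiv y x
  trans' : ∀ x ∈ I'.solutions κ, ∀ y ∈ I'.solutions κ, ∀ z ∈ I'.solutions κ,
    I'.GaugeEquiv x y → I'.GaugeEquiv y z → I'.GaugeEquiv x z
  d_ne_zero : d ≠ 0
  fiber_mem : ∀ σ ∈ I.solutions κ, ∀ x ∈ fiber σ, x ∈ I'.solutions κ
  fiber_equiv : ∀ σ ∈ I.solutions κ, ∀ x ∈ fiber σ, I.GaugeEquiv (toFun x) σ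
  fiber_card : ∀ σ ∈ I.solutions κ, (fiber σ).card = d
  fiber_inj : ∀ σ ∈ I.solutions κ, ∀ x ∈ fiber σ, ∀ y ∈ fiber σ, I'.GaugeEquiv x y → x = y
  fiber_surj : ∀ σ ∈ I.solutions κ, ∀ x ∈ I'.solutions κ, I.GaugeEquiv (toFun x) σ →
    ∃ y ∈ fiber σ, I'.GaugeEquiv y x
  jacobian_eq : ∀ x ∈ I'.solutions κ, ∃ e : ℂ, e ≠ 0 ∧
    (∀ J, I'.HasJacobian κ x (e * J) ↔ I.HasJacobian κ (toFun x) J) ∧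
    e⁻¹ • I'.integrand x = (d : ℂ)⁻¹ • f (I.integrand (toFun x))

namespace Correspondence

variable {I : DeltaIntegral k m ι V} {I' : DeltaIntegral k m ι' V'} {κ : Kinematics k m}
  {f : V →ₗ[ℂ] V'} {d : ℕ}

theorem exists_hasJacobian_iff (c : Correspondence I I' κ f d) (x : ι' → Spinor)
    (hx : x ∈ I'.solutions κ) :
    (∃ J, I'.HasJacobian κ x J) ↔ ∃ J, I.HasJacobian κ (c.toFun x) J := by
  obtain ⟨e, he, hJ, -⟩ := c.jacobian_eq x hx
  constructor
  · rintro ⟨J, h⟩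
    exact ⟨e⁻¹ * J, (hJ _).1 (by rwa [mul_inv_cancel_left₀ he])⟩
  · rintro ⟨J, h⟩
    exact ⟨e * J, (hJ _).2 h⟩

theorem residue_map (c : Correspondence I I' κ f d) (x : ι' → Spinor)
    (hx : x ∈ I'.solutions κ) (h : ∃ J, I.HasJacobian κ (c.toFun x) J) :
    I'.residue κ x = (d : ℂ)⁻¹ • f (I.residue κ (c.toFun x)) := by
  obtain ⟨J, h⟩ := h
  obtain ⟨e, he, hJ, hI⟩ := c.jacobian_eq x hx
  rw [residue, residue, h.jacobian_eq, ((hJ J).2 h).jacobian_eq, mul_inv_rev, mul_smul, hI,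
    map_smul, smul_comm]

theorem residue_equiv (c : Correspondence I I' κ f d) {σ τ : ι → Spinor}
    (hσ : σ ∈ I.solutions κ) (h : I.GaugeEquiv σ τ) (hJ : ∃ J, I.HasJacobian κ σ J) :
    (∃ J, I.HasJacobian κ τ J) ∧ I.residue κ τ = I.residue κ σ := by
  obtain ⟨J, hJ⟩ := hJ
  obtain ⟨J', hJ', he⟩ := c.residue_eq σ τ J hσ h hJ
  exact ⟨⟨J', hJ'⟩, by rw [residue, residue, hJ.jacobian_eq, hJ'.jacobian_eq, he]⟩

/-- The contributions of a fibre add up. -/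
theorem sum_fiber (c : Correspondence I I' κ f d) (v : V') :
    d • ((d : ℂ)⁻¹ • v) = v := by
  rw [← Nat.cast_smul_eq_nsmul ℂ, smul_smul, mul_inv_cancel₀, one_smul]
  exact Nat.cast_ne_zero.2 c.d_ne_zero

/-- The union of the fibres over the representatives is a system of representatives for I'. Each
fibre has d elements, each contributing 1/d of the image of the residue below. -/
theorem hasValue_map (c : Correspondence I I' κ f d) {v : V} (h : I.HasValue κ v) :
    I'.HasValue κ (f v) := by
  classical
  obtain ⟨s, h1, h2, rfl⟩ := (I.hasValue_iff κ v).1 h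
  have hs : ∀ σ ∈ s, ∀ x ∈ c.fiber σ, ∀ y ∈ I'.solutions κ, I'.GaugeEquiv x y →
      I.GaugeEquiv σ (c.toFun y) := fun σ hσ x hx y hy hxy =>
    c.equivalence.trans (c.equivalence.symm (c.fiber_equiv σ (h1 σ hσ).1 x hx))
      (c.map_equiv x (c.fiber_mem σ (h1 σ hσ).1 x hx) y hy hxy)
  have hJ : ∀ σ ∈ s, ∀ x ∈ c.fiber σ, (∃ J, I.HasJacobian κ (c.toFun x) J) ∧
      I.residue κ (c.toFun x) = I.residue κ σ := fun σ hσ x hx =>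
    c.residue_equiv (h1 σ hσ).1 (c.equivalence.symm (c.fiber_equiv σ (h1 σ hσ).1 x hx))
      (h1 σ hσ).2
  have hd : (s : Set (ι → Spinor)).PairwiseDisjoint c.fiber := by
    intro σ hσ τ hτ hne
    refine Finset.disjoint_left.2 fun x hx hx' => hne ?_
    have hx1 := c.map_mem x (c.fiber_mem σ (h1 σ hσ).1 x hx)
    exact (h2 _ hx1).unique
      ⟨hσ, c.equivalence.symm (c.fiber_equiv σ (h1 σ hσ).1 x hx)⟩
      ⟨hτ, c.equivalence.symm (c.fiber_equiv τ (h1 τ hτ).1 x hx')⟩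
  refine (I'.hasValue_iff κ _).2 ⟨s.biUnion c.fiber, ?_, ?_, ?_⟩
  · intro x hx
    obtain ⟨σ, hσ, hx⟩ := Finset.mem_biUnion.1 hx
    have hx' := c.fiber_mem σ (h1 σ hσ).1 x hx
    exact ⟨hx', (c.exists_hasJacobian_iff x hx').2 (hJ σ hσ x hx).1⟩
  · intro y hy
    obtain ⟨σ, ⟨hσ, hσy⟩, hu⟩ := h2 _ (c.map_mem y hy)
    obtain ⟨x, hx, hxy⟩ := c.fiber_surj σ (h1 σ hσ).1 y hy (c.equivalence.symm hσy)
    refine ⟨x, ⟨Finset.mem_biUnion.2 ⟨σ, hσ, hx⟩, hxy⟩, ?_⟩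
    rintro z ⟨hz, hzy⟩
    obtain ⟨τ, hτ, hz⟩ := Finset.mem_biUnion.1 hz
    obtain rfl : τ = σ := hu τ ⟨hτ, hs τ hτ z hz y hy hzy⟩
    have hz' := c.fiber_mem τ (h1 τ hσ).1 z hz
    have hx' := c.fiber_mem τ (h1 τ hσ).1 x hx
    exact c.fiber_inj τ (h1 τ hσ).1 z hz x hx
      (c.trans' z hz' y hy x hx' hzy (c.symm' x hx' y hy hxy))
  · rw [Finset.sum_biUnion hd, map_sum]
    refine Finset.sum_congr rfl fun σ hσ => ?_
    rw [Finset.sum_congr rfl fun x hx => (c.residue_map x (c.fiber_mem σ (h1 σ hσ).1 x hx)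
      (hJ σ hσ x hx).1).trans (by rw [(hJ σ hσ x hx).2]), Finset.sum_const,
      c.fiber_card σ (h1 σ hσ).1, c.sum_fiber]

/-- Conversely, representatives for I' are pushed forward to canonical representatives for I. All
orbits of I are reached because the fibres are nonempty, and exactly d of the given representatives
lie over each. -/
theorem exists_hasValue (c : Correspondence I I' κ f d) {w : V'} (h : I'.HasValue κ w) :
    ∃ v, I.HasValue κ v ∧ w = f v := by
  classical
  obtain ⟨s', h1, h2, rfl⟩ := (I'.hasValue_iff κ w).1 h
  -- A canonical representative of each orbit makes "lying over the same orbit" an equality, so that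
  -- the sum can be split with `Finset.sum_fiberwise_of_maps_to`.
  let S : Setoid (ι → Spinor) := ⟨I.GaugeEquiv, c.equivalence⟩
  let rep : (ι → Spinor) → (ι → Spinor) := fun σ => (Quotient.mk S σ).out
  have hrep : ∀ σ, I.GaugeEquiv (rep σ) σ := fun σ => Quotient.mk_out (s := S) σ
  have hrep' : ∀ σ τ, I.GaugeEquiv σ τ → rep σ = rep τ := fun σ τ h =>
    congrArg Quotient.out (Quotient.sound (s := S) h)
  let s := s'.image fun x => rep (c.toFun x)
  have hsol : ∀ x ∈ s', rep (c.toFun x) ∈ I.solutions κ := fun x hx =>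
    c.mem_solutions _ _ (c.map_mem x (h1 x hx).1) (c.equivalence.symm (hrep _))
  have hJ : ∀ x ∈ s', (∃ J, I.HasJacobian κ (rep (c.toFun x)) J) ∧
      I.residue κ (rep (c.toFun x)) = I.residue κ (c.toFun x) := fun x hx =>
    c.residue_equiv (c.map_mem x (h1 x hx).1) (c.equivalence.symm (hrep _))
      ((c.exists_hasJacobian_iff x (h1 x hx).1).1 (h1 x hx).2)
  refine ⟨∑ σ ∈ s, I.residue κ σ, (I.hasValue_iff κ _).2 ⟨s, ?_, ?_, rfl⟩, ?_⟩
  · intro σ hσ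
    obtain ⟨x, hx, rfl⟩ := Finset.mem_image.1 hσ
    exact ⟨hsol x hx, (hJ x hx).1⟩
  · intro τ hτ
    have hne : (c.fiber τ).Nonempty := by
      rw [← Finset.card_pos, c.fiber_card τ hτ]
      exact Nat.pos_of_ne_zero c.d_ne_zero
    obtain ⟨x, hx⟩ := hne
    have hx' := c.fiber_mem τ hτ x hx
    obtain ⟨z, ⟨hz, hzx⟩, -⟩ := h2 x hx'
    have hzτ : I.GaugeEquiv (c.toFun z) τ :=
      c.equivalence.trans (c.map_equiv z (h1 z hz).1 x hx' hzx) (c.fiber_equiv τ hτ x hx)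
    refine ⟨rep (c.toFun z), ⟨Finset.mem_image.2 ⟨z, hz, rfl⟩,
      c.equivalence.trans (hrep _) hzτ⟩, ?_⟩
    rintro σ ⟨hσ, hστ⟩
    obtain ⟨y, hy, rfl⟩ := Finset.mem_image.1 hσ
    exact hrep' _ _ (c.equivalence.trans (c.equivalence.trans (c.equivalence.symm (hrep _)) hστ)
      (c.equivalence.symm hzτ))
  · rw [map_sum, ← Finset.sum_fiberwise_of_maps_to (t := s) (g := fun x => rep (c.toFun x))
      fun x hx => Finset.mem_image_of_mem _ hx]
    refine Finset.sum_congr rfl fun σ hσ => ?_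
    have hσ' : σ ∈ I.solutions κ := by
      obtain ⟨x, hx, rfl⟩ := Finset.mem_image.1 hσ
      exact hsol x hx
    -- The given set and the fibre each contain exactly one member of every orbit above σ; sending a
    -- fibre element to the given representative of its orbit is a bijection.
    have hcard : (s'.filter fun x => rep (c.toFun x) = σ).card = d := by
      refine Eq.trans (Eq.symm ?_) (c.fiber_card σ hσ')
      choose! z hz hzu using h2
      refine Finset.card_bij (fun x _ => z x) ?_ ?_ ?_
      · intro x hx
        have hx' := c.fiber_mem σ hσ' x hx
        refine Finset.mem_filter.2 ⟨(hz x hx').1, ?_⟩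
        obtain ⟨y, hy, rfl⟩ := Finset.mem_image.1 hσ
        refine (hrep' _ _ (c.equivalence.trans (c.map_equiv _ (h1 _ (hz x hx').1).1 x hx'
          (hz x hx').2) (c.equivalence.trans (c.fiber_equiv _ hσ' x hx) (hrep _))))
      · intro x hx y hy hxy
        have hx' := c.fiber_mem σ hσ' x hx
        have hy' := c.fiber_mem σ hσ' y hy
        have hzx := hz x hx'
        have hzy := hz y hy'
        rw [← hxy] at hzy
        have hzs := (h1 _ hzx.1).1
        exact c.fiber_inj σ hσ' x hx y hy
          (c.trans' x hx' _ hzs y hy' (c.symm' _ hzs x hx' hzx.2) hzy.2)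
      · intro y hy
        obtain ⟨hy, hyσ⟩ := Finset.mem_filter.1 hy
        have hys := (h1 y hy).1
        obtain ⟨x, hx, hxy⟩ := c.fiber_surj σ hσ' y hys (by
          rw [← hyσ]; exact c.equivalence.symm (hrep _))
        have hx' := c.fiber_mem σ hσ' x hx
        exact ⟨x, hx, (hzu x hx' y ⟨hy, c.symm' x hx' y hys hxy⟩).symm⟩
    rw [Finset.sum_congr rfl fun x hx => ?_, Finset.sum_const, hcard, c.sum_fiber]
    obtain ⟨hx, hxσ⟩ := Finset.mem_filter.1 hx
    rw [← hxσ, c.residue_map x (h1 x hx).1 ((c.exists_hasJacobian_iff x (h1 x hx).1).1 (h1 x hx).2),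
      (hJ x hx).2]

end Correspondence
end DeltaIntegral
end Ambitwistor

namespace Ambitwistor

open Filter Topology

/-! ### Brackets -/

theorem br_self (a : Spinor) : br a a = 0 := by simp [br, mul_comm]

theorem br_swap (a b : Spinor) : br a b = -br b a := by simp [br]; ring

theorem br_smul_smul (s t : ℂ) (a b : Spinor) : br (s • a) (t • b) = s * t * br a b := by
  simp [br]; ring

theorem br_mulVec (h : Matrix (Fin 2) (Fin 2) ℂ) (a b : Spinor) :
    br (h.mulVec a) (h.mulVec b) = h.det * br a b := by
  simp [br, Matrix.mulVec, dotProduct, Fin.sum_univ_two, Matrix.det_fin_two]; ring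

theorem ne_zero_of_br_ne_zero {a b : Spinor} (h : br a b ≠ 0) : a ≠ 0 := by
  rintro rfl
  simp [br] at h

variable {k m : ℕ}

theorem parkeTaylor_smul (ω : Fin (k + m) ≃ Particle k m) (γ : Particle k m → ℂ)
    (σ : Particle k m → Spinor) :
    parkeTaylor ω (fun a => γ a • σ a) = (∏ a, γ a) ^ 2 * parkeTaylor ω σ := by
  simp only [parkeTaylor, br_smul_smul, Finset.prod_mul_distrib]
  have h := ((finRotate (k + m)).trans ω).prod_comp γ
  simp only [Equiv.trans_apply] at h
  rw [ω.prod_comp γ, h, sq]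

theorem parkeTaylor_mulVec (ω : Fin (k + m) ≃ Particle k m) (h : Matrix (Fin 2) (Fin 2) ℂ)
    (hh : h.det = 1) (σ : Particle k m → Spinor) :
    parkeTaylor ω (fun a => h.mulVec (σ a)) = parkeTaylor ω σ := by
  simp only [parkeTaylor, br_mulVec, hh, one_mul]

/-! ### The gauge action on marked points -/

/-- The weight of a particle under `GL(1)`. -/
def glWeight (c : ℂ) (a : Particle k m) : ℂ := Sum.elim (fun _ => c) (fun _ => c⁻¹) a

theorem actPoints_apply (h : Matrix (Fin 2) (Fin 2) ℂ) (c : ℂ) (σ : Particle k m → Spinor)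
    (a : Particle k m) : actPoints h c σ a = glWeight c a • h.mulVec (σ a) := by
  cases a <;> rfl

theorem glWeight_ne_zero {c : ℂ} (hc : c ≠ 0) (a : Particle k m) : glWeight c a ≠ 0 := by
  cases a <;> simp [glWeight, hc]

theorem glWeight_mul (c c' : ℂ) (a : Particle k m) :
    glWeight (c * c') a = glWeight c a * glWeight c' a := by
  cases a <;> simp [glWeight, mul_comm]

theorem actPoints_one (σ : Particle k m → Spinor) : actPoints 1 1 σ = σ := by
  funext a
  cases a <;> simp [actPoints]

theorem actPoints_actPoints (h h' : Matrix (Fin 2) (Fin 2) ℂ) (c c' : ℂ)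
    (σ : Particle k m → Spinor) :
    actPoints h c (actPoints h' c' σ) = actPoints (h * h') (c * c') σ := by
  funext a
  simp only [actPoints_apply, glWeight_mul, Matrix.mulVec_smul, Matrix.mulVec_mulVec, smul_smul]

theorem actPoints_inv {h : Matrix (Fin 2) (Fin 2) ℂ} {c : ℂ} (hh : h.det = 1) (hc : c ≠ 0)
    (σ : Particle k m → Spinor) : actPoints h.adjugate c⁻¹ (actPoints h c σ) = σ := by
  rw [actPoints_actPoints, Matrix.adjugate_mul, hh, one_smul, inv_mul_cancel₀ hc, actPoints_one]

theorem br_actPoints {h : Matrix (Fin 2) (Fin 2) ℂ} (hh : h.det = 1) (c : ℂ)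
    (σ : Particle k m → Spinor) (a b : Particle k m) :
    br (actPoints h c σ a) (actPoints h c σ b) =
      glWeight c a * glWeight c b * br (σ a) (σ b) := by
  rw [actPoints_apply, actPoints_apply, br_smul_smul, br_mulVec, hh, one_mul]

theorem br_actPoints_inl_inr {h : Matrix (Fin 2) (Fin 2) ℂ} (hh : h.det = 1) {c : ℂ}
    (hc : c ≠ 0) (σ : Particle k m → Spinor) (i : Fin k) (p : Fin m) :
    br (actPoints h c σ (Sum.inl i)) (actPoints h c σ (Sum.inr p)) =
      br (σ (Sum.inl i)) (σ (Sum.inr p)) := by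
  rw [br_actPoints hh]
  simp [glWeight, hc]

theorem br_actPoints_inr_inl {h : Matrix (Fin 2) (Fin 2) ℂ} (hh : h.det = 1) {c : ℂ}
    (hc : c ≠ 0) (σ : Particle k m → Spinor) (i : Fin k) (p : Fin m) :
    br (actPoints h c σ (Sum.inr p)) (actPoints h c σ (Sum.inl i)) =
      br (σ (Sum.inr p)) (σ (Sum.inl i)) := by
  rw [br_actPoints hh]
  simp [glWeight, hc]

/-- The gauge action of a group element as a linear map. -/
def actPointsLinear (h : Matrix (Fin 2) (Fin 2) ℂ) (c : ℂ) :
    (Particle k m → Spinor) →ₗ[ℂ] (Particle k m → Spinor) :=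
  LinearMap.pi fun a => (glWeight c a • Matrix.toLin' h) ∘ₗ LinearMap.proj a

theorem actPointsLinear_apply (h : Matrix (Fin 2) (Fin 2) ℂ) (c : ℂ) (σ : Particle k m → Spinor) :
    actPointsLinear h c σ = actPoints h c σ := by
  funext a
  simp [actPointsLinear, actPoints_apply]

theorem det_actPointsLinear {h : Matrix (Fin 2) (Fin 2) ℂ} (hh : h.det = 1) (c : ℂ) :
    LinearMap.det (actPointsLinear (k := k) (m := m) h c) =
      (∏ a : Particle k m, glWeight c a) ^ 2 := by
  rw [actPointsLinear, LinearMap.det_pi, ← Finset.prod_pow]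
  refine Finset.prod_congr rfl fun a _ => ?_
  rw [LinearMap.det_smul, LinearMap.det_toLin', hh]
  simp

/-! ### The adjoint action -/

/-- The conjugate of an element of `sl(2) × gl(1)` by the inverse of `h`. -/
def adjointAct (h : Matrix (Fin 2) (Fin 2) ℂ) : (Fin 4 → ℂ) →ₗ[ℂ] (Fin 4 → ℂ) :=
  Matrix.toLin' !![h 0 0 * h 1 1 + h 0 1 * h 1 0, h 1 0 * h 1 1, -(h 0 0 * h 0 1), 0;
    2 * h 0 1 * h 1 1, h 1 1 ^ 2, -h 0 1 ^ 2, 0;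
    -2 * h 0 0 * h 1 0, -h 1 0 ^ 2, h 0 0 ^ 2, 0; 0, 0, 0, 1]

/-- SL(2) is unimodular, so conjugation of the gauge algebra does not affect the Jacobian. -/
theorem det_adjointAct {h : Matrix (Fin 2) (Fin 2) ℂ} (hh : h.det = 1) :
    LinearMap.det (adjointAct h) = 1 := by
  have h2 : LinearMap.det (adjointAct h) = h.det ^ 3 := by
    rw [adjointAct, LinearMap.det_toLin', Matrix.det_fin_two]
    simp [Matrix.det_succ_row_zero, Fin.sum_univ_succ, Fin.succAbove]
    ring
  rw [h2, hh, one_pow]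

theorem mul_lieElement_adjointAct {h : Matrix (Fin 2) (Fin 2) ℂ} (hh : h.det = 1)
    (v : Fin 4 → ℂ) :
    h * Matrix.of (DeltaIntegral.lieElement (adjointAct h v)).1 =
      Matrix.of (DeltaIntegral.lieElement v).1 * h := by
  -- The entries of `adjointAct` are those of adj(h) X h, so without the determinant condition the
  -- identity holds with a factor det h, as an identity of polynomials.
  have h2 : h * Matrix.of (DeltaIntegral.lieElement (adjointAct h v)).1 =
      h.det • (Matrix.of (DeltaIntegral.lieElement v).1 * h) := by
    rw [Matrix.det_fin_two]
    ext i j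
    fin_cases i <;> fin_cases j <;>
    · simp [DeltaIntegral.lieElement, adjointAct, Matrix.mul_apply, Fin.sum_univ_succ,
        Matrix.vecMul, dotProduct]
      ring
  rw [h2, hh, one_smul]

theorem adjointAct_apply_three (h : Matrix (Fin 2) (Fin 2) ℂ) (v : Fin 4 → ℂ) :
    adjointAct h v 3 = v 3 := by
  simp [adjointAct, Matrix.mulVec, dotProduct, Fin.sum_univ_succ]

/-! ### The ambitwistor string -/

variable {N : ℕ} (ω : Fin (k + m) ≃ Particle k m)

theorem ambitwistor_equivalence : Equivalence (ambitwistor k m N ω).GaugeEquiv where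
  refl σ := ⟨1, 1, by simp, one_ne_zero, trivial, (actPoints_one σ).symm⟩
  symm := by
    rintro σ _ ⟨h, c, hh, hc, -, rfl⟩
    exact ⟨h.adjugate, c⁻¹, by simp [Matrix.det_adjugate, hh], inv_ne_zero hc, trivial,
      (actPoints_inv hh hc σ).symm⟩
  trans := by
    rintro σ _ _ ⟨h, c, hh, hc, -, rfl⟩ ⟨h', c', hh', hc', -, rfl⟩
    exact ⟨h' * h, c' * c, by simp [hh, hh'], mul_ne_zero hc' hc, trivial,
      actPoints_actPoints _ _ _ _ σ⟩

theorem actPoints_mem_domain {h : Matrix (Fin 2) (Fin 2) ℂ} {c : ℂ} (hh : h.det = 1) (hc : c ≠ 0)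
    {σ : Particle k m → Spinor} (hσ : σ ∈ (ambitwistor k m N ω).domain) :
    actPoints h c σ ∈ (ambitwistor k m N ω).domain := fun a b hab => by
  rw [br_actPoints hh]
  exact mul_ne_zero (mul_ne_zero (glWeight_ne_zero hc _) (glWeight_ne_zero hc _)) (hσ a b hab)

theorem ambitwistor_args_actPoints {h : Matrix (Fin 2) (Fin 2) ℂ} {c : ℂ} (hh : h.det = 1)
    (hc : c ≠ 0) (κ : Kinematics k m) (σ : Particle k m → Spinor) :
    (ambitwistor k m N ω).args κ (actPoints h c σ) = (ambitwistor k m N ω).args κ σ := by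
  funext a
  cases a <;> simp [ambitwistor, lamTildeField, lamField, br_actPoints_inl_inr hh hc,
    br_actPoints_inr_inl hh hc]

theorem actPoints_mem_solutions {h : Matrix (Fin 2) (Fin 2) ℂ} {c : ℂ} (hh : h.det = 1)
    (hc : c ≠ 0) {κ : Kinematics k m} {σ : Particle k m → Spinor}
    (hσ : σ ∈ (ambitwistor k m N ω).solutions κ) :
    actPoints h c σ ∈ (ambitwistor k m N ω).solutions κ :=
  ⟨actPoints_mem_domain ω hh hc hσ.1, by rw [ambitwistor_args_actPoints ω hh hc, hσ.2]⟩

theorem ambitwistor_mem_solutions (κ : Kinematics k m) (σ τ : Particle k m → Spinor)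
    (hσ : σ ∈ (ambitwistor k m N ω).solutions κ) (h : (ambitwistor k m N ω).GaugeEquiv σ τ) :
    τ ∈ (ambitwistor k m N ω).solutions κ := by
  obtain ⟨h, c, hh, hc, -, rfl⟩ := h
  exact actPoints_mem_solutions ω hh hc hσ

theorem br_differentiableAt {X : Type*} [NormedAddCommGroup X] [NormedSpace ℂ X]
    {f g : X → Spinor} {x : X} (hf : DifferentiableAt ℂ f x) (hg : DifferentiableAt ℂ g x) :
    DifferentiableAt ℂ (fun y => br (f y) (g y)) x := by
  have h1 := fun i => (differentiableAt_pi.1 hf i)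
  have h2 := fun i => (differentiableAt_pi.1 hg i)
  exact ((h1 1).mul (h2 0)).sub ((h1 0).mul (h2 1))

theorem ambitwistor_differentiableAt (κ : Kinematics k m) {σ : Particle k m → Spinor}
    (hσ : σ ∈ (ambitwistor k m N ω).domain) :
    DifferentiableAt ℂ ((ambitwistor k m N ω).args κ) σ := by
  have hp : ∀ a, DifferentiableAt ℂ (fun σ : Particle k m → Spinor => σ a) σ := fun a =>
    differentiableAt_apply a σ
  have hbr : ∀ a b, a ≠ b →
      DifferentiableAt ℂ (fun σ : Particle k m → Spinor => (br (σ a) (σ b))⁻¹) σ :=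
    fun a b hab => (br_differentiableAt (hp a) (hp b)).inv (hσ a b hab)
  refine differentiableAt_pi.2 fun a => ?_
  cases a with
  | inl i => exact (DifferentiableAt.fun_sum fun p _ =>
      (hbr (Sum.inl i) (Sum.inr p) (by simp)).smul_const _).const_sub _
  | inr p => exact (DifferentiableAt.fun_sum fun i _ =>
      (hbr (Sum.inr p) (Sum.inl i) (by simp)).smul_const _).const_sub _

theorem ambitwistor_differentiableAt_kinematics (κ : Kinematics k m) (σ : Particle k m → Spinor) :
    DifferentiableAt ℂ (fun κ' => (ambitwistor k m N ω).args κ' σ) κ := by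
  have h1 : ∀ a, DifferentiableAt ℂ (fun κ : Kinematics k m => κ.1 a) κ := fun a => by fun_prop
  have h2 : ∀ a, DifferentiableAt ℂ (fun κ : Kinematics k m => κ.2 a) κ := fun a => by fun_prop
  refine differentiableAt_pi.2 fun a => ?_
  cases a with
  | inl i => exact (h2 _).sub (DifferentiableAt.fun_sum fun p _ => (h2 _).fun_const_smul _)
  | inr p => exact (h1 _).sub (DifferentiableAt.fun_sum fun p _ => (h1 _).fun_const_smul _)

theorem actPoints_differentiableAt {X : Type*} [NormedAddCommGroup X] [NormedSpace ℂ X]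
    {h : X → Fin 2 → Fin 2 → ℂ} {c : X → ℂ} {x : X} (hh : DifferentiableAt ℂ h x)
    (hc : DifferentiableAt ℂ c x) (hc0 : c x ≠ 0) (σ : Particle k m → Spinor) :
    DifferentiableAt ℂ (fun y => actPoints (Matrix.of (h y)) (c y) σ) x := by
  have h1 : ∀ a : Particle k m,
      DifferentiableAt ℂ (fun y => (Matrix.of (h y)).mulVec (σ a)) x := by
    intro a
    refine differentiableAt_pi.2 fun i => ?_
    have h2 : (fun y => (Matrix.of (h y)).mulVec (σ a) i) = fun y => ∑ j, h y i j * σ a j := rfl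
    rw [h2]
    exact DifferentiableAt.fun_sum fun j _ =>
      (differentiableAt_pi.1 (differentiableAt_pi.1 hh i) j).mul_const _
  refine differentiableAt_pi.2 fun a => ?_
  cases a with
  | inl i => exact hc.smul (h1 _)
  | inr p => exact (hc.inv hc0).smul (h1 _)

theorem ambitwistor_actDifferentiable (σ : Particle k m → Spinor) :
    (ambitwistor k m N ω).ActDifferentiable σ :=
  actPoints_differentiableAt (X := (Fin 2 → Fin 2 → ℂ) × ℂ) (h := Prod.fst) (c := Prod.snd)
    differentiableAt_fst differentiableAt_snd one_ne_zero σ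

/-- The action is differentiated along a ray in the Lie algebra. The weight -1 of R enters through
the derivative of the inverse at 1. The explicit form allows the generators at two points of an
orbit to be compared. -/
theorem ambitwistor_generators (σ : Particle k m → Spinor) (v : Fin 4 → ℂ) (a : Particle k m) :
    (ambitwistor k m N ω).generators σ v a =
      (Matrix.of (DeltaIntegral.lieElement v).1).mulVec (σ a) +
        (Sum.elim (fun _ => v 3) (fun _ => -v 3) a : ℂ) • σ a := by
  have h1 := DeltaIntegral.hasFDerivAt_act_comp (ambitwistor_actDifferentiable (N := N) ω σ)
    (ContinuousLinearMap.id ℂ _)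
    (fun v => (((1 : Matrix (Fin 2) (Fin 2) ℂ), 1) : (Fin 2 → Fin 2 → ℂ) × ℂ) +
      LinearMap.toContinuousLinearMap DeltaIntegral.lieElement v) (by rw [map_zero, add_zero]; rfl)
    ((ContinuousLinearMap.hasFDerivAt _).const_add _)
  have hl : HasDerivAt (fun t : ℂ => t • v) v 0 := by
    simpa using (hasDerivAt_id (0 : ℂ)).smul_const v
  have h2 := HasFDerivAt.comp_hasDerivAt_of_eq (0 : ℂ) h1 hl (by simp)
  have h3 := hasDerivAt_pi.1 h2 a
  refine h3.unique ?_
  have h4 : HasDerivAt (fun t : ℂ => σ a + t • (Matrix.of (DeltaIntegral.lieElement v).1).mulVec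
      (σ a)) ((Matrix.of (DeltaIntegral.lieElement v).1).mulVec (σ a)) 0 := by
    simpa using ((hasDerivAt_id (0 : ℂ)).smul_const
      ((Matrix.of (DeltaIntegral.lieElement v).1).mulVec (σ a))).const_add (σ a)
  have h6 : HasDerivAt (fun t : ℂ => 1 + t * v 3) (v 3) 0 := by
    simpa using ((hasDerivAt_id (0 : ℂ)).mul_const (v 3)).const_add 1
  have h5 : HasDerivAt (fun t : ℂ => glWeight (1 + t * v 3) a)
      (Sum.elim (fun _ => v 3) (fun _ => -v 3) a : ℂ) 0 := by
    cases a with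
    | inl i => exact h6
    | inr p => simpa [glWeight] using h6.fun_inv (by simp)
  have h7 := h5.smul h4
  refine (h7.congr_deriv ?_).congr_of_eventuallyEq (Eventually.of_forall fun t => ?_)
  · cases a <;> simp [glWeight]
  · have h8 : (1 + t • Matrix.of (DeltaIntegral.lieElement v).1).mulVec (σ a) =
        σ a + t • (Matrix.of (DeltaIntegral.lieElement v).1).mulVec (σ a) := by
      rw [Matrix.add_mulVec, Matrix.smul_mulVec, Matrix.one_mulVec]
    simp only [Function.comp_apply, map_smul]
    exact (actPoints_apply (1 + t • Matrix.of (DeltaIntegral.lieElement v).1) (1 + t * v 3) σ a).trans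
      (congrArg _ h8)

theorem ambitwistor_fderiv_generators (κ : Kinematics k m) {σ : Particle k m → Spinor}
    (hσ : σ ∈ (ambitwistor k m N ω).domain) (v : Fin 4 → ℂ) :
    fderiv ℂ ((ambitwistor k m N ω).args κ) σ ((ambitwistor k m N ω).generators σ v) = 0 := by
  refine DeltaIntegral.fderiv_args_generators (ambitwistor_actDifferentiable ω σ)
    (actPoints_one σ) (ambitwistor_differentiableAt ω κ hσ) ?_ v
  filter_upwards [DeltaIntegral.eventually_det_slCurve,
    DeltaIntegral.eventually_one_add_ne_zero 3] with v hv hv'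
  exact ambitwistor_args_actPoints ω hv hv' κ σ

/-- Each point occurs in two Parke–Taylor brackets, whence the square. The fermionic part is
invariant because it contains only brackets between L and R, whose weights cancel. -/
theorem ambitwistor_integrand_actPoints {h : Matrix (Fin 2) (Fin 2) ℂ} {c : ℂ} (hh : h.det = 1)
    (hc : c ≠ 0) (σ : Particle k m → Spinor) :
    (ambitwistor k m N ω).integrand (actPoints h c σ) =
      ((∏ a : Particle k m, glWeight c a) ^ 2)⁻¹ • (ambitwistor k m N ω).integrand σ := by
  have h1 : parkeTaylor ω (actPoints h c σ) =
      (∏ a : Particle k m, glWeight c a) ^ 2 * parkeTaylor ω σ := by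
    rw [show actPoints h c σ = fun a => glWeight c a • h.mulVec (σ a) from
      funext fun a => actPoints_apply h c σ a, parkeTaylor_smul, parkeTaylor_mulVec ω h hh]
  simp only [ambitwistor, h1, chiField, br_actPoints_inr_inl hh hc, smul_smul, mul_inv]

/-- The group element acts linearly on the points, so the Jacobian changes by the inverse of its
determinant. This is the same factor by which the integrand changes, so the residue depends only on
the orbit. -/
theorem ambitwistor_residue_eq (κ : Kinematics k m) (σ τ : Particle k m → Spinor) (J : ℂ)
    (hσ : σ ∈ (ambitwistor k m N ω).solutions κ) (h : (ambitwistor k m N ω).GaugeEquiv σ τ)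
    (hJ : (ambitwistor k m N ω).HasJacobian κ σ J) :
    ∃ J', (ambitwistor k m N ω).HasJacobian κ τ J' ∧
      J'⁻¹ • (ambitwistor k m N ω).integrand τ = J⁻¹ • (ambitwistor k m N ω).integrand σ := by
  obtain ⟨h, c, hh, hc, -, rfl⟩ := h
  set w : ℂ := ∏ a : Particle k m, glWeight c a
  have hw : w ≠ 0 := Finset.prod_ne_zero_iff.2 fun a _ => glWeight_ne_zero hc a
  have hdet : LinearMap.det (actPointsLinear (k := k) (m := m) h c) = w ^ 2 :=
    det_actPointsLinear hh c
  let A := LinearMap.equivOfDetNeZero (actPointsLinear (k := k) (m := m) h c)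
    (by rw [hdet]; exact pow_ne_zero 2 hw)
  have hA : ∀ x, A x = actPoints h c x := actPointsLinear_apply h c
  let U := LinearMap.equivOfDetNeZero (adjointAct h)
    (by rw [det_adjointAct hh]; exact one_ne_zero)
  have hU : ∀ v, U v = adjointAct h v := fun _ => rfl
  have hτ : actPoints h c σ ∈ (ambitwistor k m N ω).domain := actPoints_mem_domain ω hh hc hσ.1
  have hdA : LinearMap.det (A.symm : (Particle k m → Spinor) →ₗ[ℂ] _) = (w ^ 2)⁻¹ := by
    refine eq_inv_of_mul_eq_one_left ?_
    rw [← hdet]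
    exact LinearEquiv.det_symm_mul_det A
  refine ⟨(w ^ 2)⁻¹ * J, ?_, ?_⟩
  · rw [DeltaIntegral.hasJacobian_iff] at hJ ⊢
    -- The delta functions are invariant, so M is the identity; the variables change by the inverse
    -- of the group element, and the gauge algebra by conjugation.
    have key := linJacobian_change LinearMap.id A.symm U
      (LinearEquiv.refl ℂ (Particle k m → Spinor))
      (by rw [LinearMap.det_id]; exact one_ne_zero) (det_adjointAct hh) _ _ _ _
      (fderiv ℂ ((ambitwistor k m N ω).args κ) (actPoints h c σ) :
        (Particle k m → Spinor) →ₗ[ℂ] _)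
      (fderiv ℂ (fun κ' => (ambitwistor k m N ω).args κ' (actPoints h c σ)) κ :
        Kinematics k m →ₗ[ℂ] _)
      ((ambitwistor k m N ω).generators (actPoints h c σ) : (Fin 4 → ℂ) →ₗ[ℂ] _)
      ?_ ?_ ?_ J |>.2 hJ
    · rwa [LinearMap.det_id, hdA, one_mul] at key
    · intro x
      obtain ⟨y, rfl⟩ := A.surjective x
      simp only [LinearEquiv.refl_apply, LinearEquiv.symm_apply_apply, LinearMap.id_apply,
        ContinuousLinearMap.coe_coe]
      let Ac := LinearMap.toContinuousLinearMap (actPointsLinear (k := k) (m := m) h c)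
      have h2 : HasFDerivAt (fun x => (ambitwistor k m N ω).args κ (Ac x))
          (fderiv ℂ ((ambitwistor k m N ω).args κ) (actPoints h c σ) ∘L Ac) σ :=
        hasFDerivAt_comp_of_eq σ (ambitwistor_differentiableAt ω κ hτ).hasFDerivAt
          Ac.hasFDerivAt (hA σ)
      have h3 : (fun x => (ambitwistor k m N ω).args κ (Ac x)) = (ambitwistor k m N ω).args κ :=
        funext fun x => by
          rw [show Ac x = actPoints h c x from hA x, ambitwistor_args_actPoints ω hh hc]
      rw [h3] at h2
      rw [h2.fderiv]
      rfl
    · intro y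
      simp only [ambitwistor_args_actPoints ω hh hc]
      rfl
    · intro v
      rw [LinearEquiv.symm_apply_eq, hA, hU]
      funext a
      simp only [LinearEquiv.refl_apply, ContinuousLinearMap.coe_coe]
      rw [actPoints_apply, ambitwistor_generators, ambitwistor_generators, adjointAct_apply_three,
        actPoints_apply, Matrix.mulVec_add, Matrix.mulVec_mulVec, mul_lieElement_adjointAct hh,
        Matrix.mulVec_smul, Matrix.mulVec_smul, Matrix.mulVec_mulVec, smul_add, smul_comm]
  · change ((w ^ 2)⁻¹ * J)⁻¹ • (ambitwistor k m N ω).integrand (actPoints h c σ) = _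
    rw [ambitwistor_integrand_actPoints ω hh hc, smul_smul]
    congr 1
    change ((w ^ 2)⁻¹ * J)⁻¹ * (w ^ 2)⁻¹ = J⁻¹
    field_simp

end Ambitwistor

namespace Ambitwistor

open Filter Topology

variable {k m : ℕ}

/-! ### The map from Witten's marked points to those of the ambitwistor string -/

/-- The product of the brackets of `u_a` with the points of the other kind. -/
def crossProd (u : Particle k m → Spinor) : Particle k m → ℂ
  | Sum.inl l => ∏ p : Fin m, br (u (Sum.inr p)) (u (Sum.inl l))
  | Sum.inr r => ∏ j : Fin k, br (u (Sum.inl j)) (u (Sum.inr r))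

/-- The rescaling that turns Witten's marked points into those of the ambitwistor string. -/
def wittenScale (u : Particle k m → Spinor) : Particle k m → ℂ
  | Sum.inl l => (crossProd u (Sum.inl l))⁻¹
  | Sum.inr r => -(crossProd u (Sum.inr r))⁻¹

/-- The marked points of the ambitwistor string that correspond to those of Witten's formula. -/
def wittenMap (u : Particle k m → Spinor) (a : Particle k m) : Spinor := wittenScale u a • u a

theorem crossProd_ne_zero {u : Particle k m → Spinor} (hu : ∀ a b, a ≠ b → br (u a) (u b) ≠ 0)
    (a : Particle k m) : crossProd u a ≠ 0 := by
  cases a with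
  | inl l => exact Finset.prod_ne_zero_iff.2 fun p _ => hu _ _ (by simp)
  | inr r => exact Finset.prod_ne_zero_iff.2 fun p _ => hu _ _ (by simp)

theorem wittenScale_ne_zero {u : Particle k m → Spinor} (hu : ∀ a b, a ≠ b → br (u a) (u b) ≠ 0)
    (a : Particle k m) : wittenScale u a ≠ 0 := by
  cases a with
  | inl l => exact inv_ne_zero (crossProd_ne_zero hu _)
  | inr r => exact neg_ne_zero.2 (inv_ne_zero (crossProd_ne_zero hu _))

theorem crossProd_smul (γ : Particle k m → ℂ) (u : Particle k m → Spinor) (a : Particle k m) :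
    crossProd (fun b => γ b • u b) a = (Sum.elim
      (fun l => (∏ p, γ (Sum.inr p)) * γ (Sum.inl l) ^ m)
      (fun r => (∏ j, γ (Sum.inl j)) * γ (Sum.inr r) ^ k) a : ℂ) * crossProd u a := by
  cases a <;> simp [crossProd, br_smul_smul, Finset.prod_mul_distrib]

/-- Only brackets between L and R enter, and these have weight zero. -/
theorem crossProd_actPoints {h : Matrix (Fin 2) (Fin 2) ℂ} (hh : h.det = 1) {c : ℂ}
    (hc : c ≠ 0) (u : Particle k m → Spinor) (a : Particle k m) :
    crossProd (actPoints h c u) a = crossProd u a := by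
  cases a <;> simp [crossProd, br_actPoints_inl_inr hh hc, br_actPoints_inr_inl hh hc]

theorem wittenMap_actPoints {h : Matrix (Fin 2) (Fin 2) ℂ} (hh : h.det = 1) {c : ℂ}
    (hc : c ≠ 0) (u : Particle k m → Spinor) :
    wittenMap (actPoints h c u) = actPoints h c (wittenMap u) := by
  funext a
  have h1 : wittenScale (actPoints h c u) a = wittenScale u a := by
    cases a <;> simp only [wittenScale, crossProd_actPoints hh hc]
  rw [actPoints_apply, wittenMap, wittenMap, h1, actPoints_apply, Matrix.mulVec_smul, smul_comm]

theorem wittenMap_mem_domain {u : Particle k m → Spinor}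
    (hu : ∀ a b, a ≠ b → br (u a) (u b) ≠ 0) (a b : Particle k m) (hab : a ≠ b) :
    br (wittenMap u a) (wittenMap u b) ≠ 0 := by
  rw [wittenMap, wittenMap, br_smul_smul]
  exact mul_ne_zero (mul_ne_zero (wittenScale_ne_zero hu a) (wittenScale_ne_zero hu b)) (hu a b hab)

theorem prod_differentiableAt {ι X : Type*} [NormedAddCommGroup X] [NormedSpace ℂ X]
    {f : ι → X → ℂ} {x : X} (s : Finset ι) (h : ∀ i, DifferentiableAt ℂ (f i) x) :
    DifferentiableAt ℂ (fun y => ∏ i ∈ s, f i y) x := by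
  classical
  induction s using Finset.induction_on with
  | empty => simp
  | insert a s ha ih => simpa only [Finset.prod_insert ha] using (h a).fun_mul ih

theorem wittenScale_differentiableAt {u : Particle k m → Spinor}
    (hu : ∀ a b, a ≠ b → br (u a) (u b) ≠ 0) (a : Particle k m) :
    DifferentiableAt ℂ (fun u : Particle k m → Spinor => wittenScale u a) u := by
  have hbr : ∀ a b, DifferentiableAt ℂ (fun u : Particle k m → Spinor => br (u a) (u b)) u :=
    fun a b => br_differentiableAt (differentiableAt_apply a u) (differentiableAt_apply b u)
  cases a with
  | inl l =>
    have h : DifferentiableAt ℂ (fun u : Particle k m → Spinor =>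
        ∏ p : Fin m, br (u (Sum.inr p)) (u (Sum.inl l))) u :=
      prod_differentiableAt _ fun p => hbr _ _
    exact h.inv (crossProd_ne_zero hu (Sum.inl l))
  | inr r =>
    have h : DifferentiableAt ℂ (fun u : Particle k m → Spinor =>
        ∏ j : Fin k, br (u (Sum.inl j)) (u (Sum.inr r))) u :=
      prod_differentiableAt _ fun p => hbr _ _
    exact (h.inv (crossProd_ne_zero hu (Sum.inr r))).fun_neg

/-- The logarithmic derivative of `wittenScale` under rescalings of the points. -/
def wittenWeights (c : Particle k m → ℂ) : Particle k m → ℂ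
  | Sum.inl l => -(m * c (Sum.inl l) + ∑ p, c (Sum.inr p))
  | Sum.inr r => -(k * c (Sum.inr r) + ∑ j, c (Sum.inl j))

theorem hasDerivAt_prod_one_add {ι : Type} [Fintype ι] (c : ι → ℂ) :
    HasDerivAt (fun t : ℂ => ∏ i, (1 + t * c i)) (∑ i, c i) 0 := by
  classical
  have h1 : ∀ i, HasDerivAt (fun t : ℂ => 1 + t * c i) (c i) 0 := fun i => by
    simpa using ((hasDerivAt_id (0 : ℂ)).mul_const (c i)).const_add 1
  have := HasDerivAt.fun_finsetProd (u := Finset.univ) fun i _ => h1 i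
  simpa using this

/-- An Euler identity: `wittenScale` is multihomogeneous under independent rescalings of the points,
and `wittenWeights` records its degrees. -/
theorem fderiv_wittenScale {u : Particle k m → Spinor}
    (hu : ∀ a b, a ≠ b → br (u a) (u b) ≠ 0) (a : Particle k m) (c : Particle k m → ℂ) :
    fderiv ℂ (fun u : Particle k m → Spinor => wittenScale u a) u (fun b => c b • u b) =
      wittenWeights c a * wittenScale u a := by
  have hl : HasDerivAt (fun t : ℂ => u + t • fun b => c b • u b) (fun b => c b • u b) 0 := by
    simpa using ((hasDerivAt_id (0 : ℂ)).smul_const (fun b => c b • u b)).const_add u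
  have h2 := (wittenScale_differentiableAt hu a).hasFDerivAt.comp_hasDerivAt_of_eq (0 : ℂ) hl
    (by simp)
  have h1 : ∀ i, HasDerivAt (fun t : ℂ => 1 + t * c i) (c i) 0 := fun i => by
    simpa using ((hasDerivAt_id (0 : ℂ)).mul_const (c i)).const_add 1
  have hlu : ∀ t : ℂ, (u + t • fun b => c b • u b) = fun b => (1 + t * c b) • u b := fun t => by
    funext b
    simp only [Pi.add_apply, Pi.smul_apply]
    module
  refine h2.unique ?_
  cases a with
  | inl l =>
    have h3 := (((hasDerivAt_prod_one_add fun p : Fin m => c (Sum.inr p)).mul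
      ((h1 (Sum.inl l)).pow m)).fun_inv (by simp)).mul_const (wittenScale u (Sum.inl l))
    refine (h3.congr_deriv ?_).congr_of_eventuallyEq (Eventually.of_forall fun t => ?_)
    · simp [wittenWeights]; left; ring
    · simp [hlu, wittenScale, crossProd_smul]; ring
  | inr r =>
    have h3 := (((hasDerivAt_prod_one_add fun p : Fin k => c (Sum.inl p)).mul
      ((h1 (Sum.inr r)).pow k)).fun_inv (by simp)).mul_const (wittenScale u (Sum.inr r))
    refine (h3.congr_deriv ?_).congr_of_eventuallyEq (Eventually.of_forall fun t => ?_)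
    · simp [wittenWeights]; left; ring
    · simp [hlu, wittenScale, crossProd_smul]; ring

/-- The derivative of a map that rescales the points. -/
def scaleDeriv (γ : Particle k m → ℂ) (dγ : Particle k m → (Particle k m → Spinor) →L[ℂ] ℂ)
    (u : Particle k m → Spinor) : (Particle k m → Spinor) →L[ℂ] (Particle k m → Spinor) :=
  ContinuousLinearMap.pi fun a =>
    γ a • ContinuousLinearMap.proj (R := ℂ) (φ := fun _ => Spinor) a + (dγ a).smulRight (u a)

theorem hasFDerivAt_wittenMap {u : Particle k m → Spinor}
    (hu : ∀ a b, a ≠ b → br (u a) (u b) ≠ 0) :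
    HasFDerivAt wittenMap (scaleDeriv (wittenScale u)
      (fun a => fderiv ℂ (fun u : Particle k m → Spinor => wittenScale u a) u) u) u := by
  refine hasFDerivAt_pi.2 fun a => ?_
  exact (wittenScale_differentiableAt hu a).hasFDerivAt.smul (hasFDerivAt_apply a u)

/-- The derivative is diag(γ) times 1 + UV, where V takes the logarithmic derivative of the scales
and U turns a logarithmic rescaling into a displacement along u. Since VU = W, the
Weinstein–Aronszajn identity reduces a determinant on spinors to one on scales. The square of ∏γ
reflects the two components of each spinor. -/
theorem det_scaleDeriv {γ : Particle k m → ℂ}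
    {dγ : Particle k m → (Particle k m → Spinor) →L[ℂ] ℂ} {u : Particle k m → Spinor}
    (hγ : ∀ a, γ a ≠ 0) (W : (Particle k m → ℂ) →ₗ[ℂ] (Particle k m → ℂ))
    (h : ∀ a c, dγ a (fun b => c b • u b) = W c a * γ a) :
    LinearMap.det (scaleDeriv γ dγ u : (Particle k m → Spinor) →ₗ[ℂ] _) =
      (∏ a, γ a) ^ 2 * LinearMap.det (LinearMap.id + W) := by
  let V : (Particle k m → Spinor) →ₗ[ℂ] (Particle k m → ℂ) :=
    LinearMap.pi fun a => (γ a)⁻¹ • (dγ a : (Particle k m → Spinor) →ₗ[ℂ] ℂ)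
  let U : (Particle k m → ℂ) →ₗ[ℂ] (Particle k m → Spinor) :=
    LinearMap.pi fun a => (LinearMap.proj a).smulRight (u a)
  have h1 : (scaleDeriv γ dγ u : (Particle k m → Spinor) →ₗ[ℂ] _) =
      (LinearMap.pi fun a => (γ a • (LinearMap.id : Spinor →ₗ[ℂ] Spinor)) ∘ₗ LinearMap.proj a) ∘ₗ
        (LinearMap.id + U ∘ₗ V) := by
    refine LinearMap.ext fun δ => funext fun a => ?_
    simp [scaleDeriv, U, V, smul_smul, mul_inv_cancel_left₀ (hγ a)]
  have h2 : V ∘ₗ U = W := by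
    refine LinearMap.ext fun c => funext fun a => ?_
    have h3 : U c = fun b => c b • u b := rfl
    have h4 : V (U c) a = (γ a)⁻¹ * dγ a (U c) := rfl
    rw [LinearMap.comp_apply, h4, h3, h]
    field_simp [hγ a]
  rw [h1, LinearMap.det_comp, det_one_add_comp_comm, h2, LinearMap.det_pi, ← Finset.prod_pow]
  congr 1
  refine Finset.prod_congr rfl fun a _ => ?_
  rw [LinearMap.det_smul, LinearMap.det_id]
  simp

/-- `wittenWeights` as a linear map. -/
def wittenWeightsLinear (k m : ℕ) : (Particle k m → ℂ) →ₗ[ℂ] (Particle k m → ℂ) where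
  toFun := wittenWeights
  map_add' c c' := by
    funext a
    cases a <;> simp [wittenWeights, Finset.sum_add_distrib] <;> ring
  map_smul' s c := by
    funext a
    cases a <;> simp [wittenWeights, ← Finset.mul_sum] <;> ring

/-- The number of gauge orbits of Witten's formula over one of the ambitwistor string. -/
def wittenDegree (k m : ℕ) : ℕ := (m - 1) ^ (k - 1) * (k - 1) ^ (m - 1) * (k + m - 1)

/-- The map is diagonal plus rank two: besides each scale itself, only the sums over L and over R
enter. The diagonal entries are 1-m on L and 1-k on R, both nonzero by hypothesis, and the rest is
the 2×2 determinant 1 - km/((k-1)(m-1)), which equals -(k+m-1)/((k-1)(m-1)). -/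
theorem det_one_add_wittenWeightsLinear (hk : 2 ≤ k) (hm : 2 ≤ m) :
    LinearMap.det (LinearMap.id + wittenWeightsLinear k m) =
      (-1) ^ (k + m - 1) * (wittenDegree k m : ℂ) := by
  obtain ⟨k, rfl⟩ : ∃ k', k = k' + 2 := ⟨k - 2, by omega⟩
  obtain ⟨m, rfl⟩ : ∃ m', m = m' + 2 := ⟨m - 2, by omega⟩
  have hk' : (1 - ((k + 2 : ℕ) : ℂ)) = -((k + 1 : ℕ) : ℂ) := by push_cast; ring
  have hm' : (1 - ((m + 2 : ℕ) : ℂ)) = -((m + 1 : ℕ) : ℂ) := by push_cast; ring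
  have hk0 : ((k + 1 : ℕ) : ℂ) ≠ 0 := Nat.cast_ne_zero.2 (by omega)
  have hm0 : ((m + 1 : ℕ) : ℂ) ≠ 0 := Nat.cast_ne_zero.2 (by omega)
  let d : Particle (k + 2) (m + 2) → ℂ :=
    Sum.elim (fun _ => -((m + 1 : ℕ) : ℂ)) (fun _ => -((k + 1 : ℕ) : ℂ))
  let V : (Particle (k + 2) (m + 2) → ℂ) →ₗ[ℂ] (Fin 2 → ℂ) :=
    LinearMap.pi ![∑ l, LinearMap.proj (Sum.inl l), ∑ p, LinearMap.proj (Sum.inr p)]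
  let U : (Fin 2 → ℂ) →ₗ[ℂ] (Particle (k + 2) (m + 2) → ℂ) :=
    LinearMap.pi (Sum.elim (fun _ => ((m + 1 : ℕ) : ℂ)⁻¹ • LinearMap.proj 1)
      (fun _ => ((k + 1 : ℕ) : ℂ)⁻¹ • LinearMap.proj 0))
  have h1 : LinearMap.id + wittenWeightsLinear (k + 2) (m + 2) =
      (LinearMap.pi fun a => (d a • (LinearMap.id : ℂ →ₗ[ℂ] ℂ)) ∘ₗ LinearMap.proj a) ∘ₗ
        (LinearMap.id + U ∘ₗ V) := by
    refine LinearMap.ext fun c => funext fun a => ?_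
    cases a with
    | inl l =>
      have : (LinearMap.id + wittenWeightsLinear (k + 2) (m + 2) :
          (Particle (k + 2) (m + 2) → ℂ) →ₗ[ℂ] (Particle (k + 2) (m + 2) → ℂ)) c (Sum.inl l) =
          c (Sum.inl l) + -(((m + 2 : ℕ) : ℂ) * c (Sum.inl l) + ∑ p, c (Sum.inr p)) := rfl
      rw [this]
      simp [d, U, V, -Nat.cast_add, -Nat.cast_one]
      field_simp
      push_cast
      ring
    | inr r =>
      have : (LinearMap.id + wittenWeightsLinear (k + 2) (m + 2) :
          (Particle (k + 2) (m + 2) → ℂ) →ₗ[ℂ] (Particle (k + 2) (m + 2) → ℂ)) c (Sum.inr r) =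
          c (Sum.inr r) + -(((k + 2 : ℕ) : ℂ) * c (Sum.inr r) + ∑ p, c (Sum.inl p)) := rfl
      rw [this]
      simp [d, U, V, -Nat.cast_add, -Nat.cast_one]
      field_simp
      push_cast
      ring
  have h2 : LinearMap.id + V ∘ₗ U = Matrix.toLin' !![1, ((k + 2 : ℕ) : ℂ) * ((m + 1 : ℕ) : ℂ)⁻¹;
      ((m + 2 : ℕ) : ℂ) * ((k + 1 : ℕ) : ℂ)⁻¹, 1] := by
    refine LinearMap.ext fun c => funext fun a => ?_
    fin_cases a
    · simp [U, V, Matrix.mulVec, dotProduct, -Nat.cast_add, -Nat.cast_one]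
      ring
    · simp [U, V, Matrix.mulVec, dotProduct, -Nat.cast_add, -Nat.cast_one]
      ring
  rw [h1, LinearMap.det_comp, det_one_add_comp_comm, h2, LinearMap.det_toLin', LinearMap.det_pi,
    Fintype.prod_sum_type, Matrix.det_fin_two]
  simp only [LinearMap.det_smul, LinearMap.det_id, d, Sum.elim_inl, Sum.elim_inr,
    Finset.prod_const, Finset.card_univ, Fintype.card_fin, Module.finrank_self, pow_one, mul_one,
    wittenDegree]
  have e1 : m + 2 - 1 = m + 1 := rfl
  have e2 : k + 2 - 1 = k + 1 := rfl
  have e3 : k + 2 + (m + 2) - 1 = k + m + 3 := by omega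
  rw [e1, e2, e3]
  simp only [Matrix.of_apply, Matrix.cons_val', Matrix.cons_val_zero, Matrix.cons_val_one,
    Matrix.cons_val_fin_one]
  rw [neg_pow _ (k + 2), neg_pow _ (m + 2)]
  have e4 : (-1 : ℂ) ^ (k + m + 3) = -((-1) ^ k * (-1) ^ m) := by ring
  rw [e4]
  have e5 : (-1 : ℂ) ^ (k + 2) = (-1) ^ k := by ring
  have e6 : (-1 : ℂ) ^ (m + 2) = (-1) ^ m := by ring
  rw [e5, e6, pow_succ _ (k + 1), pow_succ _ (m + 1)]
  push_cast at hk0 hm0 ⊢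
  field_simp
  ring

end Ambitwistor

namespace Ambitwistor

open Filter Topology

variable {k m : ℕ}

/-! ### Solutions of Witten's formula -/

theorem lagrangeMap_self {q : ℕ} (w v : Fin q → Spinor) (l : Fin q)
    (hw : ∀ j, j ≠ l → br (w j) (w l) ≠ 0) : lagrangeMap w v (w l) = v l := by
  rw [lagrangeMap, Finset.sum_eq_single l]
  · rw [Finset.prod_eq_one, one_smul]
    intro j hj
    exact div_self (hw j (Finset.ne_of_mem_erase hj))
  · intro l' _ hl'
    rw [Finset.prod_eq_zero (i := l), zero_smul]
    · exact Finset.mem_erase.2 ⟨hl'.symm, Finset.mem_univ _⟩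
    · rw [br_self, zero_div]
  · simp

theorem prodOthers_inl (u : Particle k m → Spinor) (l : Fin k) :
    prodOthers u (Sum.inl l) = (∏ j ∈ Finset.univ.erase l, br (u (Sum.inl j)) (u (Sum.inl l))) *
      crossProd u (Sum.inl l) := by
  have : (Finset.univ.erase (Sum.inl l) : Finset (Particle k m)) =
      (Finset.univ.erase l).disjSum Finset.univ := by
    ext (b | b) <;> simp
  rw [prodOthers, this, Finset.prod_disjSum]
  rfl

theorem prodOthers_inr (u : Particle k m → Spinor) (r : Fin m) :
    prodOthers u (Sum.inr r) = (∏ j ∈ Finset.univ.erase r, br (u (Sum.inr j)) (u (Sum.inr r))) *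
      crossProd u (Sum.inr r) := by
  have : (Finset.univ.erase (Sum.inr r) : Finset (Particle k m)) =
      Finset.univ.disjSum (Finset.univ.erase r) := by
    ext (b | b) <;> simp
  rw [prodOthers, this, Finset.prod_disjSum, mul_comm]
  rfl

theorem prodOthers_ne_zero {u : Particle k m → Spinor}
    (hu : ∀ a b, a ≠ b → br (u a) (u b) ≠ 0) (a : Particle k m) : prodOthers u a ≠ 0 :=
  Finset.prod_ne_zero_iff.2 fun b hb => hu b a (Finset.ne_of_mem_erase hb)

/-- This dictates the form of `wittenScale`. Completing both products over R expresses the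
coefficient as the product of the two cross products divided by (u_r u_l) and `prodOthers`, and the
scales absorb the cross products. The minus sign in the scale on R turns (u_r u_l) into (u_l u_r).
-/
theorem lagrange_coeff_inl {u : Particle k m → Spinor}
    (hu : ∀ a b, a ≠ b → br (u a) (u b) ≠ 0) (l : Fin k) (r : Fin m) :
    ∏ j ∈ Finset.univ.erase r, br (u (Sum.inr j)) (u (Sum.inl l)) /
      br (u (Sum.inr j)) (u (Sum.inr r)) =
    (br (wittenMap u (Sum.inl l)) (wittenMap u (Sum.inr r)))⁻¹ * (prodOthers u (Sum.inr r))⁻¹ := by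
  have h1 : crossProd u (Sum.inl l) = br (u (Sum.inr r)) (u (Sum.inl l)) *
      ∏ j ∈ Finset.univ.erase r, br (u (Sum.inr j)) (u (Sum.inl l)) :=
    (Finset.mul_prod_erase _ _ (Finset.mem_univ r)).symm
  have h2 := crossProd_ne_zero hu (Sum.inl l)
  have h3 := crossProd_ne_zero hu (Sum.inr r)
  have h4 : ∏ j ∈ Finset.univ.erase r, br (u (Sum.inr j)) (u (Sum.inr r)) ≠ 0 :=
    Finset.prod_ne_zero_iff.2 fun j hj => hu _ _ (by simpa using Finset.ne_of_mem_erase hj)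
  have h5 := hu (Sum.inr r) (Sum.inl l) (by simp)
  rw [Finset.prod_div_distrib, prodOthers_inr, wittenMap, wittenMap, br_smul_smul,
    br_swap (u (Sum.inl l)), wittenScale, wittenScale]
  rw [h1] at h2 ⊢
  have h6 := right_ne_zero_of_mul h2
  field_simp

theorem lagrange_coeff_inr {u : Particle k m → Spinor}
    (hu : ∀ a b, a ≠ b → br (u a) (u b) ≠ 0) (l : Fin k) (r : Fin m) :
    ∏ j ∈ Finset.univ.erase l, br (u (Sum.inl j)) (u (Sum.inr r)) /
      br (u (Sum.inl j)) (u (Sum.inl l)) =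
    (br (wittenMap u (Sum.inr r)) (wittenMap u (Sum.inl l)))⁻¹ * (prodOthers u (Sum.inl l))⁻¹ := by
  have h1 : crossProd u (Sum.inr r) = br (u (Sum.inl l)) (u (Sum.inr r)) *
      ∏ j ∈ Finset.univ.erase l, br (u (Sum.inl j)) (u (Sum.inr r)) :=
    (Finset.mul_prod_erase _ _ (Finset.mem_univ l)).symm
  have h2 := crossProd_ne_zero hu (Sum.inl l)
  have h3 := crossProd_ne_zero hu (Sum.inr r)
  have h4 : ∏ j ∈ Finset.univ.erase l, br (u (Sum.inl j)) (u (Sum.inl l)) ≠ 0 :=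
    Finset.prod_ne_zero_iff.2 fun j hj => hu _ _ (by simpa using Finset.ne_of_mem_erase hj)
  have h5 := hu (Sum.inl l) (Sum.inr r) (by simp)
  rw [Finset.prod_div_distrib, prodOthers_inl, wittenMap, wittenMap, br_smul_smul,
    br_swap (u (Sum.inr r)), wittenScale, wittenScale]
  rw [h1] at h3 ⊢
  have h6 := right_ne_zero_of_mul h3
  field_simp

/-- The delta-function arguments that fix the moduli. -/
def wittenModuliArgs (κ : Kinematics k m) (x : Particle k m ⊕ Particle k m → Spinor) :
    Particle k m → Spinor
  | Sum.inl l => κ.1 (Sum.inl l) -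
      (prodOthers (fun a => x (Sum.inr a)) (Sum.inl l))⁻¹ • x (Sum.inl (Sum.inl l))
  | Sum.inr r => κ.2 (Sum.inr r) -
      (prodOthers (fun a => x (Sum.inr a)) (Sum.inr r))⁻¹ • x (Sum.inl (Sum.inr r))

/-- The coefficients with which the moduli conditions enter the remaining ones. -/
def wittenMixing (σ : Particle k m → Spinor) :
    (Particle k m → Spinor) →ₗ[ℂ] (Particle k m → Spinor) :=
  LinearMap.pi (Sum.elim
    (fun l => ∑ r, (br (σ (Sum.inl l)) (σ (Sum.inr r)))⁻¹ • LinearMap.proj (Sum.inr r))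
    (fun r => ∑ l, (br (σ (Sum.inr r)) (σ (Sum.inl l)))⁻¹ • LinearMap.proj (Sum.inl l)))

theorem wittenMixing_inl (σ g : Particle k m → Spinor) (l : Fin k) :
    wittenMixing σ g (Sum.inl l) =
      ∑ r, (br (σ (Sum.inl l)) (σ (Sum.inr r)))⁻¹ • g (Sum.inr r) := by
  simp [wittenMixing]

theorem wittenMixing_inr (σ g : Particle k m → Spinor) (r : Fin m) :
    wittenMixing σ g (Sum.inr r) =
      ∑ l, (br (σ (Sum.inr r)) (σ (Sum.inl l)))⁻¹ • g (Sum.inl l) := by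
  simp [wittenMixing]

/-- The change of basis of the delta functions. -/
def wittenChange (x : Particle k m ⊕ Particle k m → Spinor) :
    (Particle k m → Spinor) × (Particle k m → Spinor) →ₗ[ℂ]
      (Particle k m → Spinor) × (Particle k m → Spinor) :=
  blocks LinearMap.id 0 (wittenMixing (wittenMap fun a => x (Sum.inr a))) LinearMap.id

theorem det_wittenChange (x : Particle k m ⊕ Particle k m → Spinor) :
    LinearMap.det (wittenChange x) = 1 := by
  have h := det_blocks (LinearEquiv.refl ℂ (Particle k m → Spinor)) 0
    (wittenMixing (wittenMap fun a => x (Sum.inr a))) LinearMap.id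
  simpa [wittenChange] using h

variable (ω : Fin (k + m) ≃ Particle k m)

/-- Interpolation expresses T(u_l) through the values T(u_r). Replacing each value by λ̃_r minus the
corresponding moduli argument, up to `prodOthers`, gives λ̃(σ_l) minus a propagator-weighted sum of
moduli arguments. The same computation applies to P on R. -/
theorem witten_factorization (κ : Kinematics k m) (x : Particle k m ⊕ Particle k m → Spinor)
    (hx : x ∈ (witten k m ω).domain) :
    DeltaIntegral.splitVars _ _ ((witten k m ω).args κ x) = wittenChange x
      (wittenModuliArgs κ x, (ambitwistor k m 0 ω).args κ (wittenMap fun a => x (Sum.inr a))) := by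
  set u : Particle k m → Spinor := fun a => x (Sum.inr a) with hu
  have hu' : ∀ a b, a ≠ b → br (u a) (u b) ≠ 0 := hx
  have hP : ∀ l, lagrangeMap (fun l => u (Sum.inl l)) (fun l => x (Sum.inl (Sum.inl l)))
      (u (Sum.inl l)) = x (Sum.inl (Sum.inl l)) := fun l =>
    lagrangeMap_self (fun l => u (Sum.inl l)) _ l fun j hj => hu' _ _ (by simpa using hj)
  have hT : ∀ l, lagrangeMap (fun l => u (Sum.inr l)) (fun l => x (Sum.inl (Sum.inr l)))
      (u (Sum.inr l)) = x (Sum.inl (Sum.inr l)) := fun l =>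
    lagrangeMap_self (fun l => u (Sum.inr l)) _ l fun j hj => hu' _ _ (by simpa using hj)
  rw [wittenChange, blocks_apply]
  refine Prod.ext ?_ ?_
  · funext a
    simp only [LinearMap.id_apply, LinearMap.zero_apply, add_zero]
    cases a with
    | inl l => exact congrArg (fun v => κ.1 (Sum.inl l) - (prodOthers u (Sum.inl l))⁻¹ • v) (hP l)
    | inr r => exact congrArg (fun v => κ.2 (Sum.inr r) - (prodOthers u (Sum.inr r))⁻¹ • v) (hT r)
  · funext a
    simp only [LinearMap.id_apply, Pi.add_apply]
    cases a with
    | inl l =>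
      have h1 : (DeltaIntegral.splitVars _ _ ((witten k m ω).args κ x)).2 (Sum.inl l) =
        κ.2 (Sum.inl l) - lagrangeMap (fun r => u (Sum.inr r)) (fun r => x (Sum.inl (Sum.inr r)))
          (u (Sum.inl l)) := rfl
      rw [h1, wittenMixing_inl, lagrangeMap]
      simp only [lagrange_coeff_inl hu', wittenModuliArgs, smul_sub, Finset.sum_sub_distrib,
        ambitwistor, lamTildeField, smul_smul]
      rw [← hu]
      abel
    | inr r =>
      have h1 : (DeltaIntegral.splitVars _ _ ((witten k m ω).args κ x)).2 (Sum.inr r) =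
        κ.1 (Sum.inr r) - lagrangeMap (fun r => u (Sum.inl r)) (fun r => x (Sum.inl (Sum.inl r)))
          (u (Sum.inr r)) := rfl
      rw [h1, wittenMixing_inr, lagrangeMap]
      simp only [lagrange_coeff_inr hu', wittenModuliArgs, smul_sub, Finset.sum_sub_distrib,
        ambitwistor, lamField, smul_smul]
      rw [← hu]
      abel

/-- The moduli of a solution with given marked points. -/
def wittenModuli (κ : Kinematics k m) (u : Particle k m → Spinor) : Particle k m → Spinor
  | Sum.inl l => prodOthers u (Sum.inl l) • κ.1 (Sum.inl l)
  | Sum.inr r => prodOthers u (Sum.inr r) • κ.2 (Sum.inr r)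

/-- The mixing of delta functions is invertible, so the two groups vanish separately: the first
solves for the moduli, the second is the system of the ambitwistor string. -/
theorem witten_mem_solutions_iff (κ : Kinematics k m)
    (x : Particle k m ⊕ Particle k m → Spinor) :
    x ∈ (witten k m ω).solutions κ ↔ x ∈ (witten k m ω).domain ∧
      (∀ a, x (Sum.inl a) = wittenModuli κ (fun a => x (Sum.inr a)) a) ∧
      wittenMap (fun a => x (Sum.inr a)) ∈ (ambitwistor k m 0 ω).solutions κ := by
  refine and_congr_right fun hx => ?_
  have hx' : ∀ a, prodOthers (fun a => x (Sum.inr a)) a ≠ 0 := prodOthers_ne_zero hx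
  have h1 : (witten k m ω).args κ x = 0 ↔ (wittenModuliArgs κ x,
      (ambitwistor k m 0 ω).args κ (wittenMap fun a => x (Sum.inr a))) = 0 := by
    have hinj : Function.Injective (wittenChange x) := (LinearMap.equivOfDetNeZero
      (wittenChange x) (by rw [det_wittenChange]; exact one_ne_zero)).injective
    rw [← (DeltaIntegral.splitVars _ _).map_eq_zero_iff, witten_factorization ω κ x hx,
      map_eq_zero_iff _ hinj]
  rw [h1, Prod.mk_eq_zero]
  refine and_congr ?_ ⟨fun h => ⟨wittenMap_mem_domain hx, h⟩, fun h => h.2⟩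
  rw [funext_iff]
  refine forall_congr' fun a => ?_
  cases a with
  | inl l => rw [wittenModuliArgs, wittenModuli, Pi.zero_apply, sub_eq_zero, eq_comm,
      inv_smul_eq_iff₀ (hx' _)]
  | inr l => rw [wittenModuliArgs, wittenModuli, Pi.zero_apply, sub_eq_zero, eq_comm,
      inv_smul_eq_iff₀ (hx' _)]

/-- The cross products are invariant, and each of the k-1 or m-1 remaining brackets joins points of
the same kind and has weight ±2. This accounts for the weights given to the moduli in the gauge
action. -/
theorem wittenModuli_actPoints {h : Matrix (Fin 2) (Fin 2) ℂ} (hh : h.det = 1) {c : ℂ}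
    (hc : c ≠ 0) (κ : Kinematics k m) (u : Particle k m → Spinor) (a : Particle k m) :
    wittenModuli κ (actPoints h c u) a =
      (Sum.elim (fun _ => c ^ (2 * (k - 1))) (fun _ => c⁻¹ ^ (2 * (m - 1))) a : ℂ) •
        wittenModuli κ u a := by
  cases a with
  | inl l =>
    simp only [wittenModuli, prodOthers_inl, crossProd_actPoints hh hc, br_actPoints hh, glWeight,
      Sum.elim_inl, Finset.prod_mul_distrib, Finset.prod_const, smul_smul,
      Finset.card_erase_of_mem (Finset.mem_univ l), Finset.card_univ, Fintype.card_fin]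
    congr 1
    rw [pow_mul]; ring
  | inr l =>
    simp only [wittenModuli, prodOthers_inr, crossProd_actPoints hh hc, br_actPoints hh, glWeight,
      Sum.elim_inr, Finset.prod_mul_distrib, Finset.prod_const, smul_smul,
      Finset.card_erase_of_mem (Finset.mem_univ l), Finset.card_univ, Fintype.card_fin]
    congr 1
    rw [pow_mul]; ring

theorem witten_act_inl (h : Matrix (Fin 2) (Fin 2) ℂ) (c : ℂ)
    (x : Particle k m ⊕ Particle k m → Spinor) (a : Particle k m) :
    (witten k m ω).act h c x (Sum.inl a) =
      (Sum.elim (fun _ => c ^ (2 * (k - 1))) (fun _ => c⁻¹ ^ (2 * (m - 1))) a : ℂ) •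
        x (Sum.inl a) := by
  cases a <;> rfl

theorem witten_act_mem_solutions {h : Matrix (Fin 2) (Fin 2) ℂ} (hh : h.det = 1) {c : ℂ}
    (hc : c ≠ 0) {κ : Kinematics k m} {x : Particle k m ⊕ Particle k m → Spinor}
    (hx : x ∈ (witten k m ω).solutions κ) :
    (witten k m ω).act h c x ∈ (witten k m ω).solutions κ := by
  rw [witten_mem_solutions_iff] at hx ⊢
  have h1 : (fun a => (witten k m ω).act h c x (Sum.inr a)) =
    actPoints h c fun a => x (Sum.inr a) := rfl
  have h2 := actPoints_mem_domain (N := 0) (σ := fun a => x (Sum.inr a)) ω hh hc hx.1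
  refine ⟨h2, fun a => ?_, ?_⟩
  · rw [h1, wittenModuli_actPoints hh hc, witten_act_inl, hx.2.1]
  · rw [h1, wittenMap_actPoints hh hc]
    exact actPoints_mem_solutions ω hh hc hx.2.2

/-- On solutions the moduli are equivariant functions of the points, so the points alone decide
equivalence. -/
theorem witten_gaugeEquiv_iff {κ : Kinematics k m}
    {x y : Particle k m ⊕ Particle k m → Spinor} (hx : x ∈ (witten k m ω).solutions κ)
    (hy : y ∈ (witten k m ω).solutions κ) :
    (witten k m ω).GaugeEquiv x y ↔ (ambitwistor k m 0 ω).GaugeEquiv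
      (fun a => x (Sum.inr a)) (fun a => y (Sum.inr a)) := by
  constructor
  · rintro ⟨h, c, hh, hc, -, he⟩
    have he' : (fun a => y (Sum.inr a)) = actPoints h c fun a => x (Sum.inr a) := by
      rw [he]
      rfl
    exact ⟨h, c, hh, hc, trivial, he'⟩
  · rintro ⟨h, c, hh, hc, -, he⟩
    refine ⟨h, c, hh, hc, trivial, ?_⟩
    have he' : (fun a => y (Sum.inr a)) = actPoints h c fun a => x (Sum.inr a) := he
    rw [witten_mem_solutions_iff] at hx hy
    funext a
    cases a with
    | inl a => rw [hy.2.1, he', wittenModuli_actPoints hh hc, witten_act_inl, hx.2.1]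
    | inr a => exact congrFun he a

/-! ### The Jacobian of Witten's formula -/

theorem det_wittenMap {u : Particle k m → Spinor} (hk : 2 ≤ k) (hm : 2 ≤ m)
    (hu : ∀ a b, a ≠ b → br (u a) (u b) ≠ 0) :
    LinearMap.det (scaleDeriv (wittenScale u)
      (fun a => fderiv ℂ (fun u : Particle k m → Spinor => wittenScale u a) u) u :
        (Particle k m → Spinor) →ₗ[ℂ] _) =
      (∏ a, wittenScale u a) ^ 2 * ((-1) ^ (k + m - 1) * (wittenDegree k m : ℂ)) := by
  rw [det_scaleDeriv (wittenScale_ne_zero hu) (wittenWeightsLinear k m)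
    fun a c => fderiv_wittenScale hu a c, det_one_add_wittenWeightsLinear hk hm]

theorem wittenDegree_ne_zero (hk : 2 ≤ k) (hm : 2 ≤ m) : wittenDegree k m ≠ 0 :=
  mul_ne_zero (mul_ne_zero (pow_ne_zero _ (by omega)) (pow_ne_zero _ (by omega))) (by omega)

theorem witten_actDifferentiable (x : Particle k m ⊕ Particle k m → Spinor) :
    (witten k m ω).ActDifferentiable x := by
  have hs : DifferentiableAt ℂ (fun p : (Fin 2 → Fin 2 → ℂ) × ℂ => p.2)
    ((1 : Matrix (Fin 2) (Fin 2) ℂ), 1) := differentiableAt_snd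
  refine differentiableAt_pi.2 fun a => ?_
  rcases a with (l | r) | a
  · exact (hs.pow _).smul_const _
  · exact ((hs.inv one_ne_zero).pow _).smul_const _
  · exact differentiableAt_pi.1 (actPoints_differentiableAt
      (X := (Fin 2 → Fin 2 → ℂ) × ℂ) (h := Prod.fst) (c := Prod.snd)
      differentiableAt_fst differentiableAt_snd one_ne_zero fun a => x (Sum.inr a)) a

theorem witten_act_one (x : Particle k m ⊕ Particle k m → Spinor) :
    (witten k m ω).act 1 1 x = x := by
  funext a
  rcases a with a | a
  · rw [witten_act_inl]
    cases a <;> simp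
  · exact congrFun (actPoints_one fun a => x (Sum.inr a)) a

/-- The delta functions that fix the moduli contribute the determinant of this map. -/
def wittenModuliDeriv (u : Particle k m → Spinor) :
    (Particle k m → Spinor) →ₗ[ℂ] (Particle k m → Spinor) :=
  LinearMap.pi fun a => (-(prodOthers u a)⁻¹ • (LinearMap.id : Spinor →ₗ[ℂ] Spinor)) ∘ₗ
    LinearMap.proj a

theorem det_wittenModuliDeriv (u : Particle k m → Spinor) :
    LinearMap.det (wittenModuliDeriv u) = ∏ a, (prodOthers u a ^ 2)⁻¹ := by
  rw [wittenModuliDeriv, LinearMap.det_pi]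
  refine Finset.prod_congr rfl fun a _ => ?_
  rw [LinearMap.det_smul, LinearMap.det_id]
  simp

theorem eventually_br_ne_zero {X : Type*} [TopologicalSpace X] {f : X → Particle k m → Spinor}
    {x : X} (hf : ContinuousAt f x) (h : ∀ a b, a ≠ b → br (f x a) (f x b) ≠ 0) :
    ∀ᶠ y in 𝓝 x, ∀ a b, a ≠ b → br (f y a) (f y b) ≠ 0 := by
  rw [eventually_all]
  intro a
  rw [eventually_all]
  intro b
  by_cases hab : a = b
  · exact Eventually.of_forall fun _ h => absurd hab h
  have h1 : ∀ a i, ContinuousAt (fun y => f y a i) x := fun a i =>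
    continuousAt_pi.1 (continuousAt_pi.1 hf a) i
  have h2 : ContinuousAt (fun y => br (f y a) (f y b)) x :=
    ((h1 a 1).mul (h1 b 0)).sub ((h1 a 0).mul (h1 b 1))
  exact (h2.eventually_ne (h a b hab)).mono fun y hy _ => hy

/-- The mixing has determinant 1 and the gauge parameters are unchanged. The two nontrivial factors
are the derivative of the rescaling of points and the inverse squares of `prodOthers` from the
moduli. -/
theorem witten_hasJacobian_iff (hk : 2 ≤ k) (hm : 2 ≤ m) {κ : Kinematics k m}
    {x : Particle k m ⊕ Particle k m → Spinor} (hx : x ∈ (witten k m ω).solutions κ) (J : ℂ) :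
    (witten k m ω).HasJacobian κ x
      ((∏ a, wittenScale (fun a => x (Sum.inr a)) a) ^ 2 *
        ((-1) ^ (k + m - 1) * (wittenDegree k m : ℂ)) *
        ((∏ a, (prodOthers (fun a => x (Sum.inr a)) a ^ 2)⁻¹) * J)) ↔
      (ambitwistor k m 0 ω).HasJacobian κ (wittenMap fun a => x (Sum.inr a)) J := by
  set u : Particle k m → Spinor := fun a => x (Sum.inr a) with hu
  have hu' : ∀ a b, a ≠ b → br (u a) (u b) ≠ 0 := hx.1
  have hγ : (∏ a, wittenScale u a) ^ 2 * ((-1) ^ (k + m - 1) * (wittenDegree k m : ℂ)) ≠ 0 :=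
    mul_ne_zero (pow_ne_zero _ (Finset.prod_ne_zero_iff.2 fun a _ => wittenScale_ne_zero hu' a))
      (mul_ne_zero (pow_ne_zero _ (by simp)) (Nat.cast_ne_zero.2 (wittenDegree_ne_zero hk hm)))
  have hprodO : ∏ a, (prodOthers u a ^ 2)⁻¹ ≠ 0 := Finset.prod_ne_zero_iff.2 fun a _ =>
    inv_ne_zero (pow_ne_zero _ (prodOthers_ne_zero hu' a))
  have hproj : ContinuousAt (fun z : Particle k m ⊕ Particle k m → Spinor =>
      fun a : Particle k m => z (Sum.inr a)) x :=
    (continuous_pi fun a => continuous_apply _).continuousAt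
  have hpr : ∀ a, DifferentiableAt ℂ (fun z : Particle k m ⊕ Particle k m → Spinor => z a) x :=
    fun a => differentiableAt_apply a x
  have hprod : ∀ a, DifferentiableAt ℂ (fun z : Particle k m ⊕ Particle k m → Spinor =>
      (prodOthers (fun a => z (Sum.inr a)) a)⁻¹) x := fun a => by
    have h1 : DifferentiableAt ℂ (fun z : Particle k m ⊕ Particle k m → Spinor =>
      prodOthers (fun a => z (Sum.inr a)) a) x :=
        prod_differentiableAt _ fun b => br_differentiableAt (hpr _) (hpr _)
    exact h1.inv (prodOthers_ne_zero hu' a)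
  have hG : DifferentiableAt ℂ (wittenModuliArgs κ) x := by
    refine differentiableAt_pi.2 fun a => ?_
    cases a with
    | inl l => exact ((hprod (Sum.inl l)).smul (hpr _)).const_sub _
    | inr r => exact ((hprod (Sum.inr r)).smul (hpr _)).const_sub _
  have key := DeltaIntegral.hasJacobian_iff_of_factorization (ambitwistor k m 0 ω)
    (witten k m ω) κ x wittenModuliArgs wittenMap wittenChange (wittenModuliDeriv u)
    (scaleDeriv (wittenScale u)
      (fun a => fderiv ℂ (fun u : Particle k m → Spinor => wittenScale u a) u) u)
    (ContinuousLinearMap.id ℂ _)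
    ((eventually_br_ne_zero hproj hu').mono fun z hz κ' => witten_factorization ω κ' z hz)
    ?_ (by rw [det_wittenChange]; exact one_ne_zero) hx.2 hG ?_
    (by rw [det_wittenModuliDeriv]; exact hprodO) ?_ (hasFDerivAt_wittenMap hu')
    (by rw [det_wittenMap hk hm hu']; exact hγ)
    (ambitwistor_differentiableAt ω κ (wittenMap_mem_domain hu'))
    (ambitwistor_differentiableAt_kinematics ω κ _) (witten_actDifferentiable ω x)
    (witten_act_one ω x) ?_ (ambitwistor_actDifferentiable ω _)
    (fun v => (DeltaIntegral.slCurve v, 1 + v 3))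
    (by ext <;> simp [DeltaIntegral.slCurve_zero]) ?_ ?_ (by simp)
    (ambitwistor_fderiv_generators ω κ (wittenMap_mem_domain hu')) J
  · rw [det_wittenChange, det_wittenMap hk hm hu', det_wittenModuliDeriv, one_mul] at key
    exact key
  · intro v
    have hσ : ∀ a, ContinuousAt (fun z : Particle k m ⊕ Particle k m → Spinor =>
        wittenMap (fun a => z (Sum.inr a)) a) x := fun a =>
      ContinuousAt.comp_of_eq (g := fun u => wittenMap u a)
        (continuousAt_pi.1 (hasFDerivAt_wittenMap hu').continuousAt a) hproj rfl
    have hbr : ∀ a b, a ≠ b → ContinuousAt (fun z : Particle k m ⊕ Particle k m → Spinor =>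
        (br (wittenMap (fun a => z (Sum.inr a)) a) (wittenMap (fun a => z (Sum.inr a)) b))⁻¹) x := by
      intro a b hab
      refine ContinuousAt.inv₀ ?_ (wittenMap_mem_domain hu' a b hab)
      exact ((continuousAt_pi.1 (hσ a) 1).mul (continuousAt_pi.1 (hσ b) 0)).sub
        ((continuousAt_pi.1 (hσ a) 0).mul (continuousAt_pi.1 (hσ b) 1))
    have h1 : (fun z => wittenChange z v) = fun z : Particle k m ⊕ Particle k m → Spinor =>
        (v.1, wittenMixing (wittenMap fun a => z (Sum.inr a)) v.1 + v.2) := by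
      funext z
      obtain ⟨v1, v2⟩ := v
      rw [wittenChange, blocks_apply]
      simp
    rw [h1]
    refine continuousAt_const.prodMk (ContinuousAt.add ?_ continuousAt_const)
    refine continuousAt_pi.2 fun a => ?_
    cases a with
    | inl l =>
      simp only [wittenMixing_inl]
      exact tendsto_finsetSum _ fun r _ => (hbr _ _ (by simp)).smul continuousAt_const
    | inr l =>
      simp only [wittenMixing_inr]
      exact tendsto_finsetSum _ fun r _ => (hbr _ _ (by simp)).smul continuousAt_const
  · intro a
    -- With the marked points held fixed, the moduli conditions are affine in the moduli.
    refine DeltaIntegral.fderiv_apply_of_affine hG fun t => ?_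
    have e1 : (fun b : Particle k m => (x + t • (DeltaIntegral.splitVars
        (Particle k m) (Particle k m)).symm (a, 0)) (Sum.inr b)) = u := by
      funext b
      simp [hu]
    have e2 : ∀ b, (x + t • (DeltaIntegral.splitVars
        (Particle k m) (Particle k m)).symm (a, 0)) (Sum.inl b) = x (Sum.inl b) + t • a b := by
      intro b
      simp
    funext b
    cases b with
    | inl l =>
      simp only [wittenModuliArgs, e1, e2]
      simp only [wittenModuliArgs, Pi.add_apply, Pi.smul_apply, wittenModuliDeriv,
        LinearMap.pi_apply, LinearMap.comp_apply, LinearMap.smul_apply,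
        LinearMap.id_apply, LinearMap.proj_apply]
      module
    | inr l =>
      simp only [wittenModuliArgs, e1, e2]
      simp only [wittenModuliArgs, Pi.add_apply, Pi.smul_apply, wittenModuliDeriv,
        LinearMap.pi_apply, LinearMap.comp_apply, LinearMap.smul_apply,
        LinearMap.id_apply, LinearMap.proj_apply]
      module
  · have h1 : ∀ a, DifferentiableAt ℂ (fun κ : Kinematics k m => κ.1 a) κ := fun a => by fun_prop
    have h2 : ∀ a, DifferentiableAt ℂ (fun κ : Kinematics k m => κ.2 a) κ := fun a => by fun_prop
    refine differentiableAt_pi.2 fun a => ?_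
    cases a with
    | inl l => exact (h1 _).sub_const _
    | inr r => exact (h2 _).sub_const _
  · filter_upwards [DeltaIntegral.eventually_det_slCurve,
      DeltaIntegral.eventually_one_add_ne_zero 3] with v hv hv'
    exact (witten_act_mem_solutions ω hv hv' hx).2
  · exact DeltaIntegral.hasFDerivAt_slCurve_prod
  · filter_upwards [DeltaIntegral.eventually_det_slCurve,
      DeltaIntegral.eventually_one_add_ne_zero 3] with v hv hv'
    exact wittenMap_actPoints hv hv' u

theorem ambitwistor_integrand_zero (σ : Particle k m → Spinor) :
    (ambitwistor k m 0 ω).integrand σ =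
      algebraMap ℂ (Grassmann (Particle k m × Fin 0)) (parkeTaylor ω σ)⁻¹ := by
  simp [ambitwistor, fermiDelta, Algebra.algebraMap_eq_smul_one]

theorem witten_integrand (x : Particle k m ⊕ Particle k m → Spinor) :
    (witten k m ω).integrand x = (parkeTaylor ω fun a => x (Sum.inr a))⁻¹ *
      ∏ a, (prodOthers (fun a => x (Sum.inr a)) a ^ 2)⁻¹ := by
  simp [witten, prodOthers, Finset.prod_pow]

theorem parkeTaylor_wittenMap (u : Particle k m → Spinor) :
    parkeTaylor ω (wittenMap u) = (∏ a, wittenScale u a) ^ 2 * parkeTaylor ω u :=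
  parkeTaylor_smul ω _ u

end Ambitwistor

namespace Ambitwistor

open Filter Topology

/-! ### Counting the fibres of the map of marked points -/

theorem exists_finset_roots {n : ℕ} (hn : n ≠ 0) {c : ℂ} (hc : c ≠ 0) :
    ∃ s : Finset ℂ, (∀ z, z ∈ s ↔ z ^ n = c) ∧ s.card = n := by
  classical
  have hp := Complex.isPrimitiveRoot_exp n hn
  refine ⟨(Polynomial.nthRoots n c).toFinset, fun z => ?_, ?_⟩
  · rw [Multiset.mem_toFinset, Polynomial.mem_nthRoots (Nat.pos_of_ne_zero hn)]
  · rw [Multiset.toFinset_card_of_nodup (hp.nthRoots_nodup hc), hp.card_nthRoots, if_pos]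
    exact IsAlgClosed.exists_pow_nat_eq c (Nat.pos_of_ne_zero hn)

/-- The number of solutions of a system of monomial equations. -/
theorem exists_finset_monomial_system {K M : ℕ} (hK : K ≠ 0) (hM : M ≠ 0)
    (p : Fin (K + 1) → ℂ) (q : Fin (M + 1) → ℂ) (hp : ∀ l, p l ≠ 0) (hq : ∀ r, q r ≠ 0) :
    ∃ s : Finset ((Fin (K + 1) → ℂ) × (Fin (M + 1) → ℂ)),
      (∀ x, x ∈ s ↔ (∀ l, x.1 l ^ M * ∏ r, x.2 r = p l) ∧ ∀ r, x.2 r ^ K * ∏ l, x.1 l = q r) ∧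
      s.card = M ^ K * K ^ M * (K + M + 1) := by
  classical
  -- Dividing by the equations of index 0 decouples the ratios: (a_l/a_0)^M = p_l/p_0 and
  -- (b_r/b_0)^K = q_r/q_0, with M roots for each of K ratios and K roots for each of M ratios.
  choose Z hZ hZc using fun l : Fin K => exists_finset_roots hM
    (div_ne_zero (hp l.succ) (hp 0))
  choose X hX hXc using fun r : Fin M => exists_finset_roots hK
    (div_ne_zero (hq r.succ) (hq 0))
  have hZ0 : ∀ ζ ∈ Fintype.piFinset Z, ∏ l, ζ l ≠ 0 := fun ζ hζ =>
    Finset.prod_ne_zero_iff.2 fun l _ h0 => by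
      have h1 := (hZ l _).1 (Fintype.mem_piFinset.1 hζ l)
      rw [h0, zero_pow hM] at h1
      exact div_ne_zero (hp l.succ) (hp 0) h1.symm
  have hX0 : ∀ ξ ∈ Fintype.piFinset X, ∏ l, ξ l ≠ 0 := fun ζ hζ =>
    Finset.prod_ne_zero_iff.2 fun l _ h0 => by
      have h1 := (hX l _).1 (Fintype.mem_piFinset.1 hζ l)
      rw [h0, zero_pow hK] at h1
      exact div_ne_zero (hq l.succ) (hq 0) h1.symm
  -- Multiplying the two equations of index 0 shows that z = a_0 b_0 satisfies z^(K+M+1) = c, which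
  -- accounts for the last factor in the count.
  let c : (Fin K → ℂ) × (Fin M → ℂ) → ℂ := fun x => p 0 * q 0 / ((∏ r, x.2 r) * ∏ l, x.1 l)
  have hc : ∀ x ∈ Fintype.piFinset Z ×ˢ Fintype.piFinset X, c x ≠ 0 := fun x hx => by
    rw [Finset.mem_product] at hx
    exact div_ne_zero (mul_ne_zero (hp 0) (hq 0)) (mul_ne_zero (hX0 _ hx.2) (hZ0 _ hx.1))
  have hroots : ∀ x, ∃ s : Finset ℂ, x ∈ Fintype.piFinset Z ×ˢ Fintype.piFinset X →
      (∀ z, z ∈ s ↔ z ^ (K + M + 1) = c x) ∧ s.card = K + M + 1 := fun x => by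
    by_cases hx : x ∈ Fintype.piFinset Z ×ˢ Fintype.piFinset X
    · obtain ⟨s, h1, h2⟩ := exists_finset_roots (Nat.succ_ne_zero (K + M)) (hc x hx)
      exact ⟨s, fun _ => ⟨h1, h2⟩⟩
    · exact ⟨∅, fun h => absurd h hx⟩
  choose W hW using hroots
  let T : Finset ((_ : (Fin K → ℂ) × (Fin M → ℂ)) × ℂ) :=
    (Fintype.piFinset Z ×ˢ Fintype.piFinset X).sigma W
  have hT : T.card = M ^ K * K ^ M * (K + M + 1) := by
    rw [Finset.card_sigma, Finset.sum_congr rfl fun x hx => (hW x hx).2, Finset.sum_const,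
      Finset.card_product, Fintype.card_piFinset, Fintype.card_piFinset]
    simp [hZc, hXc]
  -- The base entries are recovered from z and the ratios: the equation for q_0 reads a_0 z^K ∏ζ =
  -- q_0, and the one for p_0 reads b_0 z^M ∏ξ = p_0.
  let a₀ : ((_ : (Fin K → ℂ) × (Fin M → ℂ)) × ℂ) → ℂ := fun y =>
    q 0 / (y.2 ^ K * ∏ l, y.1.1 l)
  let b₀ : ((_ : (Fin K → ℂ) × (Fin M → ℂ)) × ℂ) → ℂ := fun y =>
    p 0 / (y.2 ^ M * ∏ r, y.1.2 r)
  let φ : ((_ : (Fin K → ℂ) × (Fin M → ℂ)) × ℂ) → (Fin (K + 1) → ℂ) × (Fin (M + 1) → ℂ) :=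
    fun y => (Fin.cons (a₀ y) fun l => a₀ y * y.1.1 l, Fin.cons (b₀ y) fun r => b₀ y * y.1.2 r)
  have hTmem : ∀ y ∈ T, (∀ l, y.1.1 l ^ M = p l.succ / p 0) ∧ (∀ r, y.1.2 r ^ K = q r.succ / q 0) ∧
      (∏ l, y.1.1 l ≠ 0) ∧ (∏ r, y.1.2 r ≠ 0) ∧ y.2 ^ (K + M + 1) = c y.1 ∧ y.2 ≠ 0 := by
    intro y hy
    obtain ⟨h1, h2⟩ := Finset.mem_sigma.1 hy
    have h3 := ((hW _ h1).1 _).1 h2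
    have h4 := hc _ h1
    rw [Finset.mem_product] at h1
    refine ⟨fun l => (hZ l _).1 (Fintype.mem_piFinset.1 h1.1 l),
      fun r => (hX r _).1 (Fintype.mem_piFinset.1 h1.2 r), hZ0 _ h1.1, hX0 _ h1.2, h3, fun h0 => ?_⟩
    rw [h0, zero_pow (Nat.succ_ne_zero _)] at h3
    exact h4 h3.symm
  have hab : ∀ y ∈ T, a₀ y ≠ 0 ∧ b₀ y ≠ 0 ∧ a₀ y * b₀ y = y.2 := by
    intro y hy
    obtain ⟨-, -, h1, h2, h3, h4⟩ := hTmem y hy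
    refine ⟨div_ne_zero (hq 0) (mul_ne_zero (pow_ne_zero _ h4) h1),
      div_ne_zero (hp 0) (mul_ne_zero (pow_ne_zero _ h4) h2), ?_⟩
    simp only [c] at h3
    rw [eq_div_iff (mul_ne_zero h2 h1)] at h3
    simp only [a₀, b₀]
    rw [div_mul_div_comm, div_eq_iff (mul_ne_zero (mul_ne_zero (pow_ne_zero _ h4) h1)
      (mul_ne_zero (pow_ne_zero _ h4) h2)), mul_comm (q 0), ← h3]
    ring
  refine ⟨T.image φ, fun x => ?_, ?_⟩
  · rw [Finset.mem_image]
    constructor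
    · rintro ⟨y, hy, rfl⟩
      obtain ⟨h1, h2, h3, h4, -, h6⟩ := hTmem y hy
      obtain ⟨ha, hb, habz⟩ := hab y hy
      have e1 : a₀ y ^ M * (b₀ y * ∏ r, b₀ y * y.1.2 r) = p 0 := by
        rw [Finset.prod_mul_distrib, Finset.prod_const, Finset.card_univ, Fintype.card_fin]
        have : b₀ y * (y.2 ^ M * ∏ r, y.1.2 r) = p 0 :=
          div_mul_cancel₀ _ (mul_ne_zero (pow_ne_zero _ h6) h4)
        rw [← this, ← habz]
        ring
      have e2 : b₀ y ^ K * (a₀ y * ∏ r, a₀ y * y.1.1 r) = q 0 := by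
        rw [Finset.prod_mul_distrib, Finset.prod_const, Finset.card_univ, Fintype.card_fin]
        have : a₀ y * (y.2 ^ K * ∏ r, y.1.1 r) = q 0 :=
          div_mul_cancel₀ _ (mul_ne_zero (pow_ne_zero _ h6) h3)
        rw [← this, ← habz]
        ring
      simp only [φ, Fin.prod_univ_succ, Fin.cons_zero, Fin.cons_succ]
      refine ⟨fun l => ?_, fun r => ?_⟩
      · refine Fin.cases ?_ (fun l => ?_) l
        · simpa using e1
        · rw [Fin.cons_succ, mul_pow, h1, mul_right_comm, e1]
          field_simp [hp 0]
      · refine Fin.cases ?_ (fun r => ?_) r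
        · simpa using e2
        · rw [Fin.cons_succ, mul_pow, h2, mul_right_comm, e2]
          field_simp [hq 0]
    · rintro ⟨h1, h2⟩
      obtain ⟨a, b⟩ := x
      simp only at h1 h2
      have hB : ∏ r, b r ≠ 0 := fun h0 => hp 0 (by rw [← h1, h0, mul_zero])
      have hA : ∏ r, a r ≠ 0 := fun h0 => hq 0 (by rw [← h2, h0, mul_zero])
      have ha : ∀ l, a l ≠ 0 := fun l => Finset.prod_ne_zero_iff.1 hA l (Finset.mem_univ l)
      have hb : ∀ l, b l ≠ 0 := fun l => Finset.prod_ne_zero_iff.1 hB l (Finset.mem_univ l)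
      have hA' : ∏ l, a l = a 0 ^ (K + 1) * ∏ l : Fin K, a l.succ / a 0 := by
        rw [Fin.prod_univ_succ, Finset.prod_div_distrib, Finset.prod_const, Finset.card_univ,
          Fintype.card_fin, pow_succ]
        field_simp [ha 0]
      have hB' : ∏ l, b l = b 0 ^ (M + 1) * ∏ l : Fin M, b l.succ / b 0 := by
        rw [Fin.prod_univ_succ, Finset.prod_div_distrib, Finset.prod_const, Finset.card_univ,
          Fintype.card_fin, pow_succ]
        field_simp [hb 0]
      let y : ((_ : (Fin K → ℂ) × (Fin M → ℂ)) × ℂ) :=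
        ⟨(fun l => a l.succ / a 0, fun r => b r.succ / b 0), a 0 * b 0⟩
      have hA'' : ∏ l : Fin K, a l.succ / a 0 ≠ 0 := fun h0 => hA (by rw [hA', h0, mul_zero])
      have hB'' : ∏ l : Fin M, b l.succ / b 0 ≠ 0 := fun h0 => hB (by rw [hB', h0, mul_zero])
      have hay : a₀ y = a 0 := by
        simp only [a₀, y]
        rw [div_eq_iff (mul_ne_zero (pow_ne_zero _ (mul_ne_zero (ha 0) (hb 0))) hA''), ← h2 0, hA']
        ring
      have hby : b₀ y = b 0 := by
        simp only [b₀, y]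
        rw [div_eq_iff (mul_ne_zero (pow_ne_zero _ (mul_ne_zero (ha 0) (hb 0))) hB''), ← h1 0, hB']
        ring
      have hy1 : y.1 ∈ Fintype.piFinset Z ×ˢ Fintype.piFinset X := by
        rw [Finset.mem_product, Fintype.mem_piFinset, Fintype.mem_piFinset]
        refine ⟨fun l => (hZ l _).2 ?_, fun r => (hX r _).2 ?_⟩
        · simp only [y]
          rw [div_pow, ← h1 l.succ, ← h1 0]
          field_simp [ha 0, hB]
        · simp only [y]
          rw [div_pow, ← h2 r.succ, ← h2 0]
          field_simp [hb 0, hA]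
      refine ⟨y, Finset.mem_sigma.2 ⟨hy1, ((hW _ hy1).1 _).2 ?_⟩, ?_⟩
      · simp only [c, y]
        rw [eq_div_iff (mul_ne_zero hB'' hA''), ← h1 0, ← h2 0, hA', hB']
        ring
      · simp only [φ, hay, hby]
        refine Prod.ext (funext fun l => ?_) (funext fun r => ?_)
        · refine Fin.cases ?_ (fun l => ?_) l
          · simp
          · simp only [Fin.cons_succ, y]
            field_simp [ha 0]
        · refine Fin.cases ?_ (fun l => ?_) r
          · simp
          · simp only [Fin.cons_succ, y]
            field_simp [hb 0]
  · rw [Finset.card_image_of_injOn, hT]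
    intro y hy y' hy' he
    obtain ⟨ha, hb, hab1⟩ := hab y hy
    obtain ⟨ha', hb', hab2⟩ := hab y' hy'
    have e1 := fun l => congrFun (congrArg Prod.fst he) l
    have e2 := fun l => congrFun (congrArg Prod.snd he) l
    simp only [φ] at e1 e2
    have ea : a₀ y = a₀ y' := by simpa using e1 0
    have eb : b₀ y = b₀ y' := by simpa using e2 0
    obtain ⟨⟨ζ, ξ⟩, z⟩ := y
    obtain ⟨⟨ζ', ξ'⟩, z'⟩ := y'
    have h1 : ζ = ζ' := funext fun l => by
      have := e1 l.succ
      rw [Fin.cons_succ, Fin.cons_succ, ea] at this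
      exact mul_left_cancel₀ ha' this
    have h2 : ξ = ξ' := funext fun l => by
      have := e2 l.succ
      rw [Fin.cons_succ, Fin.cons_succ, eb] at this
      exact mul_left_cancel₀ hb' this
    have h3 : z = z' := by
      have h4 := hab1.symm.trans (by rw [ea, eb])
      exact h4.trans hab2
    rw [h1, h2, h3]

variable {k m : ℕ}

/-- By multihomogeneity of the cross products, the fibre over σ is cut out by monomial equations in
the scales. The exponents drop to m-1 and k-1 because the factor in front of the point cancels one
power. -/
theorem wittenMap_smul_eq_iff {σ : Particle k m → Spinor} (hk : 2 ≤ k) (hm : 2 ≤ m)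
    (hσ : ∀ a b, a ≠ b → br (σ a) (σ b) ≠ 0) (a : Fin k → ℂ) (b : Fin m → ℂ)
    (ha : ∀ l, a l ≠ 0) (hb : ∀ r, b r ≠ 0) :
    wittenMap (fun c => Sum.elim a b c • σ c) = σ ↔
      (∀ l, a l ^ (m - 1) * ∏ r, b r = (crossProd σ (Sum.inl l))⁻¹) ∧
        ∀ r, b r ^ (k - 1) * ∏ l, a l = -(crossProd σ (Sum.inr r))⁻¹ := by
  have hσ0 : ∀ c, σ c ≠ 0 := fun c => by
    cases c with
    | inl l => exact ne_zero_of_br_ne_zero (hσ (Sum.inl l) (Sum.inr ⟨0, by omega⟩) (by simp))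
    | inr l => exact ne_zero_of_br_ne_zero (hσ (Sum.inr l) (Sum.inl ⟨0, by omega⟩) (by simp))
  have hsm : ∀ (t : ℂ) (c), t • σ c = σ c ↔ t = 1 := fun t c => by
    constructor
    · intro h
      have : (t - 1) • σ c = 0 := by rw [sub_smul, h, one_smul, sub_self]
      exact sub_eq_zero.1 ((smul_eq_zero.1 this).resolve_right (hσ0 c))
    · rintro rfl
      exact one_smul _ _
  have hX := crossProd_ne_zero hσ
  have hB : ∏ r, b r ≠ 0 := Finset.prod_ne_zero_iff.2 fun r _ => hb r
  have hA : ∏ r, a r ≠ 0 := Finset.prod_ne_zero_iff.2 fun r _ => ha r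
  rw [funext_iff, Sum.forall]
  refine and_congr (forall_congr' fun l => ?_) (forall_congr' fun r => ?_)
  · rw [wittenMap, smul_smul, hsm, wittenScale, crossProd_smul]
    simp only [Sum.elim_inl, Sum.elim_inr]
    have h1 : a l ^ m = a l ^ (m - 1) * a l := by
      rw [← pow_succ]
      congr 1
      omega
    have h2 : (∏ r, b r) * (a l ^ (m - 1) * a l) * crossProd σ (Sum.inl l) ≠ 0 :=
      mul_ne_zero (mul_ne_zero hB (mul_ne_zero (pow_ne_zero _ (ha l)) (ha l))) (hX _)
    rw [h1, inv_mul_eq_one₀ h2, ← mul_eq_one_iff_eq_inv₀ (hX _)]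
    exact ⟨fun h => mul_right_cancel₀ (ha l) (by linear_combination h),
      fun h => by linear_combination a l * h⟩
  · rw [wittenMap, smul_smul, hsm, wittenScale, crossProd_smul]
    simp only [Sum.elim_inl, Sum.elim_inr]
    have h1 : b r ^ k = b r ^ (k - 1) * b r := by
      rw [← pow_succ]
      congr 1
      omega
    have h2 : (∏ r, a r) * (b r ^ (k - 1) * b r) * crossProd σ (Sum.inr r) ≠ 0 :=
      mul_ne_zero (mul_ne_zero hA (mul_ne_zero (pow_ne_zero _ (hb r)) (hb r))) (hX _)
    rw [h1, neg_mul, neg_eq_iff_eq_neg, inv_mul_eq_iff_eq_mul₀ h2, eq_neg_iff_add_eq_zero,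
      ← one_div]
    have h3 : b r ^ (k - 1) * ∏ l, a l + 1 / crossProd σ (Sum.inr r) =
        (b r + (∏ l, a l) * (b r ^ (k - 1) * b r) * crossProd σ (Sum.inr r)) /
          (b r * crossProd σ (Sum.inr r)) := by
      field_simp [hb r, hX (Sum.inr r)]
      ring
    rw [h3, div_eq_zero_iff, or_iff_left (mul_ne_zero (hb r) (hX _))]
    constructor <;> intro h <;> linear_combination h

/-- A preimage of σ can only differ from σ by rescaling its points, so the fibre is the solution set
of a monomial system, counted by `exists_finset_monomial_system`. -/
theorem exists_wittenFiber {σ : Particle k m → Spinor} (hk : 2 ≤ k) (hm : 2 ≤ m)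
    (hσ : ∀ a b, a ≠ b → br (σ a) (σ b) ≠ 0) :
    ∃ s : Finset (Particle k m → Spinor),
      (∀ u, u ∈ s ↔ (∀ a b, a ≠ b → br (u a) (u b) ≠ 0) ∧ wittenMap u = σ) ∧
      s.card = wittenDegree k m := by
  classical
  have hσ0 : ∀ c, σ c ≠ 0 := fun c => by
    cases c with
    | inl l => exact ne_zero_of_br_ne_zero (hσ (Sum.inl l) (Sum.inr ⟨0, by omega⟩) (by simp))
    | inr l => exact ne_zero_of_br_ne_zero (hσ (Sum.inr l) (Sum.inl ⟨0, by omega⟩) (by simp))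
  have hX := crossProd_ne_zero hσ
  obtain ⟨s, hs, hsc⟩ : ∃ s : Finset ((Fin k → ℂ) × (Fin m → ℂ)),
      (∀ x, x ∈ s ↔ (∀ l, x.1 l ^ (m - 1) * ∏ r, x.2 r = (crossProd σ (Sum.inl l))⁻¹) ∧
        ∀ r, x.2 r ^ (k - 1) * ∏ l, x.1 l = -(crossProd σ (Sum.inr r))⁻¹) ∧
      s.card = wittenDegree k m := by
    obtain ⟨K, rfl⟩ : ∃ K, k = K + 1 := ⟨k - 1, by omega⟩
    obtain ⟨M, rfl⟩ : ∃ M, m = M + 1 := ⟨m - 1, by omega⟩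
    obtain ⟨s, hs, hsc⟩ := exists_finset_monomial_system (K := K) (M := M) (by omega) (by omega)
      (fun l => (crossProd σ (Sum.inl l))⁻¹) (fun r => -(crossProd σ (Sum.inr r))⁻¹)
      (fun l => inv_ne_zero (hX _)) (fun r => neg_ne_zero.2 (inv_ne_zero (hX _)))
    refine ⟨s, hs, hsc.trans ?_⟩
    rw [wittenDegree]
    congr 1
    omega
  have hs0 : ∀ x ∈ s, (∀ l, x.1 l ≠ 0) ∧ ∀ r, x.2 r ≠ 0 := by
    intro x hx
    obtain ⟨h1, h2⟩ := (hs x).1 hx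
    have hB : ∏ r, x.2 r ≠ 0 := fun h0 => inv_ne_zero (hX (Sum.inl ⟨0, by omega⟩))
      (by rw [← h1, h0, mul_zero])
    have hA : ∏ r, x.1 r ≠ 0 := fun h0 => neg_ne_zero.2 (inv_ne_zero (hX (Sum.inr ⟨0, by omega⟩)))
      (by rw [← h2, h0, mul_zero])
    exact ⟨fun l => Finset.prod_ne_zero_iff.1 hA l (Finset.mem_univ l),
      fun l => Finset.prod_ne_zero_iff.1 hB l (Finset.mem_univ l)⟩
  refine ⟨s.image fun x c => Sum.elim x.1 x.2 c • σ c, fun u => ?_, ?_⟩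
  · rw [Finset.mem_image]
    constructor
    · rintro ⟨x, hx, rfl⟩
      obtain ⟨h1, h2⟩ := hs0 x hx
      refine ⟨fun a b hab => ?_, (wittenMap_smul_eq_iff hk hm hσ _ _ h1 h2).2 ((hs x).1 hx)⟩
      have h3 : ∀ c, (Sum.elim x.1 x.2 c : ℂ) ≠ 0 := fun c => by
        cases c
        · exact h1 _
        · exact h2 _
      rw [br_smul_smul]
      exact mul_ne_zero (mul_ne_zero (h3 a) (h3 b)) (hσ a b hab)
    · rintro ⟨hu, rfl⟩
      have h1 : ∀ c, (wittenScale u c)⁻¹ ≠ 0 := fun c => inv_ne_zero (wittenScale_ne_zero hu c)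
      have h2 : (fun c => (Sum.elim (fun l => (wittenScale u (Sum.inl l))⁻¹)
          (fun r => (wittenScale u (Sum.inr r))⁻¹) c : ℂ) • wittenMap u c) = u := by
        funext c
        have h3 := wittenScale_ne_zero hu c
        cases c <;> simp [wittenMap, smul_smul, h3]
      refine ⟨(fun l => (wittenScale u (Sum.inl l))⁻¹, fun r => (wittenScale u (Sum.inr r))⁻¹),
        (hs _).2 ?_, h2⟩
      rw [← wittenMap_smul_eq_iff hk hm hσ _ _ (fun l => h1 _) (fun r => h1 _), h2]
  · rw [Finset.card_image_of_injective _ ?_, hsc]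
    intro x y hxy
    have h1 : ∀ c, (Sum.elim x.1 x.2 c : ℂ) = Sum.elim y.1 y.2 c := fun c =>
      smul_left_injective ℂ (hσ0 c) (congrFun hxy c)
    exact Prod.ext (funext fun l => h1 (Sum.inl l)) (funext fun r => h1 (Sum.inr r))

end Ambitwistor

namespace Ambitwistor

open Filter Topology

variable {k m : ℕ}

/-! ### The ambitwistor string and Witten's formula -/

/-- Two points of L form a basis, so h is the scalar 1/c; a point of R then forces c² = 1. Such an
element acts trivially on every configuration. Hence distinct elements of a fibre of `wittenMap` are
never gauge equivalent, and counting elements counts orbits. -/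
theorem actPoints_eq_self_of_fixed (hk : 2 ≤ k) (hm : 1 ≤ m) {σ : Particle k m → Spinor}
    (hσ : ∀ a b, a ≠ b → br (σ a) (σ b) ≠ 0) {h : Matrix (Fin 2) (Fin 2) ℂ} {c : ℂ} (hc : c ≠ 0)
    (hfix : actPoints h c σ = σ) (u : Particle k m → Spinor) : actPoints h c u = u := by
  have h0 : ∀ i : Fin k, h.mulVec (σ (Sum.inl i)) = c⁻¹ • σ (Sum.inl i) := fun i => by
    have h1 : c • h.mulVec (σ (Sum.inl i)) = σ (Sum.inl i) := congrFun hfix (Sum.inl i)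
    rw [eq_inv_smul_iff₀ hc, h1]
  let i₀ : Fin k := ⟨0, by omega⟩
  let i₁ : Fin k := ⟨1, by omega⟩
  have hbr := hσ (Sum.inl i₀) (Sum.inl i₁) (by simp [i₀, i₁])
  have hv : ∀ v : Spinor, h.mulVec v = c⁻¹ • v := by
    intro v
    have hv' : v = (br v (σ (Sum.inl i₁)) / br (σ (Sum.inl i₀)) (σ (Sum.inl i₁))) • σ (Sum.inl i₀) +
        (br (σ (Sum.inl i₀)) v / br (σ (Sum.inl i₀)) (σ (Sum.inl i₁))) • σ (Sum.inl i₁) := by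
      funext j
      simp only [Pi.add_apply, Pi.smul_apply, smul_eq_mul]
      field_simp
      fin_cases j <;> simp [br] <;> ring
    rw [hv', Matrix.mulVec_add, Matrix.mulVec_smul, Matrix.mulVec_smul, h0, h0]
    module
  have hc2 : c⁻¹ * c⁻¹ = 1 := by
    let r : Fin m := ⟨0, by omega⟩
    have h1 : c⁻¹ • h.mulVec (σ (Sum.inr r)) = σ (Sum.inr r) := congrFun hfix (Sum.inr r)
    rw [hv, smul_smul] at h1
    have h2 := congrArg (fun v => br (σ (Sum.inl i₀)) v) h1
    have h3 := br_smul_smul 1 (c⁻¹ * c⁻¹) (σ (Sum.inl i₀)) (σ (Sum.inr r))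
    simp only [one_smul, one_mul] at h3
    simp only [h3] at h2
    exact mul_right_cancel₀ (hσ (Sum.inl i₀) (Sum.inr r) (by simp)) (h2.trans (one_mul _).symm)
  funext a
  cases a with
  | inl i => simp only [actPoints, hv, smul_smul, mul_inv_cancel₀ hc, one_smul]
  | inr i => simp only [actPoints, hv, smul_smul, hc2, one_smul]

theorem ambitwistor_gaugeEquiv_iff {N : ℕ} (ω : Fin (k + m) ≃ Particle k m)
    {σ τ : Particle k m → Spinor} : (ambitwistor k m N ω).GaugeEquiv σ τ ↔
      ∃ (h : Matrix (Fin 2) (Fin 2) ℂ) (c : ℂ), h.det = 1 ∧ c ≠ 0 ∧ τ = actPoints h c σ :=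
  ⟨fun ⟨h, c, hh, hc, _, he⟩ => ⟨h, c, hh, hc, he⟩,
    fun ⟨h, c, hh, hc, he⟩ => ⟨h, c, hh, hc, trivial, he⟩⟩

/-- The solution of Witten's equations with given marked points. -/
def wittenPoint (κ : Kinematics k m) (u : Particle k m → Spinor) :
    Particle k m ⊕ Particle k m → Spinor :=
  Sum.elim (wittenModuli κ u) u

theorem wittenPoint_mem_solutions (ω : Fin (k + m) ≃ Particle k m) {κ : Kinematics k m}
    {u : Particle k m → Spinor} (hu : ∀ a b, a ≠ b → br (u a) (u b) ≠ 0)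
    (h : wittenMap u ∈ (ambitwistor k m 0 ω).solutions κ) :
    wittenPoint κ u ∈ (witten k m ω).solutions κ :=
  (witten_mem_solutions_iff ω κ _).2 ⟨hu, fun _ => rfl, h⟩

open Classical in
/-- Representatives of the solutions of Witten's equations over a solution of those of the
ambitwistor string. -/
def wittenFiber (κ : Kinematics k m) (hk : 2 ≤ k) (hm : 2 ≤ m) (σ : Particle k m → Spinor) :
    Finset (Particle k m ⊕ Particle k m → Spinor) :=
  if hσ : ∀ a b, a ≠ b → br (σ a) (σ b) ≠ 0 then
    (exists_wittenFiber hk hm hσ).choose.image (wittenPoint κ)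
  else ∅

theorem mem_wittenFiber {κ : Kinematics k m} (hk : 2 ≤ k) (hm : 2 ≤ m) {σ : Particle k m → Spinor}
    (hσ : ∀ a b, a ≠ b → br (σ a) (σ b) ≠ 0) (x : Particle k m ⊕ Particle k m → Spinor) :
    x ∈ wittenFiber κ hk hm σ ↔ ∃ u : Particle k m → Spinor,
      ((∀ a b, a ≠ b → br (u a) (u b) ≠ 0) ∧ wittenMap u = σ) ∧ wittenPoint κ u = x := by
  rw [wittenFiber, dif_pos hσ, Finset.mem_image]
  simp only [(exists_wittenFiber hk hm hσ).choose_spec.1]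

theorem card_wittenFiber {κ : Kinematics k m} (hk : 2 ≤ k) (hm : 2 ≤ m) {σ : Particle k m → Spinor}
    (hσ : ∀ a b, a ≠ b → br (σ a) (σ b) ≠ 0) :
    (wittenFiber κ hk hm σ).card = wittenDegree k m := by
  rw [wittenFiber, dif_pos hσ, Finset.card_image_of_injective,
    (exists_wittenFiber hk hm hσ).choose_spec.2]
  exact fun u u' h => funext fun a => congrFun h (Sum.inr a)

/-- The relation between the ambitwistor string without supersymmetry and Witten's formula. -/
def wittenCorrespondence (ω : Fin (k + m) ≃ Particle k m) (κ : Kinematics k m) (hk : 2 ≤ k)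
    (hm : 2 ≤ m) : DeltaIntegral.Correspondence (ambitwistor k m 0 ω) (witten k m ω) κ
      ((-1 : ℂ) ^ (k + m - 1) • (ExteriorAlgebra.algebraMapInv :
        Grassmann (Particle k m × Fin 0) →ₐ[ℂ] ℂ).toLinearMap) (wittenDegree k m) where
  toFun x := wittenMap fun a => x (Sum.inr a)
  fiber := wittenFiber κ hk hm
  equivalence := ambitwistor_equivalence ω
  mem_solutions := ambitwistor_mem_solutions ω κ
  residue_eq := ambitwistor_residue_eq ω κ
  map_mem x hx := ((witten_mem_solutions_iff ω κ x).1 hx).2.2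
  map_equiv x hx y hy hxy := by
    rw [witten_gaugeEquiv_iff ω hx hy, ambitwistor_gaugeEquiv_iff] at hxy
    obtain ⟨h, c, hh, hc, he⟩ := hxy
    rw [he, ambitwistor_gaugeEquiv_iff]
    exact ⟨h, c, hh, hc, wittenMap_actPoints hh hc _⟩
  symm' x hx y hy hxy := (witten_gaugeEquiv_iff ω hy hx).2
    ((ambitwistor_equivalence ω).symm ((witten_gaugeEquiv_iff ω hx hy).1 hxy))
  trans' x hx y hy z hz hxy hyz := (witten_gaugeEquiv_iff ω hx hz).2
    ((ambitwistor_equivalence ω).trans ((witten_gaugeEquiv_iff ω hx hy).1 hxy)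
      ((witten_gaugeEquiv_iff ω hy hz).1 hyz))
  d_ne_zero := wittenDegree_ne_zero hk hm
  fiber_mem σ hσ x hx := by
    obtain ⟨u, ⟨hu, rfl⟩, rfl⟩ := (mem_wittenFiber hk hm hσ.1 x).1 hx
    exact wittenPoint_mem_solutions ω hu hσ
  fiber_equiv σ hσ x hx := by
    obtain ⟨u, ⟨hu, rfl⟩, rfl⟩ := (mem_wittenFiber hk hm hσ.1 x).1 hx
    exact (ambitwistor_equivalence ω).refl _
  fiber_card σ hσ := card_wittenFiber hk hm hσ.1
  fiber_inj σ hσ x hx y hy hxy := by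
    obtain ⟨u, ⟨hu, rfl⟩, rfl⟩ := (mem_wittenFiber hk hm hσ.1 x).1 hx
    obtain ⟨u', ⟨hu', he⟩, rfl⟩ := (mem_wittenFiber hk hm hσ.1 y).1 hy
    have hx' := wittenPoint_mem_solutions ω hu hσ
    have hy' := wittenPoint_mem_solutions ω hu' (by rw [he]; exact hσ)
    rw [witten_gaugeEquiv_iff ω hx' hy', ambitwistor_gaugeEquiv_iff] at hxy
    obtain ⟨h, c, hh, hc, h1⟩ := hxy
    have h2 : u' = actPoints h c u := h1
    rw [h2, wittenMap_actPoints hh hc] at he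
    rw [h2, actPoints_eq_self_of_fixed hk (by omega) hσ.1 hc he]
  fiber_surj σ hσ x hx hxσ := by
    rw [ambitwistor_gaugeEquiv_iff] at hxσ
    obtain ⟨h, c, hh, hc, h1⟩ := hxσ
    have h2 : σ = wittenMap (actPoints h c fun a => x (Sum.inr a)) := by
      rw [wittenMap_actPoints hh hc]
      exact h1
    have h3 : ∀ a b, a ≠ b → br (actPoints h c (fun a => x (Sum.inr a)) a)
      (actPoints h c (fun a => x (Sum.inr a)) b) ≠ 0 :=
        actPoints_mem_domain (N := 0) (σ := fun a => x (Sum.inr a)) ω hh hc hx.1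
    have h4 := wittenPoint_mem_solutions ω h3 (h2 ▸ hσ)
    refine ⟨wittenPoint κ (actPoints h c fun a => x (Sum.inr a)),
      (mem_wittenFiber hk hm hσ.1 _).2 ⟨_, ⟨h3, h2.symm⟩, rfl⟩,
      (witten_gaugeEquiv_iff ω h4 hx).2 ((ambitwistor_equivalence ω).symm ?_)⟩
    exact (ambitwistor_gaugeEquiv_iff ω).2 ⟨h, c, hh, hc, rfl⟩
  jacobian_eq x hx := by
    have hu : ∀ a b, a ≠ b → br (x (Sum.inr a)) (x (Sum.inr b)) ≠ 0 := hx.1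
    set u : Particle k m → Spinor := fun a => x (Sum.inr a)
    have h1 : (∏ a, wittenScale u a) ^ 2 ≠ 0 := pow_ne_zero _
      (Finset.prod_ne_zero_iff.2 fun a _ => wittenScale_ne_zero hu a)
    have h2 : (wittenDegree k m : ℂ) ≠ 0 := Nat.cast_ne_zero.2 (wittenDegree_ne_zero hk hm)
    have h3 : ∏ a, (prodOthers u a ^ 2)⁻¹ ≠ 0 := Finset.prod_ne_zero_iff.2 fun a _ =>
      inv_ne_zero (pow_ne_zero _ (prodOthers_ne_zero hu a))
    have h4 : ((-1 : ℂ) ^ (k + m - 1)) * (-1) ^ (k + m - 1) = 1 := by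
      rw [← mul_pow]; simp
    have h5 : ((-1 : ℂ) ^ (k + m - 1))⁻¹ = (-1) ^ (k + m - 1) := inv_eq_of_mul_eq_one_left h4
    have h6 : ((-1 : ℂ) ^ (k + m - 1)) ≠ 0 := left_ne_zero_of_mul_eq_one h4
    -- The factor of `witten_hasJacobian_iff`: the scales cancel against Parke–Taylor, `prodOthers`
    -- against Witten's integrand, and what remains is the sign divided by the degree.
    refine ⟨(∏ a, wittenScale u a) ^ 2 * ((-1) ^ (k + m - 1) * (wittenDegree k m : ℂ)) *
        ∏ a, (prodOthers u a ^ 2)⁻¹, mul_ne_zero (mul_ne_zero h1 (mul_ne_zero h6 h2)) h3,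
      fun J => ?_, ?_⟩
    · rw [← witten_hasJacobian_iff ω hk hm hx J, mul_assoc _ _ J]
    · have hI : (witten k m ω).integrand x =
        (parkeTaylor ω u)⁻¹ * ∏ a, (prodOthers u a ^ 2)⁻¹ := witten_integrand ω x
      rw [hI, ambitwistor_integrand_zero, parkeTaylor_wittenMap]
      generalize ∏ a, (prodOthers u a ^ 2)⁻¹ = Q at h3 ⊢
      simp only [LinearMap.smul_apply, AlgHom.toLinearMap_apply, AlgHom.commutes,
        Algebra.algebraMap_self, RingHom.id_apply, smul_eq_mul, mul_inv, h5]
      field_simp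

theorem ambitwistor_iff_witten (ω : Fin (k + m) ≃ Particle k m) (κ : Kinematics k m)
    (hk : 2 ≤ k) (hm : 2 ≤ m) (v : ℂ) :
    (ambitwistor k m 0 ω).HasValue κ (algebraMap ℂ _ v) ↔
      (witten k m ω).HasValue κ ((-1) ^ (k + m - 1) * v) := by
  have h6 : ((-1 : ℂ) ^ (k + m - 1)) ≠ 0 := pow_ne_zero _ (by simp)
  constructor
  · intro h
    simpa using (wittenCorrespondence ω κ hk hm).hasValue_map h
  · intro h
    obtain ⟨v', hv', he⟩ := (wittenCorrespondence ω κ hk hm).exists_hasValue h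
    -- The linear map of the correspondence sees only the scalar part. Nothing is lost, since every
    -- value at 𝒩 = 0 is a scalar.
    obtain ⟨c, rfl⟩ : ∃ c : ℂ, v' = algebraMap ℂ _ c := by
      obtain ⟨s, J, -, -, rfl⟩ := hv'
      refine ⟨∑ x ∈ s, (J x)⁻¹ * (parkeTaylor ω x)⁻¹, ?_⟩
      rw [map_sum]
      refine Finset.sum_congr rfl fun x _ => ?_
      rw [ambitwistor_integrand_zero, map_mul, Algebra.smul_def]
    simp only [LinearMap.smul_apply, AlgHom.toLinearMap_apply, AlgHom.commutes,
        Algebra.algebraMap_self, RingHom.id_apply, smul_eq_mul] at he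
    rwa [mul_left_cancel₀ h6 he]

end Ambitwistor

namespace Ambitwistor

open Filter Topology

variable {k m : ℕ}

/-! ### The marked points of the RSVW formula -/

/-- The marked points are distinct and the scales do not vanish. -/
def RsvwDomain (y : Particle k m → Spinor) : Prop :=
  (∀ a b, a ≠ b → y a 0 ≠ y b 0) ∧ ∀ a, y a 1 ≠ 0

/-- The product of the differences with the other marked points `j ∈ L`. -/
def diffProd (y : Particle k m → Spinor) : Particle k m → ℂ
  | Sum.inl i => ∏ j ∈ Finset.univ.erase i, (y (Sum.inl i) 0 - y (Sum.inl j) 0)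
  | Sum.inr p => ∏ j : Fin k, (y (Sum.inr p) 0 - y (Sum.inl j) 0)

/-- The scales of the marked points of the ambitwistor string. -/
def rsvwScale (y : Particle k m → Spinor) : Particle k m → ℂ
  | Sum.inl i => y (Sum.inl i) 1 * diffProd y (Sum.inl i)
  | Sum.inr p => (y (Sum.inr p) 1 * diffProd y (Sum.inr p))⁻¹

/-- The marked points of the ambitwistor string that correspond to those of the RSVW formula. -/
def rsvwMap (y : Particle k m → Spinor) (a : Particle k m) : Spinor :=
  rsvwScale y a • affinePoint (y a 0)

theorem br_affinePoint (x y : ℂ) : br (affinePoint x) (affinePoint y) = x - y := by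
  simp [br, affinePoint]

theorem diffProd_ne_zero {y : Particle k m → Spinor} (hy : RsvwDomain y) (a : Particle k m) :
    diffProd y a ≠ 0 := by
  cases a with
  | inl i => exact Finset.prod_ne_zero_iff.2 fun j hj =>
      sub_ne_zero.2 (hy.1 _ _ (by simpa using (Finset.ne_of_mem_erase hj).symm))
  | inr p => exact Finset.prod_ne_zero_iff.2 fun j _ => sub_ne_zero.2 (hy.1 _ _ (by simp))

theorem rsvwScale_ne_zero {y : Particle k m → Spinor} (hy : RsvwDomain y) (a : Particle k m) :
    rsvwScale y a ≠ 0 := by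
  cases a with
  | inl i => exact mul_ne_zero (hy.2 _) (diffProd_ne_zero hy _)
  | inr p => exact inv_ne_zero (mul_ne_zero (hy.2 _) (diffProd_ne_zero hy _))

theorem br_rsvwMap (y : Particle k m → Spinor) (a b : Particle k m) :
    br (rsvwMap y a) (rsvwMap y b) = rsvwScale y a * rsvwScale y b * (y a 0 - y b 0) := by
  rw [rsvwMap, rsvwMap, br_smul_smul, br_affinePoint]

theorem rsvwMap_mem_domain {y : Particle k m → Spinor} (hy : RsvwDomain y) (a b : Particle k m)
    (hab : a ≠ b) : br (rsvwMap y a) (rsvwMap y b) ≠ 0 := by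
  rw [br_rsvwMap]
  exact mul_ne_zero (mul_ne_zero (rsvwScale_ne_zero hy a) (rsvwScale_ne_zero hy b))
    (sub_ne_zero.2 (hy.1 a b hab))

/-- Interpolation at q distinct nodes reproduces polynomials of degree below q. -/
theorem sum_pow_mul_lagrange {q : ℕ} (v : Fin q → ℂ) (hv : Function.Injective v) (r : Fin q)
    (x : ℂ) : ∑ i, v i ^ (r : ℕ) * ∏ j ∈ Finset.univ.erase i, ((x - v j) / (v i - v j)) =
      x ^ (r : ℕ) := by
  have h := Lagrange.eq_interpolate_of_eval_eq (s := Finset.univ) (v := v)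
    (r := fun i => v i ^ (r : ℕ)) (f := Polynomial.X ^ (r : ℕ)) hv.injOn
    (by rw [Polynomial.degree_X_pow, Finset.card_univ, Fintype.card_fin]; exact_mod_cast r.2)
    (fun i _ => by simp)
  have h2 := congrArg (Polynomial.eval x) h
  rw [Polynomial.eval_pow, Polynomial.eval_X, Lagrange.interpolate_apply,
    Polynomial.eval_finsetSum] at h2
  rw [h2]
  refine Finset.sum_congr rfl fun i _ => ?_
  rw [Polynomial.eval_mul, Polynomial.eval_C, Lagrange.basis, Polynomial.eval_prod]
  congr 1
  refine Finset.prod_congr rfl fun j _ => ?_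
  simp [Lagrange.basisDivisor]
  ring

/-- Interpolation of the monomials of degree `k - 1` from the points of `L`. -/
theorem rsvw_interpolation {y : Particle k m → Spinor} (hy : RsvwDomain y) (p : Fin m)
    (r : Fin k) : ∑ i, (br (rsvwMap y (Sum.inr p)) (rsvwMap y (Sum.inl i)))⁻¹ *
      (y (Sum.inl i) 1 * y (Sum.inl i) 0 ^ (r : ℕ)) = y (Sum.inr p) 1 * y (Sum.inr p) 0 ^ (r : ℕ) := by
  rw [← sum_pow_mul_lagrange (fun i => y (Sum.inl i) 0) (fun i j h => by
    by_contra hij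
    exact hy.1 (Sum.inl i) (Sum.inl j) (by simpa using hij) h) r, Finset.mul_sum]
  refine Finset.sum_congr rfl fun i _ => ?_
  have h1 : diffProd y (Sum.inr p) = (y (Sum.inr p) 0 - y (Sum.inl i) 0) *
      ∏ j ∈ Finset.univ.erase i, (y (Sum.inr p) 0 - y (Sum.inl j) 0) :=
    (Finset.mul_prod_erase _ _ (Finset.mem_univ i)).symm
  have h2 : ∏ j ∈ Finset.univ.erase i, (y (Sum.inl i) 0 - y (Sum.inl j) 0) =
    diffProd y (Sum.inl i) := rfl
  have h3 := diffProd_ne_zero hy (Sum.inr p)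
  have h4 := diffProd_ne_zero hy (Sum.inl i)
  have h5 := hy.2 (Sum.inl i)
  have h6 := hy.2 (Sum.inr p)
  rw [Finset.prod_div_distrib, br_rsvwMap, rsvwScale, rsvwScale, h2]
  rw [h1] at h3 ⊢
  have h7 := left_ne_zero_of_mul h3
  have h8 := right_ne_zero_of_mul h3
  field_simp

/-! ### The gauge action -/

/-- The first component of `h (1, x_a)`. -/
def mobiusDenom (h : Matrix (Fin 2) (Fin 2) ℂ) (x : ℂ) : ℂ := h 0 0 + h 0 1 * x

theorem mulVec_affinePoint (h : Matrix (Fin 2) (Fin 2) ℂ) (x : ℂ) :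
    h.mulVec (affinePoint x) = ![mobiusDenom h x, h 1 0 + h 1 1 * x] := by
  funext i
  fin_cases i <;> simp [Matrix.mulVec, dotProduct, affinePoint, mobiusDenom]

/-- The action on marked points and scales. -/
def actScaled (h : Matrix (Fin 2) (Fin 2) ℂ) (c : ℂ) (y : Particle k m → Spinor)
    (a : Particle k m) : Spinor :=
  ![(h 1 0 + h 1 1 * y a 0) / mobiusDenom h (y a 0),
    c * mobiusDenom h (y a 0) ^ (k - 1) * y a 1]

theorem actScaled_sub {h : Matrix (Fin 2) (Fin 2) ℂ} (hh : h.det = 1) (c : ℂ)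
    {y : Particle k m → Spinor} {a b : Particle k m} (ha : mobiusDenom h (y a 0) ≠ 0)
    (hb : mobiusDenom h (y b 0) ≠ 0) :
    actScaled h c y a 0 - actScaled h c y b 0 =
      (y a 0 - y b 0) / (mobiusDenom h (y a 0) * mobiusDenom h (y b 0)) := by
  have h1 : (h 1 0 + h 1 1 * y a 0) * mobiusDenom h (y b 0) -
      mobiusDenom h (y a 0) * (h 1 0 + h 1 1 * y b 0) = y a 0 - y b 0 := by
    rw [Matrix.det_fin_two] at hh
    simp only [mobiusDenom]
    linear_combination (y a 0 - y b 0) * hh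
  simp only [actScaled, Matrix.cons_val_zero]
  rw [div_sub_div _ _ ha hb, h1]

theorem actScaled_mem_domain {h : Matrix (Fin 2) (Fin 2) ℂ} (hh : h.det = 1) {c : ℂ} (hc : c ≠ 0)
    {y : Particle k m → Spinor} (hy : RsvwDomain y) (hd : ∀ a, mobiusDenom h (y a 0) ≠ 0) :
    RsvwDomain (actScaled h c y) := by
  refine ⟨fun a b hab => ?_, fun a => ?_⟩
  · rw [← sub_ne_zero, actScaled_sub hh c (hd a) (hd b)]
    exact div_ne_zero (sub_ne_zero.2 (hy.1 a b hab)) (mul_ne_zero (hd a) (hd b))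
  · exact mul_ne_zero (mul_ne_zero hc (pow_ne_zero _ (hd a))) (hy.2 a)

/-- A Möbius map sends (1, x) to its denominator times the new affine point, and each difference of
points acquires the two denominators. In the scale of a point these combine to its own denominator,
times the product W of all denominators on L to the power -1 on L and +1 on R. A Möbius
transformation thus acts on σ as h accompanied by the GL(1) element 1/W. -/
theorem rsvwMap_actScaled {h : Matrix (Fin 2) (Fin 2) ℂ} (hh : h.det = 1) {c : ℂ} (hc : c ≠ 0)
    {y : Particle k m → Spinor} (hy : RsvwDomain y) (hk : 1 ≤ k)
    (hd : ∀ a, mobiusDenom h (y a 0) ≠ 0) :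
    rsvwMap (actScaled h c y) =
      actPoints h (c * (∏ j : Fin k, mobiusDenom h (y (Sum.inl j) 0))⁻¹) (rsvwMap y) := by
  set W := ∏ j : Fin k, mobiusDenom h (y (Sum.inl j) 0) with hW
  have hW0 : W ≠ 0 := Finset.prod_ne_zero_iff.2 fun j _ => hd _
  have hscale : ∀ a, rsvwScale (actScaled h c y) a =
      glWeight (c * W⁻¹) a * rsvwScale y a * mobiusDenom h (y a 0) := by
    intro a
    cases a with
    | inl i =>
      have h1 : W = mobiusDenom h (y (Sum.inl i) 0) *
          ∏ j ∈ Finset.univ.erase i, mobiusDenom h (y (Sum.inl j) 0) :=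
        (Finset.mul_prod_erase _ _ (Finset.mem_univ i)).symm
      have h2 : diffProd (actScaled h c y) (Sum.inl i) = diffProd y (Sum.inl i) /
          (mobiusDenom h (y (Sum.inl i) 0) ^ (k - 1) *
            ∏ j ∈ Finset.univ.erase i, mobiusDenom h (y (Sum.inl j) 0)) := by
        simp only [diffProd, actScaled_sub hh c (hd _) (hd _), Finset.prod_div_distrib,
          Finset.prod_mul_distrib, Finset.prod_const,
          Finset.card_erase_of_mem (Finset.mem_univ i), Finset.card_univ, Fintype.card_fin]
      have h3 := hd (Sum.inl i)
      have h4 : ∏ j ∈ Finset.univ.erase i, mobiusDenom h (y (Sum.inl j) 0) ≠ 0 :=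
        Finset.prod_ne_zero_iff.2 fun j _ => hd _
      simp only [rsvwScale, glWeight, Sum.elim_inl, h2]
      rw [h1]
      simp only [actScaled, Matrix.cons_val_one, Matrix.cons_val_fin_one]
      field_simp
    | inr p =>
      have h2 : diffProd (actScaled h c y) (Sum.inr p) = diffProd y (Sum.inr p) /
          (mobiusDenom h (y (Sum.inr p) 0) ^ k * W) := by
        simp only [diffProd, actScaled_sub hh c (hd _) (hd _), Finset.prod_div_distrib,
          Finset.prod_mul_distrib, Finset.prod_const, Finset.card_univ, Fintype.card_fin, hW]
      have h3 := hd (Sum.inr p)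
      have h5 : mobiusDenom h (y (Sum.inr p) 0) ^ k =
          mobiusDenom h (y (Sum.inr p) 0) ^ (k - 1) * mobiusDenom h (y (Sum.inr p) 0) := by
        rw [← pow_succ]; congr 1; omega
      have h6 := diffProd_ne_zero hy (Sum.inr p)
      have h7 := hy.2 (Sum.inr p)
      simp only [rsvwScale, glWeight, Sum.elim_inr, h2, h5]
      simp only [actScaled, Matrix.cons_val_one, Matrix.cons_val_fin_one]
      field_simp
  funext a
  rw [rsvwMap, hscale, actPoints_apply, rsvwMap, Matrix.mulVec_smul, mulVec_affinePoint, smul_smul]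
  have h1 : affinePoint (actScaled h c y a 0) = (mobiusDenom h (y a 0))⁻¹ •
      ![mobiusDenom h (y a 0), h 1 0 + h 1 1 * y a 0] := by
    funext i
    fin_cases i
    · simp [affinePoint, hd a]
    · simp [affinePoint, actScaled, div_eq_inv_mul]
  rw [h1, smul_smul, mul_inv_cancel_right₀ (hd a)]

/-- The marked points determine those of the RSVW formula. -/
theorem rsvwMap_injOn {y z : Particle k m → Spinor} (hz : RsvwDomain z)
    (h : rsvwMap y = rsvwMap z) : y = z := by
  have h0 : ∀ a, rsvwScale y a = rsvwScale z a := fun a => by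
    simpa [rsvwMap, affinePoint] using congrFun (congrFun h a) 0
  have h1 : ∀ a, y a 0 = z a 0 := fun a => by
    have := congrFun (congrFun h a) 1
    simp only [rsvwMap, affinePoint, Pi.smul_apply, Matrix.cons_val_one, Matrix.cons_val_fin_one,
      smul_eq_mul, h0] at this
    exact mul_left_cancel₀ (rsvwScale_ne_zero hz a) this
  have h2 : ∀ a, diffProd y a = diffProd z a := fun a => by
    cases a <;> simp only [diffProd, h1]
  have h3 : ∀ a, y a 1 = z a 1 := fun a => by
    have h4 := h0 a
    cases a with
    | inl i =>
      simp only [rsvwScale, h2] at h4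
      exact mul_right_cancel₀ (diffProd_ne_zero hz _) h4
    | inr p =>
      simp only [rsvwScale, h2, inv_inj] at h4
      exact mul_right_cancel₀ (diffProd_ne_zero hz _) h4
  funext a i
  fin_cases i
  · exact h1 a
  · exact h3 a

/-- The inverse is explicit in the chart: x_a is the ratio of the components, and t_a is obtained by
solving for the scale. -/
theorem exists_rsvwMap_eq {σ : Particle k m → Spinor}
    (hσ : ∀ a b, a ≠ b → br (σ a) (σ b) ≠ 0) (h0 : ∀ a, σ a 0 ≠ 0) :
    ∃ y, RsvwDomain y ∧ rsvwMap y = σ := by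
  let x : Particle k m → ℂ := fun a => σ a 1 / σ a 0
  let D : Particle k m → ℂ := diffProd fun a => ![x a, 0]
  let y : Particle k m → Spinor := fun a =>
    ![x a, Sum.elim (fun i => σ (Sum.inl i) 0 / D (Sum.inl i))
      (fun p => (σ (Sum.inr p) 0 * D (Sum.inr p))⁻¹) a]
  have hx : ∀ a b, a ≠ b → x a ≠ x b := fun a b hab hx => hσ a b hab (by
    simp only [x] at hx
    rw [div_eq_div_iff (h0 a) (h0 b)] at hx
    simp only [br]
    linear_combination hx)
  have hD : ∀ a, D a = diffProd y a := fun a => by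
    cases a <;> simp [D, diffProd, y]
  have hD0 : ∀ a, D a ≠ 0 := fun a => by
    have : RsvwDomain fun a : Particle k m => ![x a, 1] := ⟨by simpa using hx, by simp⟩
    have h1 := diffProd_ne_zero this a
    cases a <;> simpa [D, diffProd] using h1
  have hy : RsvwDomain y := by
    refine ⟨by simpa [y] using hx, fun a => ?_⟩
    cases a with
    | inl i => exact div_ne_zero (h0 _) (hD0 _)
    | inr p => exact inv_ne_zero (mul_ne_zero (h0 _) (hD0 _))
  have hs : ∀ a, rsvwScale y a = σ a 0 := fun a => by
    cases a with
    | inl i =>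
      rw [rsvwScale, ← hD]
      exact div_mul_cancel₀ _ (hD0 _)
    | inr p =>
      have h1 : y (Sum.inr p) 1 = (σ (Sum.inr p) 0 * D (Sum.inr p))⁻¹ := rfl
      have := h0 (Sum.inr p)
      have := hD0 (Sum.inr p)
      rw [rsvwScale, ← hD, h1]
      field_simp
  refine ⟨y, hy, funext fun a => funext fun i => ?_⟩
  rw [rsvwMap, hs]
  have := h0 a
  fin_cases i
  · simp [affinePoint]
  · simp [affinePoint, y, x]
    field_simp

/-- Each nonzero spinor excludes at most one value of s, and ℂ is infinite. The shear moves all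
marked points into the affine chart. -/
theorem exists_shear {σ : Particle k m → Spinor} (hσ : ∀ a, σ a ≠ 0) :
    ∃ s : ℂ, ∀ a, σ a 0 + s * σ a 1 ≠ 0 := by
  have hfin : (⋃ a : Particle k m, {s : ℂ | σ a 0 + s * σ a 1 = 0}).Finite := by
    refine Set.finite_iUnion fun a => Set.Subsingleton.finite fun s hs t ht => ?_
    simp only [Set.mem_ofPred_eq] at hs ht
    have h1 : (s - t) * σ a 1 = 0 := by linear_combination hs - ht
    rcases mul_eq_zero.1 h1 with h | h
    · exact sub_eq_zero.1 h
    · refine absurd (funext fun i => ?_) (hσ a)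
      rw [h, mul_zero, add_zero] at hs
      fin_cases i
      · exact hs
      · exact h
  obtain ⟨s, hs⟩ := hfin.exists_notMem
  exact ⟨s, fun a h => hs (Set.mem_iUnion.2 ⟨a, h⟩)⟩

end Ambitwistor

namespace Ambitwistor

open Filter Topology

variable {k m : ℕ}

/-! ### Solutions of the RSVW equations -/

/-- A matrix acting on tuples of spinors. -/
def matrixAct {q : ℕ} (A : Matrix (Fin q) (Fin q) ℂ) :
    (Fin q → Spinor) →ₗ[ℂ] (Fin q → Spinor) :=
  LinearMap.pi fun i => ∑ r, A i r • LinearMap.proj r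

theorem matrixAct_apply {q : ℕ} (A : Matrix (Fin q) (Fin q) ℂ) (b : Fin q → Spinor) (i : Fin q) :
    matrixAct A b i = ∑ r, A i r • b r := by
  simp [matrixAct]

/-- Exchange of the two indices. -/
def swapIndices (q : ℕ) : (Fin q → Spinor) ≃ₗ[ℂ] (Fin 2 → Fin q → ℂ) where
  toFun b α i := b i α
  invFun b i α := b α i
  map_add' _ _ := rfl
  map_smul' _ _ := rfl
  left_inv _ := rfl
  right_inv _ := rfl

/-- After exchanging indices the map is two copies of A, one for each spinor component. -/
theorem det_matrixAct {q : ℕ} (A : Matrix (Fin q) (Fin q) ℂ) :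
    LinearMap.det (matrixAct A) = A.det ^ 2 := by
  have h1 : (swapIndices q : (Fin q → Spinor) →ₗ[ℂ] _) ∘ₗ matrixAct A ∘ₗ
      ((swapIndices q).symm : (Fin 2 → Fin q → ℂ) →ₗ[ℂ] (Fin q → Spinor)) =
      LinearMap.pi fun α => Matrix.toLin' A ∘ₗ LinearMap.proj α := by
    refine LinearMap.ext fun b => funext fun α => funext fun i => ?_
    have : ((swapIndices q : (Fin q → Spinor) →ₗ[ℂ] (Fin 2 → Fin q → ℂ)) ∘ₗ matrixAct A ∘ₗ
      ((swapIndices q).symm : (Fin 2 → Fin q → ℂ) →ₗ[ℂ] (Fin q → Spinor))) b α i =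
        matrixAct A (fun i α => b α i) i α := rfl
    rw [this, matrixAct_apply]
    simp [Matrix.mulVec, dotProduct]
  rw [← LinearMap.det_conj _ (swapIndices q), h1, LinearMap.det_pi]
  simp

/-- The values at the points of `L` of the monomials of degree `k - 1`. -/
def rsvwMatrix (y : Particle k m → Spinor) : Matrix (Fin k) (Fin k) ℂ :=
  Matrix.of fun i r => y (Sum.inl i) 1 * y (Sum.inl i) 0 ^ (r : ℕ)

/-- The matrix is the diagonal of the scales times a Vandermonde matrix. -/
theorem det_rsvwMatrix_ne_zero {y : Particle k m → Spinor} (hy : RsvwDomain y) :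
    (rsvwMatrix y).det ≠ 0 := by
  have h1 : rsvwMatrix y = Matrix.diagonal (fun i => y (Sum.inl i) 1) *
      Matrix.vandermonde fun i => y (Sum.inl i) 0 := by
    ext i r
    simp [rsvwMatrix, Matrix.vandermonde_apply]
  rw [h1, Matrix.det_mul, Matrix.det_diagonal]
  refine mul_ne_zero (Finset.prod_ne_zero_iff.2 fun i _ => hy.2 _)
    (Matrix.det_vandermonde_ne_zero_iff.2 fun i j hij => ?_)
  by_contra h
  exact hy.1 (Sum.inl i) (Sum.inl j) (by simpa using h) hij

/-- The spinor with components `(e_α v)`. -/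
def lowerIndex : Spinor →ₗ[ℂ] Spinor := Matrix.toLin' !![0, -1; 1, 0]

theorem lowerIndex_apply (v : Spinor) : lowerIndex v = ![-v 1, v 0] := by
  funext i
  fin_cases i <;> simp [lowerIndex, Matrix.mulVec, dotProduct]

theorem det_lowerIndex : LinearMap.det lowerIndex = 1 := by
  simp [lowerIndex, Matrix.det_fin_two]

variable (ω : Fin (k + m) ≃ Particle k m)

theorem monomialMap_affinePoint (v : Fin k → Spinor) (x : ℂ) :
    monomialMap v (affinePoint x) = ∑ r : Fin k, x ^ (r : ℕ) • v r := by
  simp [monomialMap, affinePoint]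

theorem rsvw_args_inr (κ : Kinematics k m) (x : Fin k ⊕ Particle k m → Spinor)
    (a : Particle k m) : (rsvw k m ω).args κ x (Sum.inr a) =
      κ.1 a - ∑ r : Fin k, (x (Sum.inr a) 1 * x (Sum.inr a) 0 ^ (r : ℕ)) • x (Sum.inl r) := by
  have h1 : (rsvw k m ω).args κ x (Sum.inr a) = κ.1 a - x (Sum.inr a) 1 •
    monomialMap (fun r => x (Sum.inl r)) (affinePoint (x (Sum.inr a) 0)) := rfl
  rw [h1, monomialMap_affinePoint, Finset.smul_sum]
  simp only [smul_smul]

theorem rsvw_args_inl (κ : Kinematics k m) (x : Fin k ⊕ Particle k m → Spinor) (r : Fin k) :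
    (rsvw k m ω).args κ x (Sum.inl r) =
      lowerIndex (∑ a, (x (Sum.inr a) 1 * x (Sum.inr a) 0 ^ (r : ℕ)) • κ.2 a) := by
  funext α
  have h1 : (rsvw k m ω).args κ x (Sum.inl r) α = ∑ a, x (Sum.inr a) 1 *
    br (monomialMap (Pi.single r (Pi.single α 1)) (affinePoint (x (Sum.inr a) 0))) (κ.2 a) := rfl
  have h2 : ∀ z : ℂ, monomialMap (Pi.single r (Pi.single α (1 : ℂ)) : Fin k → Spinor)
      (affinePoint z) = z ^ (r : ℕ) • (Pi.single α (1 : ℂ) : Spinor) := by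
    intro z
    rw [monomialMap_affinePoint, Finset.sum_eq_single r]
    · rw [Pi.single_eq_same]
    · intro b _ hb
      rw [Pi.single_eq_of_ne hb, smul_zero]
    · simp
  rw [h1, lowerIndex_apply]
  fin_cases α
  · simp only [h2, Finset.sum_apply, Pi.smul_apply, smul_eq_mul, ← Finset.sum_neg_distrib]
    exact Finset.sum_congr rfl fun a _ => by simp [br]; ring
  · simp only [h2, Finset.sum_apply, Pi.smul_apply, smul_eq_mul]
    exact Finset.sum_congr rfl fun a _ => by simp [br]; ring

/-- The delta-function arguments that fix the moduli. -/
def rsvwModuliArgs (κ : Kinematics k m) (x : Fin k ⊕ Particle k m → Spinor) : Fin k → Spinor :=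
  fun i => κ.1 (Sum.inl i) - matrixAct (rsvwMatrix fun a => x (Sum.inr a)) (fun r => x (Sum.inl r)) i

/-- The coefficients with which the moduli conditions enter those of the particles in `R`. -/
def rsvwMixing (σ : Particle k m → Spinor) : (Fin k → Spinor) →ₗ[ℂ] (Particle k m → Spinor) :=
  LinearMap.pi (Sum.elim (fun _ => 0)
    (fun p => ∑ i, (br (σ (Sum.inr p)) (σ (Sum.inl i)))⁻¹ • LinearMap.proj i))

theorem rsvwMixing_inl (σ : Particle k m → Spinor) (g : Fin k → Spinor) (i : Fin k) :
    rsvwMixing σ g (Sum.inl i) = 0 := by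
  simp [rsvwMixing]

theorem rsvwMixing_inr (σ : Particle k m → Spinor) (g : Fin k → Spinor) (p : Fin m) :
    rsvwMixing σ g (Sum.inr p) = ∑ i, (br (σ (Sum.inr p)) (σ (Sum.inl i)))⁻¹ • g i := by
  simp [rsvwMixing]

/-- The components of the particles in `L`. -/
def projLeft (k m : ℕ) : (Particle k m → Spinor) →ₗ[ℂ] (Fin k → Spinor) :=
  LinearMap.funLeft ℂ Spinor Sum.inl

theorem projLeft_apply (f : Particle k m → Spinor) (i : Fin k) :
    projLeft k m f i = f (Sum.inl i) := rfl

/-- Extension by zero from `L`. -/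
def extendLeft (k m : ℕ) : (Fin k → Spinor) →ₗ[ℂ] (Particle k m → Spinor) :=
  LinearMap.pi (Sum.elim (fun i => LinearMap.proj i) (fun _ => 0))

theorem extendLeft_inl (g : Fin k → Spinor) (i : Fin k) :
    extendLeft k m g (Sum.inl i) = g i := by
  simp [extendLeft]

theorem extendLeft_inr (g : Fin k → Spinor) (p : Fin m) :
    extendLeft k m g (Sum.inr p) = 0 := by
  simp [extendLeft]

/-- Exchange of the components of the particles in `L`. -/
def swapLeft (k m : ℕ) :
    (Fin k → Spinor) × (Particle k m → Spinor) →ₗ[ℂ] (Fin k → Spinor) × (Particle k m → Spinor) :=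
  LinearMap.id + ((-LinearMap.id).prod (extendLeft k m)) ∘ₗ
    (LinearMap.id.coprod (-projLeft k m))

theorem swapLeft_apply (g : Fin k → Spinor) (f : Particle k m → Spinor) :
    swapLeft k m (g, f) = (projLeft k m f, f + extendLeft k m (g - projLeft k m f)) := by
  simp [swapLeft, sub_eq_add_neg]

/-- The exchange involves k pairs of spinors, hence 2k transpositions of scalar coordinates, an even
number. -/
theorem det_swapLeft : LinearMap.det (swapLeft k m) = 1 := by
  have h1 : LinearMap.id + (LinearMap.id.coprod (-projLeft k m)) ∘ₗ
      ((-LinearMap.id).prod (extendLeft k m)) =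
      LinearMap.pi fun i : Fin k => (-1 : ℂ) • LinearMap.proj (R := ℂ) (φ := fun _ => Spinor) i := by
    refine LinearMap.ext fun g => funext fun i => ?_
    simp [projLeft_apply, extendLeft_inl]
  have h2 : (LinearMap.pi fun i : Fin k => (-1 : ℂ) •
      LinearMap.proj (R := ℂ) (φ := fun _ => Spinor) i) =
      LinearMap.pi fun i : Fin k => ((-1 : ℂ) • (LinearMap.id : Spinor →ₗ[ℂ] Spinor)) ∘ₗ
        LinearMap.proj i := rfl
  rw [swapLeft, det_one_add_comp_comm, h1, h2, LinearMap.det_pi, LinearMap.det_smul,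
    LinearMap.det_id]
  simp

/-- The change of basis of the delta functions. -/
def rsvwChange (x : Fin k ⊕ Particle k m → Spinor) :
    (Fin k → Spinor) × (Particle k m → Spinor) →ₗ[ℂ]
      (Fin k → Spinor) × (Particle k m → Spinor) :=
  ((matrixAct (rsvwMatrix fun a => x (Sum.inr a)).transpose ∘ₗ
      LinearMap.pi fun i => lowerIndex ∘ₗ LinearMap.proj i).prodMap
    (LinearMap.id + rsvwMixing (rsvwMap fun a => x (Sum.inr a)) ∘ₗ projLeft k m)) ∘ₗ swapLeft k m

theorem rsvwChange_apply (x : Fin k ⊕ Particle k m → Spinor) (g : Fin k → Spinor)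
    (f : Particle k m → Spinor) : rsvwChange x (g, f) =
      (fun r : Fin k => ∑ i : Fin k, (x (Sum.inr (Sum.inl i)) 1 * x (Sum.inr (Sum.inl i)) 0 ^ (r : ℕ)) •
        lowerIndex (f (Sum.inl i)), Sum.elim g fun p => f (Sum.inr p) +
          ∑ i, (br (rsvwMap (fun a => x (Sum.inr a)) (Sum.inr p))
            (rsvwMap (fun a => x (Sum.inr a)) (Sum.inl i)))⁻¹ • g i) := by
  have h1 : projLeft k m (f + extendLeft k m (g - projLeft k m f)) = g := by
    funext i
    simp [projLeft_apply, extendLeft_inl]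
  rw [rsvwChange, LinearMap.comp_apply, swapLeft_apply, LinearMap.prodMap_apply]
  refine Prod.ext ?_ ?_
  · funext r
    simp only [LinearMap.comp_apply, matrixAct_apply]
    rfl
  · funext a
    simp only [LinearMap.add_apply, LinearMap.comp_apply, LinearMap.id_apply, h1, Pi.add_apply]
    cases a with
    | inl i => simp [extendLeft_inl, rsvwMixing_inl, projLeft_apply]
    | inr p => simp [extendLeft_inr, rsvwMixing_inr]

theorem det_rsvwChange (x : Fin k ⊕ Particle k m → Spinor) :
    LinearMap.det (rsvwChange x) = (rsvwMatrix fun a => x (Sum.inr a)).det ^ 2 := by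
  rw [rsvwChange, LinearMap.det_comp, det_swapLeft, mul_one, LinearMap.det_prodMap,
    det_one_add_comp_of_comp_eq_zero, mul_one, LinearMap.det_comp, det_matrixAct,
    Matrix.det_transpose, LinearMap.det_pi]
  · simp [det_lowerIndex]
  · refine LinearMap.ext fun g => funext fun i => ?_
    simp [projLeft_apply, rsvwMixing_inl]

/-- The interpolation is used twice. For R it writes t_p λ(σ_p) through the values on L, giving
λ(σ_p) up to moduli conditions. Transposed, it collects the coefficient of μ_r, a sum over all
particles, into a sum over L of t_i x_i^r times the ambitwistor argument of particle i. The swap is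
needed because the μ delta functions supply the L-equations, while the λ delta functions on L fix
the moduli. -/
theorem rsvw_factorization {N : ℕ} (κ : Kinematics k m) (x : Fin k ⊕ Particle k m → Spinor)
    (hx : RsvwDomain fun a => x (Sum.inr a)) :
    DeltaIntegral.splitVars _ _ ((rsvw k m ω).args κ x) = rsvwChange x
      (rsvwModuliArgs κ x, (ambitwistor k m N ω).args κ (rsvwMap fun a => x (Sum.inr a))) := by
  have hint := rsvw_interpolation hx
  set y : Particle k m → Spinor := fun a => x (Sum.inr a) with hy
  have hy' : ∀ a i, x (Sum.inr a) i = y a i := fun _ _ => rfl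
  rw [rsvwChange_apply]
  refine Prod.ext ?_ ?_
  · funext r
    have h1 : (DeltaIntegral.splitVars _ _ ((rsvw k m ω).args κ x)).1 r =
      (rsvw k m ω).args κ x (Sum.inl r) := rfl
    have h2 : ∀ i, (ambitwistor k m N ω).args κ (rsvwMap y) (Sum.inl i) = κ.2 (Sum.inl i) +
        ∑ p, (br (rsvwMap y (Sum.inr p)) (rsvwMap y (Sum.inl i)))⁻¹ • κ.2 (Sum.inr p) := by
      intro i
      simp only [ambitwistor, lamTildeField, br_swap (rsvwMap y (Sum.inl i)), inv_neg, neg_smul,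
        Finset.sum_neg_distrib, sub_neg_eq_add]
    rw [h1, rsvw_args_inl]
    simp only [h2, ← map_smul, ← map_sum]
    congr 1
    simp only [smul_add, Finset.sum_add_distrib, Fintype.sum_sum_type, hy', Finset.smul_sum,
      smul_smul]
    congr 1
    rw [Finset.sum_comm]
    refine Finset.sum_congr rfl fun p _ => ?_
    rw [← hint, Finset.sum_smul]
    exact Finset.sum_congr rfl fun i _ => by rw [mul_comm]
  · funext a
    have h1 : (DeltaIntegral.splitVars _ _ ((rsvw k m ω).args κ x)).2 a =
      (rsvw k m ω).args κ x (Sum.inr a) := rfl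
    rw [h1, rsvw_args_inr]
    cases a with
    | inl i =>
      simp only [Sum.elim_inl, rsvwModuliArgs, matrixAct_apply, ← hy]
      rfl
    | inr p =>
      have h2 : ∑ r : Fin k, (y (Sum.inr p) 1 * y (Sum.inr p) 0 ^ (r : ℕ)) • x (Sum.inl r) =
          ∑ i, (br (rsvwMap y (Sum.inr p)) (rsvwMap y (Sum.inl i)))⁻¹ •
            matrixAct (rsvwMatrix y) (fun r => x (Sum.inl r)) i := by
        simp only [matrixAct_apply, Finset.smul_sum, smul_smul]
        rw [Finset.sum_comm]
        refine Finset.sum_congr rfl fun r _ => ?_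
        rw [← hint, Finset.sum_smul]
        rfl
      simp only [hy', h2, Sum.elim_inr, rsvwModuliArgs, ← hy, smul_sub, Finset.sum_sub_distrib,
        ambitwistor, lamField]
      abel

/-- Invertibility of the Vandermonde-type matrix makes the change of delta functions invertible, so
the moduli conditions and the ambitwistor equations vanish separately. -/
theorem rsvw_mem_solutions_iff {N : ℕ} (κ : Kinematics k m)
    (x : Fin k ⊕ Particle k m → Spinor) :
    x ∈ (rsvw k m ω).solutions κ ↔ RsvwDomain (fun a => x (Sum.inr a)) ∧
      matrixAct (rsvwMatrix fun a => x (Sum.inr a)) (fun r => x (Sum.inl r)) =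
        (fun i => κ.1 (Sum.inl i)) ∧
      rsvwMap (fun a => x (Sum.inr a)) ∈ (ambitwistor k m N ω).solutions κ := by
  refine and_congr_right fun hx => ?_
  have hx' : RsvwDomain fun a => x (Sum.inr a) := hx
  have h1 : (rsvw k m ω).args κ x = 0 ↔ (rsvwModuliArgs κ x,
      (ambitwistor k m N ω).args κ (rsvwMap fun a => x (Sum.inr a))) = 0 := by
    have hinj : Function.Injective (rsvwChange x) := (LinearMap.equivOfDetNeZero
      (rsvwChange x) (by
        rw [det_rsvwChange]; exact pow_ne_zero 2 (det_rsvwMatrix_ne_zero hx'))).injective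
    rw [← (DeltaIntegral.splitVars _ _).map_eq_zero_iff, rsvw_factorization (N := N) ω κ x hx',
      map_eq_zero_iff _ hinj]
  rw [h1, Prod.mk_eq_zero]
  refine and_congr ?_ ⟨fun h => ⟨rsvwMap_mem_domain hx', h⟩, fun h => h.2⟩
  have h2 : rsvwModuliArgs κ x = (fun i => κ.1 (Sum.inl i)) -
    matrixAct (rsvwMatrix fun a => x (Sum.inr a)) (fun r => x (Sum.inl r)) := rfl
  rw [h2, sub_eq_zero, eq_comm]

theorem matrixAct_injective {q : ℕ} {A : Matrix (Fin q) (Fin q) ℂ} (hA : A.det ≠ 0) :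
    Function.Injective (matrixAct A) :=
  (LinearMap.equivOfDetNeZero (matrixAct A)
    (by rw [det_matrixAct]; exact pow_ne_zero 2 hA)).injective

theorem matrixAct_surjective {q : ℕ} {A : Matrix (Fin q) (Fin q) ℂ} (hA : A.det ≠ 0) :
    Function.Surjective (matrixAct A) :=
  (LinearMap.equivOfDetNeZero (matrixAct A)
    (by rw [det_matrixAct]; exact pow_ne_zero 2 hA)).surjective

end Ambitwistor

namespace Ambitwistor

open Filter Topology

variable {k m : ℕ} (ω : Fin (k + m) ≃ Particle k m)

/-! ### The gauge action of the RSVW formula -/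

/-- The transform of the monomial of degree `s`. -/
def mobiusPoly (k : ℕ) (h : Matrix (Fin 2) (Fin 2) ℂ) (s : ℕ) : Polynomial ℂ :=
  (Polynomial.C (h 1 1) - Polynomial.C (h 0 1) * Polynomial.X) ^ (k - 1 - s) *
    (Polynomial.C (h 0 0) * Polynomial.X - Polynomial.C (h 1 0)) ^ s

theorem rsvw_act_inl (h : Matrix (Fin 2) (Fin 2) ℂ) (c : ℂ) (x : Fin k ⊕ Particle k m → Spinor)
    (r : Fin k) : (rsvw k m ω).act h c x (Sum.inl r) =
      c⁻¹ • ∑ s : Fin k, (mobiusPoly k h s).coeff (r : ℕ) • x (Sum.inl s) := rfl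

theorem rsvw_act_inr (h : Matrix (Fin 2) (Fin 2) ℂ) (c : ℂ) (x : Fin k ⊕ Particle k m → Spinor) :
    (fun a => (rsvw k m ω).act h c x (Sum.inr a)) = actScaled h c fun a => x (Sum.inr a) := by
  funext a
  have h1 : (rsvw k m ω).act h c x (Sum.inr a) =
    ![h.mulVec (affinePoint (x (Sum.inr a) 0)) 1 / h.mulVec (affinePoint (x (Sum.inr a) 0)) 0,
      c * h.mulVec (affinePoint (x (Sum.inr a) 0)) 0 ^ (k - 1) * x (Sum.inr a) 1] := rfl
  rw [h1, mulVec_affinePoint]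
  rfl

theorem rsvw_actDefined_iff (h : Matrix (Fin 2) (Fin 2) ℂ) (x : Fin k ⊕ Particle k m → Spinor) :
    (rsvw k m ω).actDefined h x ↔ ∀ a, mobiusDenom h (x (Sum.inr a) 0) ≠ 0 := by
  refine forall_congr' fun a => ?_
  rw [mulVec_affinePoint]
  rfl

theorem natDegree_mobiusPoly_lt (h : Matrix (Fin 2) (Fin 2) ℂ) (s : Fin k) :
    (mobiusPoly k h s).natDegree < k := by
  have h1 : (Polynomial.C (h 1 1) - Polynomial.C (h 0 1) * Polynomial.X).natDegree ≤ 1 := by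
    compute_degree
  have h2 : (Polynomial.C (h 0 0) * Polynomial.X - Polynomial.C (h 1 0)).natDegree ≤ 1 := by
    compute_degree
  have h3 := Polynomial.natDegree_mul_le_of_le
    (Polynomial.natDegree_pow_le_of_le (k - 1 - (s : ℕ)) h1)
    (Polynomial.natDegree_pow_le_of_le (s : ℕ) h2)
  have h4 : (mobiusPoly k h s).natDegree ≤ (k - 1 - (s : ℕ)) * 1 + (s : ℕ) * 1 := h3
  have := s.2
  omega

/-- The left side evaluates `mobiusPoly` at the image of x. There its two linear factors become 1
and x, each divided by the Möbius denominator. -/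
theorem sum_coeff_mobiusPoly {h : Matrix (Fin 2) (Fin 2) ℂ} (hh : h.det = 1) {x : ℂ}
    (hx : mobiusDenom h x ≠ 0) (s : Fin k) :
    ∑ r : Fin k, (mobiusPoly k h s).coeff (r : ℕ) *
      ((h 1 0 + h 1 1 * x) / mobiusDenom h x) ^ (r : ℕ) =
      x ^ (s : ℕ) / mobiusDenom h x ^ (k - 1) := by
  rw [Fin.sum_univ_eq_sum_range (fun r => (mobiusPoly k h s).coeff r *
      ((h 1 0 + h 1 1 * x) / mobiusDenom h x) ^ r),
    ← Polynomial.eval_eq_sum_range' (natDegree_mobiusPoly_lt h s)]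
  have hd := hh
  rw [Matrix.det_fin_two] at hd
  have h1 : h 1 1 - h 0 1 * ((h 1 0 + h 1 1 * x) / mobiusDenom h x) = 1 / mobiusDenom h x := by
    field_simp
    rw [mobiusDenom]
    linear_combination hd
  have h2 : h 0 0 * ((h 1 0 + h 1 1 * x) / mobiusDenom h x) - h 1 0 = x / mobiusDenom h x := by
    field_simp
    rw [mobiusDenom]
    linear_combination x * hd
  simp only [mobiusPoly, Polynomial.eval_mul, Polynomial.eval_pow, Polynomial.eval_sub,
    Polynomial.eval_C, Polynomial.eval_X, h1, h2, div_pow, one_pow]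
  have h3 : mobiusDenom h x ^ (k - 1) =
      mobiusDenom h x ^ (k - 1 - (s : ℕ)) * mobiusDenom h x ^ (s : ℕ) := by
    rw [← pow_add]
    congr 1
    have := s.2
    omega
  rw [h3]
  field_simp

/-- The values t_i λ(σ_i) are gauge invariant: the induced action on the moduli undoes the Möbius
map on monomials, and the power of the denominator is compensated by t_i. -/
theorem matrixAct_rsvw_act {h : Matrix (Fin 2) (Fin 2) ℂ} (hh : h.det = 1) {c : ℂ} (hc : c ≠ 0)
    (x : Fin k ⊕ Particle k m → Spinor) (hd : ∀ a, mobiusDenom h (x (Sum.inr a) 0) ≠ 0) :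
    matrixAct (rsvwMatrix (actScaled h c fun a => x (Sum.inr a)))
      (fun r => (rsvw k m ω).act h c x (Sum.inl r)) =
        matrixAct (rsvwMatrix fun a => x (Sum.inr a)) fun r => x (Sum.inl r) := by
  funext i
  simp only [matrixAct_apply, rsvw_act_inl, Finset.smul_sum, smul_smul]
  rw [Finset.sum_comm]
  refine Finset.sum_congr rfl fun s _ => ?_
  rw [← Finset.sum_smul]
  congr 1
  have h1 := hd (Sum.inl i)
  have h2 := sum_coeff_mobiusPoly hh h1 s
  simp only [rsvwMatrix, Matrix.of_apply, actScaled, Matrix.cons_val_one, Matrix.cons_val_zero,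
    Matrix.cons_val_fin_one]
  have h3 : x (Sum.inr (Sum.inl i)) 0 ^ (s : ℕ) = mobiusDenom h (x (Sum.inr (Sum.inl i)) 0) ^ (k - 1) *
    (x (Sum.inr (Sum.inl i)) 0 ^ (s : ℕ) / mobiusDenom h (x (Sum.inr (Sum.inl i)) 0) ^ (k - 1)) := by
    field_simp
  rw [h3, ← h2, Finset.mul_sum, Finset.mul_sum]
  refine Finset.sum_congr rfl fun r _ => ?_
  field_simp

theorem rsvw_act_mem_solutions (hk : 1 ≤ k) {h : Matrix (Fin 2) (Fin 2) ℂ} (hh : h.det = 1)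
    {c : ℂ} (hc : c ≠ 0) {κ : Kinematics k m} {x : Fin k ⊕ Particle k m → Spinor}
    (hx : x ∈ (rsvw k m ω).solutions κ) (hd : ∀ a, mobiusDenom h (x (Sum.inr a) 0) ≠ 0) :
    (rsvw k m ω).act h c x ∈ (rsvw k m ω).solutions κ := by
  rw [rsvw_mem_solutions_iff (N := 4)] at hx ⊢
  obtain ⟨h1, h2, h3⟩ := hx
  rw [rsvw_act_inr, matrixAct_rsvw_act ω hh hc x hd, rsvwMap_actScaled hh hc h1 hk hd]
  refine ⟨actScaled_mem_domain hh hc h1 hd, h2, actPoints_mem_solutions ω hh ?_ h3⟩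
  exact mul_ne_zero hc (inv_ne_zero (Finset.prod_ne_zero_iff.2 fun j _ => hd _))

theorem rsvw_eq_of_eq {κ : Kinematics k m} {x y : Fin k ⊕ Particle k m → Spinor}
    (hx : x ∈ (rsvw k m ω).solutions κ) (hy : y ∈ (rsvw k m ω).solutions κ)
    (h : rsvwMap (fun a => x (Sum.inr a)) = rsvwMap fun a => y (Sum.inr a)) : x = y := by
  rw [rsvw_mem_solutions_iff (N := 4)] at hx hy
  have h1 := rsvwMap_injOn hy.1 h
  have h2 := hx.2.1.trans hy.2.1.symm
  rw [h1] at h2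
  have h3 := matrixAct_injective (det_rsvwMatrix_ne_zero hy.1) h2
  funext a
  cases a with
  | inl r => exact congrFun h3 r
  | inr a => exact congrFun h1 a

/-- A solution is determined by its image under `rsvwMap`, which is equivariant up to the change of
GL(1) parameter by W; multiplying c by W inverts that change. -/
theorem rsvw_gaugeEquiv_iff (hk : 1 ≤ k) {κ : Kinematics k m}
    {x y : Fin k ⊕ Particle k m → Spinor} (hx : x ∈ (rsvw k m ω).solutions κ)
    (hy : y ∈ (rsvw k m ω).solutions κ) :
    (rsvw k m ω).GaugeEquiv x y ↔ (ambitwistor k m 4 ω).GaugeEquiv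
      (rsvwMap fun a => x (Sum.inr a)) (rsvwMap fun a => y (Sum.inr a)) := by
  have hx' := (rsvw_mem_solutions_iff (N := 4) ω κ x).1 hx
  have hy' := (rsvw_mem_solutions_iff (N := 4) ω κ y).1 hy
  rw [ambitwistor_gaugeEquiv_iff]
  constructor
  · rintro ⟨h, c, hh, hc, hd, he⟩
    rw [rsvw_actDefined_iff] at hd
    have he' : (fun a => y (Sum.inr a)) = actScaled h c fun a => x (Sum.inr a) := by
      rw [he, rsvw_act_inr]
    rw [he', rsvwMap_actScaled hh hc hx'.1 hk hd]
    exact ⟨h, _, hh, mul_ne_zero hc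
      (inv_ne_zero (Finset.prod_ne_zero_iff.2 fun j _ => hd _)), rfl⟩
  · rintro ⟨h, c, hh, hc, he⟩
    -- The transformation stays in the chart because its result is the image of y, whose points have
    -- nonzero first component.
    have hd : ∀ a, mobiusDenom h (x (Sum.inr a) 0) ≠ 0 := by
      intro a h0
      have h1 := congrFun (congrFun he a) 0
      rw [actPoints_apply, rsvwMap, rsvwMap, Matrix.mulVec_smul, mulVec_affinePoint, h0] at h1
      simp only [affinePoint, Pi.smul_apply, Matrix.cons_val_zero, smul_eq_mul, mul_one,
        mul_zero] at h1
      exact rsvwScale_ne_zero hy'.1 a h1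
    set W : ℂ := ∏ j : Fin k, mobiusDenom h (x (Sum.inr (Sum.inl j)) 0) with hW
    have hW0 : W ≠ 0 := Finset.prod_ne_zero_iff.2 fun j _ => hd _
    have hcW := mul_ne_zero hc hW0
    refine ⟨h, c * W, hh, hcW, (rsvw_actDefined_iff ω h x).2 hd, ?_⟩
    refine rsvw_eq_of_eq ω hy (rsvw_act_mem_solutions ω hk hh hcW hx hd) ?_
    rw [rsvw_act_inr, rsvwMap_actScaled hh hcW hx'.1 hk hd, he, ← hW, mul_inv_cancel_right₀ hW0]

theorem rsvw_act_one (x : Fin k ⊕ Particle k m → Spinor) : (rsvw k m ω).act 1 1 x = x := by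
  funext a
  cases a with
  | inl r =>
    rw [rsvw_act_inl, Finset.sum_eq_single r]
    · simp [mobiusPoly]
    · intro s _ hs
      have : (r : ℕ) ≠ (s : ℕ) := fun h => hs (Fin.ext h.symm)
      simp [mobiusPoly, Polynomial.coeff_X_pow, this]
    · simp
  | inr a =>
    refine (congrFun (rsvw_act_inr ω 1 1 x) a).trans ?_
    funext i
    fin_cases i <;> simp [actScaled, mobiusDenom]

theorem coeff_mul_differentiableAt {X : Type*} [NormedAddCommGroup X] [NormedSpace ℂ X]
    {P Q : X → Polynomial ℂ} {x : X} (hP : ∀ n, DifferentiableAt ℂ (fun y => (P y).coeff n) x)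
    (hQ : ∀ n, DifferentiableAt ℂ (fun y => (Q y).coeff n) x) (n : ℕ) :
    DifferentiableAt ℂ (fun y => (P y * Q y).coeff n) x := by
  simp only [Polynomial.coeff_mul]
  exact DifferentiableAt.fun_sum fun i _ => (hP _).mul (hQ _)

theorem coeff_pow_differentiableAt {X : Type*} [NormedAddCommGroup X] [NormedSpace ℂ X]
    {P : X → Polynomial ℂ} {x : X} (hP : ∀ n, DifferentiableAt ℂ (fun y => (P y).coeff n) x)
    (d n : ℕ) : DifferentiableAt ℂ (fun y => (P y ^ d).coeff n) x := by
  induction d generalizing n with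
  | zero => simp
  | succ d ih =>
    simp only [pow_succ]
    exact coeff_mul_differentiableAt ih hP n

theorem rsvw_actDifferentiable (x : Fin k ⊕ Particle k m → Spinor) :
    (rsvw k m ω).ActDifferentiable x := by
  have hs : DifferentiableAt ℂ (fun p : (Fin 2 → Fin 2 → ℂ) × ℂ => p.2)
    ((1 : Matrix (Fin 2) (Fin 2) ℂ), 1) := differentiableAt_snd
  have hh : ∀ i j, DifferentiableAt ℂ (fun p : (Fin 2 → Fin 2 → ℂ) × ℂ => p.1 i j)
      ((1 : Matrix (Fin 2) (Fin 2) ℂ), 1) := fun i j =>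
    differentiableAt_pi.1 (differentiableAt_pi.1 (differentiableAt_fst (𝕜 := ℂ)
      (p := (((1 : Matrix (Fin 2) (Fin 2) ℂ), 1) : (Fin 2 → Fin 2 → ℂ) × ℂ))) i) j
  refine differentiableAt_pi.2 fun a => ?_
  cases a with
  | inl r =>
    refine (hs.inv one_ne_zero).smul (DifferentiableAt.fun_sum fun s _ => ?_)
    refine (coeff_mul_differentiableAt (fun n => coeff_pow_differentiableAt (fun n => ?_) _ n)
      (fun n => coeff_pow_differentiableAt (fun n => ?_) _ n) _).smul_const _
    · simp only [Polynomial.coeff_sub, Polynomial.coeff_C, Polynomial.coeff_C_mul]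
      refine DifferentiableAt.sub ?_ ((hh 0 1).mul_const _)
      split_ifs
      · exact hh 1 1
      · exact differentiableAt_const _
    · simp only [Polynomial.coeff_sub, Polynomial.coeff_C, Polynomial.coeff_C_mul]
      refine DifferentiableAt.sub ((hh 0 0).mul_const _) ?_
      split_ifs
      · exact hh 1 0
      · exact differentiableAt_const _
  | inr a =>
    have h1 : (fun p : (Fin 2 → Fin 2 → ℂ) × ℂ =>
        (rsvw k m ω).act (Matrix.of p.1) p.2 x (Sum.inr a)) = fun p =>
        ![(p.1 1 0 + p.1 1 1 * x (Sum.inr a) 0) * (p.1 0 0 + p.1 0 1 * x (Sum.inr a) 0)⁻¹,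
          p.2 * (p.1 0 0 + p.1 0 1 * x (Sum.inr a) 0) ^ (k - 1) * x (Sum.inr a) 1] :=
      funext fun p => (congrFun (rsvw_act_inr ω (Matrix.of p.1) p.2 x) a).trans (by
        simp only [actScaled, mobiusDenom, div_eq_mul_inv, Matrix.of_apply])
    rw [h1]
    have h2 := (hh 0 0).add ((hh 0 1).mul_const (x (Sum.inr a) 0))
    have h3 := (hh 1 0).add ((hh 1 1).mul_const (x (Sum.inr a) 0))
    have h4 := h3.mul (h2.inv (by simp))
    refine differentiableAt_pi.2 fun i => ?_
    fin_cases i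
    · exact h4
    · exact (hs.mul (h2.pow _)).mul_const _

end Ambitwistor

namespace Ambitwistor

open Filter Topology

variable {k m : ℕ}

/-! ### The derivative of the map of marked points -/

theorem diffProd_differentiableAt (y : Particle k m → Spinor) (a : Particle k m) :
    DifferentiableAt ℂ (fun y : Particle k m → Spinor => diffProd y a) y := by
  have h0 : ∀ a, DifferentiableAt ℂ (fun y : Particle k m → Spinor => y a 0) y := fun a =>
    differentiableAt_pi.1 (differentiableAt_apply a y) 0
  cases a with
  | inl i => exact prod_differentiableAt _ fun j => (h0 _).sub (h0 _)
  | inr p => exact prod_differentiableAt _ fun j => (h0 _).sub (h0 _)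

theorem scale_mul_diffProd_differentiableAt (y : Particle k m → Spinor) (a : Particle k m) :
    DifferentiableAt ℂ (fun y : Particle k m → Spinor => y a 1 * diffProd y a) y :=
  (differentiableAt_pi.1 (differentiableAt_apply a y) 1).mul (diffProd_differentiableAt y a)

theorem rsvwScale_differentiableAt {y : Particle k m → Spinor} (hy : RsvwDomain y)
    (a : Particle k m) :
    DifferentiableAt ℂ (fun y : Particle k m → Spinor => rsvwScale y a) y := by
  cases a with
  | inl i => exact scale_mul_diffProd_differentiableAt y _
  | inr p =>
    exact (scale_mul_diffProd_differentiableAt y (Sum.inr p)).inv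
      (mul_ne_zero (hy.2 _) (diffProd_ne_zero hy _))

/-- The weight of the scale of particle `a` in `rsvwScale`. -/
def scaleSign : Particle k m → ℂ := Sum.elim (fun _ => 1) (fun _ => -1)

/-- The derivative of `rsvwScale` in the direction of the scales. -/
theorem fderiv_rsvwScale {y : Particle k m → Spinor} (hy : RsvwDomain y) (a : Particle k m)
    (c : Particle k m → ℂ) :
    fderiv ℂ (fun y : Particle k m → Spinor => rsvwScale y a) y (fun b => ![0, c b]) =
      scaleSign a * (y a 1)⁻¹ * rsvwScale y a * c a := by
  have hD : ∀ t : ℂ, diffProd (y + t • fun b => ![0, c b]) a = diffProd y a := fun t => by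
    cases a <;> simp [diffProd]
  have h1 : fderiv ℂ (fun y : Particle k m → Spinor => y a 1 * diffProd y a) y
      (fun b => ![0, c b]) = c a * diffProd y a := by
    refine DeltaIntegral.fderiv_apply_of_affine (scale_mul_diffProd_differentiableAt y a)
      fun t => ?_
    rw [hD]
    simp
    ring
  have h2 := hy.2 a
  have h3 := diffProd_ne_zero hy a
  cases a with
  | inl i =>
    refine h1.trans ?_
    simp only [rsvwScale, scaleSign, Sum.elim_inl]
    field_simp
  | inr p =>
    have h4 := HasDerivAt.comp_hasFDerivAt (x := y)
      (f := fun y : Particle k m → Spinor => y (Sum.inr p) 1 * diffProd y (Sum.inr p))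
      (hasDerivAt_inv (mul_ne_zero h2 h3)) (scale_mul_diffProd_differentiableAt y (Sum.inr p)).hasFDerivAt
    have h5 : HasFDerivAt (fun y : Particle k m → Spinor => rsvwScale y (Sum.inr p)) _ y := h4
    rw [h5.fderiv, smul_apply, h1]
    simp only [rsvwScale, scaleSign, Sum.elim_inr, smul_eq_mul]
    field_simp

/-- The derivative of `rsvwMap`. -/
def rsvwDeriv (y : Particle k m → Spinor) :
    (Particle k m → Spinor) →L[ℂ] (Particle k m → Spinor) :=
  ContinuousLinearMap.pi fun a =>
    rsvwScale y a • ((ContinuousLinearMap.proj (R := ℂ) (φ := fun _ : Fin 2 => ℂ) 0 ∘L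
      ContinuousLinearMap.proj (R := ℂ) (φ := fun _ => Spinor) a).smulRight (![0, 1] : Spinor)) +
    (fderiv ℂ (fun y : Particle k m → Spinor => rsvwScale y a) y).smulRight (affinePoint (y a 0))

theorem hasFDerivAt_rsvwMap {y : Particle k m → Spinor} (hy : RsvwDomain y) :
    HasFDerivAt rsvwMap (rsvwDeriv y) y := by
  refine hasFDerivAt_pi.2 fun a => ?_
  refine (rsvwScale_differentiableAt hy a).hasFDerivAt.smul ?_
  have h1 : (fun y : Particle k m → Spinor => affinePoint (y a 0)) = fun y =>
      (![1, 0] : Spinor) + ((ContinuousLinearMap.proj (R := ℂ) (φ := fun _ : Fin 2 => ℂ) 0 ∘L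
      ContinuousLinearMap.proj (R := ℂ) (φ := fun _ => Spinor) a).smulRight (![0, 1] : Spinor)) y := by
    funext y i
    fin_cases i <;> simp [affinePoint]
  rw [h1]
  exact (ContinuousLinearMap.hasFDerivAt _).const_add _

/-- In the coordinates (x_a, normalised derivative of the scale) the map is a 2×2 block for each
particle. Passing to these coordinates costs nothing: for fixed points the scale of particle a
depends on t_a alone, so the passage is unipotent. -/
theorem det_rsvwDeriv {y : Particle k m → Spinor} (hy : RsvwDomain y) :
    LinearMap.det (rsvwDeriv y : (Particle k m → Spinor) →ₗ[ℂ] _) =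
      (-1) ^ k * (∏ a, rsvwScale y a) ^ 2 * ∏ a, (y a 1)⁻¹ := by
  have hs : ∀ a : Particle k m, scaleSign a * scaleSign a = 1 := fun a => by
    cases a <;> simp [scaleSign]
  let γ := rsvwScale y
  have hγ : ∀ a, γ a ≠ 0 := rsvwScale_ne_zero hy
  -- V is normalised to be the discrepancy between the rescaled derivative of the scale and the
  -- displacement of t_a; it vanishes on displacements of the t_a alone.
  let V : (Particle k m → Spinor) →ₗ[ℂ] (Particle k m → ℂ) := LinearMap.pi fun a =>
    (scaleSign a * y a 1 * (γ a)⁻¹) •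
      (fderiv ℂ (fun y : Particle k m → Spinor => rsvwScale y a) y :
        (Particle k m → Spinor) →ₗ[ℂ] ℂ) - (LinearMap.proj (R := ℂ) (φ := fun _ : Fin 2 => ℂ) 1 ∘ₗ
        LinearMap.proj (R := ℂ) (φ := fun _ => Spinor) a)
  let U : (Particle k m → ℂ) →ₗ[ℂ] (Particle k m → Spinor) :=
    LinearMap.pi fun a => (LinearMap.proj a).smulRight (![0, 1] : Spinor)
  let A : Particle k m → Matrix (Fin 2) (Fin 2) ℂ := fun a =>
    !![0, γ a * scaleSign a * (y a 1)⁻¹; γ a, γ a * scaleSign a * (y a 1)⁻¹ * y a 0]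
  have h1 : (rsvwDeriv y : (Particle k m → Spinor) →ₗ[ℂ] _) =
      (LinearMap.pi fun a => Matrix.toLin' (A a) ∘ₗ LinearMap.proj a) ∘ₗ
        (LinearMap.id + U ∘ₗ V) := by
    refine LinearMap.ext fun δ => funext fun a => ?_
    have h2 : (LinearMap.id + U ∘ₗ V :
        (Particle k m → Spinor) →ₗ[ℂ] (Particle k m → Spinor)) δ a = ![δ a 0, scaleSign a * y a 1 * (γ a)⁻¹ *
        fderiv ℂ (fun y : Particle k m → Spinor => rsvwScale y a) y δ] := by
      funext i
      fin_cases i <;> simp [U, V]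
    have h3 := hγ a
    have h4 := hy.2 a
    have h5 := hs a
    rw [LinearMap.comp_apply, LinearMap.pi_apply, LinearMap.comp_apply, LinearMap.proj_apply, h2]
    set d := fderiv ℂ (fun y : Particle k m → Spinor => rsvwScale y a) y δ
    have h7 : γ a * scaleSign a * (y a 1)⁻¹ * (scaleSign a * y a 1 * (γ a)⁻¹ * d) = d := by
      field_simp
      linear_combination d * h5
    have h6 : rsvwDeriv y δ a =
      γ a • (δ a 0 • (![0, 1] : Spinor)) + d • affinePoint (y a 0) := rfl
    rw [ContinuousLinearMap.coe_coe, h6]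
    funext i
    fin_cases i
    · simp [A, affinePoint, Matrix.mulVec, dotProduct, h7]
    · simp only [A, affinePoint]
      simp [Matrix.mulVec, dotProduct]
      linear_combination -(y a 0) * h7
  have h2 : V ∘ₗ U = 0 := by
    refine LinearMap.ext fun c => funext fun a => ?_
    have h3 : U c = fun b => ![0, c b] := by
      funext b i
      fin_cases i <;> simp [U]
    have h4 : V (U c) a = scaleSign a * y a 1 * (γ a)⁻¹ *
      fderiv ℂ (fun y : Particle k m → Spinor => rsvwScale y a) y (U c) - U c a 1 := rfl
    have h5 := hγ a
    have h6 := hy.2 a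
    rw [LinearMap.comp_apply, h4, h3, fderiv_rsvwScale hy]
    have h7 := hs a
    simp only [Matrix.cons_val_one, Matrix.cons_val_fin_one, LinearMap.zero_apply, Pi.zero_apply]
    change scaleSign a * y a 1 * (γ a)⁻¹ * (scaleSign a * (y a 1)⁻¹ * γ a * c a) - c a = 0
    field_simp
    linear_combination c a * h7
  have h3 : ∀ a, (A a).det = scaleSign a * (-1) * (γ a ^ 2 * (y a 1)⁻¹) := fun a => by
    rw [Matrix.det_fin_two]
    simp [A]
    ring
  -- Each block contributes a minus sign, cancelled on R because there the scale is inverse to t_p.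
  -- This is the origin of (-1)^k.
  have h4 : ∏ a : Particle k m, scaleSign a * (-1) = (-1) ^ k := by
    simp [Fintype.prod_sum_type, scaleSign]
  rw [h1, LinearMap.det_comp, det_one_add_comp_of_comp_eq_zero _ _ h2, mul_one, LinearMap.det_pi]
  simp only [LinearMap.det_toLin', h3]
  rw [Finset.prod_mul_distrib, h4, Finset.prod_mul_distrib, Finset.prod_pow, mul_assoc]

end Ambitwistor

namespace Ambitwistor

open Filter Topology

variable {k m : ℕ} (ω : Fin (k + m) ≃ Particle k m)

/-! ### The Jacobian of the RSVW formula -/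

theorem eventually_rsvwDomain {X : Type*} [TopologicalSpace X] {f : X → Particle k m → Spinor}
    {x : X} (hf : ContinuousAt f x) (h : RsvwDomain (f x)) : ∀ᶠ y in 𝓝 x, RsvwDomain (f y) := by
  have h1 : ∀ a i, ContinuousAt (fun y => f y a i) x := fun a i =>
    continuousAt_pi.1 (continuousAt_pi.1 hf a) i
  refine Eventually.and ?_ (eventually_all.2 fun a => (h1 a 1).eventually_ne (h.2 a))
  refine eventually_all.2 fun a => eventually_all.2 fun b => ?_
  by_cases hab : a = b
  · exact Eventually.of_forall fun _ h => absurd hab h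
  · exact ((h1 a 0).ne_iff_eventually_ne (h1 b 0) |>.1 (h.1 a b hab)).mono fun y hy _ => hy

theorem eventually_mobiusDenom_ne_zero (x : ℂ) :
    ∀ᶠ v in 𝓝 0, mobiusDenom (Matrix.of (DeltaIntegral.slCurve v)) x ≠ 0 := by
  have h1 : ContinuousAt (fun v : Fin 4 → ℂ => 1 + v 0 + v 1 * x) 0 :=
    ((continuous_const.add (continuous_apply 0)).add
      ((continuous_apply 1).mul continuous_const)).continuousAt
  exact h1.eventually_ne (by simp)

/-- The weight `c` with which the gauge transformation of the RSVW variables acts on the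
ambitwistor string. -/
def rsvwWeight (y : Particle k m → Spinor) (v : Fin 4 → ℂ) : ℂ :=
  (1 + v 3) * (∏ j : Fin k, mobiusDenom (Matrix.of (DeltaIntegral.slCurve v)) (y (Sum.inl j) 0))⁻¹

theorem rsvwWeight_differentiableAt (y : Particle k m → Spinor) :
    DifferentiableAt ℂ (rsvwWeight y) 0 := by
  have hp : ∀ i : Fin 4, DifferentiableAt ℂ (fun v : Fin 4 → ℂ => v i) 0 := fun i =>
    differentiableAt_apply i 0
  have h1 : DifferentiableAt ℂ (fun v : Fin 4 → ℂ =>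
      ∏ j : Fin k, mobiusDenom (Matrix.of (DeltaIntegral.slCurve v)) (y (Sum.inl j) 0)) 0 :=
    prod_differentiableAt _ fun j => ((hp 0).const_add 1).add ((hp 1).mul_const _)
  have h2 : ∏ j : Fin k, mobiusDenom (Matrix.of (DeltaIntegral.slCurve 0)) (y (Sum.inl j) 0) ≠ 0 :=
    Finset.prod_ne_zero_iff.2 fun j _ => by simp [mobiusDenom, DeltaIntegral.slCurve]
  exact ((hp 3).const_add 1).mul (h1.inv h2)

theorem fderiv_rsvwWeight (y : Particle k m → Spinor) :
    fderiv ℂ (rsvwWeight y) 0 (Pi.single 3 1) = 1 := by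
  refine DeltaIntegral.fderiv_apply_of_affine (rsvwWeight_differentiableAt y) fun t => ?_
  simp [rsvwWeight, mobiusDenom, DeltaIntegral.slCurve]

/-- The derivative of `rsvwWeight` completed to a map of Lie algebras. -/
def rsvwLieMap (y : Particle k m → Spinor) : (Fin 4 → ℂ) →L[ℂ] (Fin 4 → ℂ) :=
  ContinuousLinearMap.id ℂ _ + (fderiv ℂ (rsvwWeight y) 0 -
    ContinuousLinearMap.proj (R := ℂ) (φ := fun _ : Fin 4 => ℂ) 3).smulRight (Pi.single 3 1)

/-- The Möbius denominators make the induced GL(1) weight depend on the sl(2) parameters, but its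
derivative in the GL(1) direction is 1, so the map of Lie algebras is a transvection. -/
theorem det_rsvwLieMap (y : Particle k m → Spinor) :
    LinearMap.det (rsvwLieMap y : (Fin 4 → ℂ) →ₗ[ℂ] (Fin 4 → ℂ)) = 1 := by
  let f : (Fin 4 → ℂ) →ₗ[ℂ] ℂ := (fderiv ℂ (rsvwWeight y) 0 -
    ContinuousLinearMap.proj (R := ℂ) (φ := fun _ : Fin 4 => ℂ) 3 : (Fin 4 → ℂ) →L[ℂ] ℂ)
  let e : ℂ →ₗ[ℂ] (Fin 4 → ℂ) := LinearMap.toSpanSingleton ℂ _ (Pi.single 3 1)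
  have h1 : (rsvwLieMap y : (Fin 4 → ℂ) →ₗ[ℂ] (Fin 4 → ℂ)) = LinearMap.id + e ∘ₗ f := by
    refine LinearMap.ext fun v => ?_
    rfl
  rw [h1, det_one_add_comp_of_comp_eq_zero]
  refine LinearMap.ext_ring ?_
  have h2 : (f ∘ₗ e) 1 = f ((1 : ℂ) • (Pi.single 3 1 : Fin 4 → ℂ)) := rfl
  have h3 : f (Pi.single 3 1) = fderiv ℂ (rsvwWeight y) 0 (Pi.single 3 1) -
    (Pi.single 3 1 : Fin 4 → ℂ) 3 := rfl
  rw [h2, one_smul, h3, fderiv_rsvwWeight]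
  simp

theorem hasFDerivAt_slCurve_rsvwWeight (y : Particle k m → Spinor) :
    HasFDerivAt (fun v : Fin 4 → ℂ => (DeltaIntegral.slCurve v, rsvwWeight y v))
      ((LinearMap.toContinuousLinearMap DeltaIntegral.lieElement) ∘L rsvwLieMap y) 0 := by
  refine (DeltaIntegral.hasFDerivAt_slCurve.prodMk
    (rsvwWeight_differentiableAt y).hasFDerivAt).congr_fderiv ?_
  refine ContinuousLinearMap.ext fun v => Prod.ext ?_ ?_
  · funext i j
    fin_cases i <;> fin_cases j <;> simp [DeltaIntegral.lieElement, rsvwLieMap]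
  · simp [DeltaIntegral.lieElement, rsvwLieMap]

/-- The squared determinant of the interpolation matrix appears twice, once from the change of delta
functions and once from the λ-moduli. The sign in the derivative of the moduli conditions is
harmless in even dimension 2k. -/
theorem rsvw_hasJacobian_iff (hk : 1 ≤ k) {κ : Kinematics k m}
    {x : Fin k ⊕ Particle k m → Spinor} (hx : x ∈ (rsvw k m ω).solutions κ) (J : ℂ) :
    (rsvw k m ω).HasJacobian κ x
      ((rsvwMatrix fun a => x (Sum.inr a)).det ^ 2 *
        ((-1) ^ k * (∏ a, rsvwScale (fun a => x (Sum.inr a)) a) ^ 2 * ∏ a, (x (Sum.inr a) 1)⁻¹) *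
        ((rsvwMatrix fun a => x (Sum.inr a)).det ^ 2 * J)) ↔
      (ambitwistor k m 4 ω).HasJacobian κ (rsvwMap fun a => x (Sum.inr a)) J := by
  have hy : RsvwDomain fun a => x (Sum.inr a) := hx.1
  set y : Particle k m → Spinor := fun a => x (Sum.inr a) with hydef
  have hV := pow_ne_zero 2 (det_rsvwMatrix_ne_zero hy)
  have hC : (-1) ^ k * (∏ a, rsvwScale y a) ^ 2 * ∏ a, (y a 1)⁻¹ ≠ 0 :=
    mul_ne_zero (mul_ne_zero (pow_ne_zero _ (by simp)) (pow_ne_zero _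
      (Finset.prod_ne_zero_iff.2 fun a _ => rsvwScale_ne_zero hy a)))
      (Finset.prod_ne_zero_iff.2 fun a _ => inv_ne_zero (hy.2 a))
  have hproj : ContinuousAt (fun z : Fin k ⊕ Particle k m → Spinor =>
      fun a : Particle k m => z (Sum.inr a)) x :=
    (continuous_pi fun a => continuous_apply _).continuousAt
  have hpr : ∀ a, DifferentiableAt ℂ (fun z : Fin k ⊕ Particle k m → Spinor => z a) x :=
    fun a => differentiableAt_apply a x
  have hpr' : ∀ a i, DifferentiableAt ℂ (fun z : Fin k ⊕ Particle k m → Spinor => z a i) x :=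
    fun a => differentiableAt_pi.1 (hpr a)
  have hmon : ∀ (a : Particle k m) (r : ℕ), DifferentiableAt ℂ
      (fun z : Fin k ⊕ Particle k m → Spinor => z (Sum.inr a) 1 * z (Sum.inr a) 0 ^ r) x :=
    fun a r => (hpr' _ 1).mul ((hpr' _ 0).pow r)
  have hG : DifferentiableAt ℂ (rsvwModuliArgs κ) x := by
    refine differentiableAt_pi.2 fun i => ?_
    simp only [rsvwModuliArgs, matrixAct_apply]
    exact (DifferentiableAt.fun_sum fun (r : Fin k) _ =>
      (hmon (Sum.inl i) (r : ℕ)).fun_smul (hpr (Sum.inl r))).const_sub _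
  have hdetE : LinearMap.det (-matrixAct (rsvwMatrix y)) = (rsvwMatrix y).det ^ 2 := by
    have h1 : -matrixAct (rsvwMatrix y) = (-1 : ℂ) • matrixAct (rsvwMatrix y) :=
      (neg_one_smul ℂ _).symm
    rw [h1, LinearMap.det_smul, det_matrixAct, Module.finrank_pi_fintype]
    simp
  have key := DeltaIntegral.hasJacobian_iff_of_factorization (ambitwistor k m 4 ω)
    (rsvw k m ω) κ x rsvwModuliArgs rsvwMap rsvwChange (-matrixAct (rsvwMatrix y))
    (rsvwDeriv y) (rsvwLieMap y)
    ((eventually_rsvwDomain hproj hy).mono fun z hz κ' => rsvw_factorization ω κ' z hz)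
    ?_ (by rw [det_rsvwChange]; exact hV) hx.2 hG ?_
    (by rw [hdetE]; exact hV) ?_ (hasFDerivAt_rsvwMap hy)
    (by rw [det_rsvwDeriv hy]; exact hC)
    (ambitwistor_differentiableAt ω κ (rsvwMap_mem_domain hy))
    (ambitwistor_differentiableAt_kinematics ω κ _) (rsvw_actDifferentiable ω x)
    (rsvw_act_one ω x) ?_ (ambitwistor_actDifferentiable ω _)
    (fun v => (DeltaIntegral.slCurve v, rsvwWeight y v))
    ?_ (hasFDerivAt_slCurve_rsvwWeight y) ?_ (det_rsvwLieMap y)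
    (ambitwistor_fderiv_generators ω κ (rsvwMap_mem_domain hy)) J
  · rw [det_rsvwChange, det_rsvwDeriv hy, hdetE] at key
    exact key
  · intro v
    obtain ⟨g, f⟩ := v
    have hσ : ∀ a, ContinuousAt (fun z : Fin k ⊕ Particle k m → Spinor =>
        rsvwMap (fun a => z (Sum.inr a)) a) x := fun a =>
      ContinuousAt.comp_of_eq (g := fun u => rsvwMap u a)
        (continuousAt_pi.1 (hasFDerivAt_rsvwMap hy).continuousAt a) hproj rfl
    have hbr : ∀ a b, a ≠ b → ContinuousAt (fun z : Fin k ⊕ Particle k m → Spinor =>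
        (br (rsvwMap (fun a => z (Sum.inr a)) a) (rsvwMap (fun a => z (Sum.inr a)) b))⁻¹) x := by
      intro a b hab
      refine ContinuousAt.inv₀ ?_ (rsvwMap_mem_domain hy a b hab)
      exact ((continuousAt_pi.1 (hσ a) 1).mul (continuousAt_pi.1 (hσ b) 0)).sub
        ((continuousAt_pi.1 (hσ a) 0).mul (continuousAt_pi.1 (hσ b) 1))
    simp only [rsvwChange_apply]
    refine ContinuousAt.prodMk ?_ ?_
    · refine continuousAt_pi.2 fun r => ?_
      exact tendsto_finsetSum _ fun i _ => (hmon (Sum.inl i) r).continuousAt.smul continuousAt_const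
    · refine continuousAt_pi.2 fun a => ?_
      cases a with
      | inl l => exact continuousAt_const
      | inr p =>
        refine ContinuousAt.add continuousAt_const ?_
        exact tendsto_finsetSum _ fun r _ => (hbr _ _ (by simp)).smul continuousAt_const
  · intro a
    refine DeltaIntegral.fderiv_apply_of_affine hG fun t => ?_
    have e1 : (fun b : Particle k m => (x + t • (DeltaIntegral.splitVars
        (Fin k) (Particle k m)).symm (a, 0)) (Sum.inr b)) = y := by
      funext b
      simp [hydef]
    have e2 : (fun r => (x + t • (DeltaIntegral.splitVars
        (Fin k) (Particle k m)).symm (a, 0)) (Sum.inl r)) = (fun r => x (Sum.inl r)) + t • a := by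
      funext r
      simp
    funext i
    have e3 : ∀ z : Fin k ⊕ Particle k m → Spinor, rsvwModuliArgs κ z i = κ.1 (Sum.inl i) -
      matrixAct (rsvwMatrix fun a => z (Sum.inr a)) (fun r => z (Sum.inl r)) i := fun _ => rfl
    simp only [Pi.add_apply, Pi.smul_apply, e3]
    simp only [Pi.add_apply, Pi.smul_apply] at e1 e2
    rw [e1, e2, map_add, map_smul]
    simp only [Pi.add_apply, Pi.smul_apply, LinearMap.neg_apply, Pi.neg_apply]
    module
  · have h1 : ∀ a, DifferentiableAt ℂ (fun κ : Kinematics k m => κ.1 a) κ := fun a => by fun_prop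
    exact differentiableAt_pi.2 fun i => (h1 _).sub_const _
  · filter_upwards [DeltaIntegral.eventually_det_slCurve,
      DeltaIntegral.eventually_one_add_ne_zero 3,
      eventually_all.2 fun a => eventually_mobiusDenom_ne_zero (y a 0)] with v hv hv' hd
    exact (rsvw_act_mem_solutions ω hk hv hv' hx hd).2
  · exact Prod.ext DeltaIntegral.slCurve_zero
      (by simp [rsvwWeight, DeltaIntegral.slCurve, mobiusDenom])
  · filter_upwards [DeltaIntegral.eventually_det_slCurve,
      DeltaIntegral.eventually_one_add_ne_zero 3,
      eventually_all.2 fun a => eventually_mobiusDenom_ne_zero (y a 0)] with v hv hv' hd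
    have h1 := rsvwMap_actScaled hv hv' hy hk hd
    rw [← rsvw_act_inr ω] at h1
    exact h1

end Ambitwistor

namespace Ambitwistor

/-! ### Berezin integrals of products of generators -/

section Contraction

variable {M : Type*} [AddCommGroup M] [Module ℂ M]

/-- The contraction with a linear form. -/
abbrev contraction (d : M →ₗ[ℂ] ℂ) : ExteriorAlgebra ℂ M →ₗ[ℂ] ExteriorAlgebra ℂ M :=
  CliffordAlgebra.contractLeft (Q := (0 : QuadraticForm ℂ M)) d

theorem contraction_ι_mul (d : M →ₗ[ℂ] ℂ) (v : M) (z : ExteriorAlgebra ℂ M) :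
    contraction d (ExteriorAlgebra.ι ℂ v * z) = d v • z - ExteriorAlgebra.ι ℂ v * contraction d z :=
  CliffordAlgebra.contractLeft_ι_mul d v z

/-- Iterated contraction; the last form is applied first. -/
def iteratedContraction (l : List (M →ₗ[ℂ] ℂ)) : ExteriorAlgebra ℂ M →ₗ[ℂ] ExteriorAlgebra ℂ M :=
  l.foldr (fun d f => (contraction d).comp f) LinearMap.id

theorem iteratedContraction_concat (l : List (M →ₗ[ℂ] ℂ)) (d : M →ₗ[ℂ] ℂ)
    (z : ExteriorAlgebra ℂ M) :
    iteratedContraction (l.concat d) z = iteratedContraction l (contraction d z) := by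
  induction l with
  | nil => rfl
  | cons a l ih => exact congrArg (contraction a) ih

/-- Contraction is an antiderivation, so it removes one factor at a time with alternating signs. -/
theorem contraction_ιMulti_mul (d : M →ₗ[ℂ] ℂ) {Y : ExteriorAlgebra ℂ M}
    (hY : contraction d Y = 0) {N : ℕ} (w : Fin (N + 1) → M) :
    contraction d (ExteriorAlgebra.ιMulti ℂ (N + 1) w * Y) =
      ∑ j : Fin (N + 1), ((-1) ^ (j : ℕ) * d (w j)) •
        (ExteriorAlgebra.ιMulti ℂ N (fun i => w (j.succAbove i)) * Y) := by
  induction N with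
  | zero => simp [ExteriorAlgebra.ιMulti_apply, contraction_ι_mul, hY]
  | succ N ih =>
    have h1 : ExteriorAlgebra.ιMulti ℂ (N + 1 + 1) w =
        ExteriorAlgebra.ι ℂ (w 0) * ExteriorAlgebra.ιMulti ℂ (N + 1) (fun i => w i.succ) :=
      ExteriorAlgebra.ιMulti_succ_apply w
    have h2 : ∀ j : Fin (N + 1),
        ExteriorAlgebra.ιMulti ℂ (N + 1) (fun i => w (j.succ.succAbove i)) =
        ExteriorAlgebra.ι ℂ (w 0) *
          ExteriorAlgebra.ιMulti ℂ N (fun i => w (j.succAbove i).succ) := by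
      intro j
      rw [ExteriorAlgebra.ιMulti_succ_apply]
      congr 2
      funext i
      simp [Matrix.vecTail]
    conv_rhs => rw [Fin.sum_univ_succ]
    rw [h1, mul_assoc, contraction_ι_mul, ih]
    simp only [h2, Finset.mul_sum, sub_eq_add_neg, ← Finset.sum_neg_distrib]
    congr 1
    · simp
    · refine Finset.sum_congr rfl fun j _ => ?_
      rw [mul_smul_comm, ← neg_smul, mul_assoc]
      congr 1
      rw [Fin.val_succ, pow_succ]
      ring

/-- The last contraction acts first and yields the Laplace expansion along the last row. Each stage
leaves a sign (-1)^N, and these accumulate to the triangular exponent. -/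
theorem iteratedContraction_ιMulti_mul {N : ℕ} (d : Fin N → M →ₗ[ℂ] ℂ)
    {Y : ExteriorAlgebra ℂ M} (hY : ∀ i, contraction (d i) Y = 0) (w : Fin N → M) :
    iteratedContraction (List.ofFn d) (ExteriorAlgebra.ιMulti ℂ N w * Y) =
      ((-1) ^ N.choose 2 * (Matrix.of fun i j => d i (w j)).det) • Y := by
  induction N with
  | zero => simp [iteratedContraction]
  | succ N ih =>
    rw [List.ofFn_succ', iteratedContraction_concat, contraction_ιMulti_mul _ (hY _), map_sum,
      Matrix.det_succ_row _ (Fin.last N), Finset.mul_sum, Finset.sum_smul]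
    refine Finset.sum_congr rfl fun j _ => ?_
    rw [map_smul, ih (fun i => d i.castSucc) (fun i => hY _), smul_smul]
    congr 1
    have h1 : (N + 1).choose 2 = N + N.choose 2 := by
      rw [Nat.choose_succ_succ' N 1, Nat.choose_one_right]
    have h2 : (Matrix.of fun i j => d i (w j)).submatrix (Fin.last N).succAbove j.succAbove =
        Matrix.of fun (i : Fin N) (i' : Fin N) => d i.castSucc (w (j.succAbove i')) := by
      ext i i'
      simp
    have h3 : ((-1 : ℂ) ^ N) * (-1) ^ N = 1 := by rw [← mul_pow]; simp
    rw [h1, h2, pow_add, pow_add, Fin.val_last, Matrix.of_apply]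
    linear_combination -((-1 : ℂ) ^ (j : ℕ) * d (Fin.last N) (w j) * (-1) ^ N.choose 2 *
      (Matrix.of fun (i : Fin N) (i' : Fin N) => d i.castSucc (w (j.succAbove i'))).det) * h3

theorem contraction_ιMulti_eq_zero (d : M →ₗ[ℂ] ℂ) {N : ℕ} (w : Fin N → M)
    (h : ∀ i, d (w i) = 0) : contraction d (ExteriorAlgebra.ιMulti ℂ N w) = 0 := by
  induction N with
  | zero => simp
  | succ N ih =>
    rw [ExteriorAlgebra.ιMulti_succ_apply, contraction_ι_mul, h, zero_smul, zero_sub, neg_eq_zero]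
    exact mul_eq_zero_of_right _ (ih _ fun i => h _)

/-- Products of generators commute with generators up to sign. -/
theorem ιMulti_mul_ι {N : ℕ} (w : Fin N → M) (v : M) :
    ExteriorAlgebra.ιMulti ℂ N w * ExteriorAlgebra.ι ℂ v =
      (-1 : ℂ) ^ N • (ExteriorAlgebra.ι ℂ v * ExteriorAlgebra.ιMulti ℂ N w) := by
  induction N with
  | zero => simp
  | succ N ih =>
    have h1 := eq_neg_of_add_eq_zero_left (ExteriorAlgebra.ι_add_mul_swap (R := ℂ) (w 0) v)
    rw [ExteriorAlgebra.ιMulti_succ_apply, mul_assoc, ih, mul_smul_comm, ← mul_assoc, h1, pow_succ,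
      mul_smul, neg_one_smul, neg_mul, mul_assoc]

/-- Generators may be shifted by elements that the other factor annihilates. -/
theorem ιMulti_mul_ιMulti_congr {N N' : ℕ} (w : Fin N → M) (v v' : Fin N' → M)
    (h : ∀ j, ExteriorAlgebra.ι ℂ (v j - v' j) * ExteriorAlgebra.ιMulti ℂ N w = 0) :
    ExteriorAlgebra.ιMulti ℂ N w * ExteriorAlgebra.ιMulti ℂ N' v =
      ExteriorAlgebra.ιMulti ℂ N w * ExteriorAlgebra.ιMulti ℂ N' v' := by
  induction N' with
  | zero => simp
  | succ N' ih =>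
    have h1 : ExteriorAlgebra.ι ℂ (v 0) * ExteriorAlgebra.ιMulti ℂ N w =
        ExteriorAlgebra.ι ℂ (v' 0) * ExteriorAlgebra.ιMulti ℂ N w := by
      rw [← sub_eq_zero, ← sub_mul, ← map_sub, h]
    have h2 := ih (fun i => v i.succ) (fun i => v' i.succ) fun j => h _
    have h3 : ∀ v : Fin (N' + 1) → M, ExteriorAlgebra.ιMulti ℂ (N' + 1) v =
      ExteriorAlgebra.ι ℂ (v 0) * ExteriorAlgebra.ιMulti ℂ N' (fun i => v i.succ) := fun v =>
        ExteriorAlgebra.ιMulti_succ_apply v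
    rw [h3, h3, ← mul_assoc, ← mul_assoc, ιMulti_mul_ι, ιMulti_mul_ι, smul_mul_assoc,
      smul_mul_assoc, mul_assoc, mul_assoc, h2, ← mul_assoc, ← mul_assoc, h1]

end Contraction

theorem prod_ofFn_prod {A : Type*} [Monoid A] {a b : ℕ} (f : Fin a → Fin b → A) :
    (List.ofFn fun i => (List.ofFn (f i)).prod).prod =
      (List.ofFn fun n : Fin (a * b) =>
        f (finProdFinEquiv.symm n).1 (finProdFinEquiv.symm n).2).prod := by
  rw [List.ofFn_mul, List.prod_flatten, List.map_ofFn]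
  congr 2
  funext i
  simp only [Function.comp_apply]
  congr 2
  funext j
  have h1 : finProdFinEquiv.symm (⟨(i : ℕ) * b + j, by
      calc
        (i : ℕ) * b + j < (i + 1) * b :=
          (Nat.add_lt_add_left j.prop _).trans_eq (by rw [Nat.add_mul, Nat.one_mul])
        _ ≤ a * b := Nat.mul_le_mul_right _ i.prop⟩ : Fin (a * b)) = (i, j) := by
    rw [Equiv.symm_apply_eq]
    ext
    simp [finProdFinEquiv]
    ring
  rw [h1]

theorem berezin_map {S : Type} (l : List S) :
    berezin l = iteratedContraction (l.map fun s => (LinearMap.proj s : (S → ℂ) →ₗ[ℂ] ℂ)) := by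
  induction l with
  | nil => rfl
  | cons a l ih => exact congrArg (fun f => (berezin₁ a).comp f) ih

theorem finRange_product (a b : ℕ) : (List.finRange a).product (List.finRange b) =
    List.ofFn fun n : Fin (a * b) => finProdFinEquiv.symm n := by
  rw [List.ofFn_mul, List.product, ← List.ofFn_id, ← List.ofFn_id, List.flatMap,
    List.map_ofFn]
  congr 2
  funext i
  simp only [Function.comp_apply, List.map_ofFn]
  congr 1
  funext j
  simp only [Function.comp_apply, id]
  rw [eq_comm, Equiv.symm_apply_eq]
  ext
  simp [finProdFinEquiv]
  ring

end Ambitwistor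

namespace Ambitwistor

open scoped Kronecker

variable {k m : ℕ}

/-! ### The fermionic moduli of the RSVW formula -/

/-- The linear combination of generators `η_a - t_a χ(σ_a)`. -/
def rsvwFermiVec (y : Particle k m → Spinor) (a : Particle k m) (A : Fin 4) :
    Fin k × Fin 4 ⊕ Particle k m × Fin 4 → ℂ :=
  Pi.single (Sum.inr (a, A)) 1 -
    ∑ r : Fin k, (y a 1 * y a 0 ^ (r : ℕ)) • Pi.single (Sum.inl (r, A)) 1

/-- The linear combination of generators `η_p - χ(σ_p)` of the ambitwistor string. -/
def chiVec {N : ℕ} (σ : Particle k m → Spinor) (p : Fin m) (A : Fin N) :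
    Particle k m × Fin N → ℂ :=
  Pi.single (Sum.inr p, A) 1 -
    ∑ i : Fin k, (br (σ (Sum.inr p)) (σ (Sum.inl i)))⁻¹ • Pi.single (Sum.inl i, A) 1

/-- `chiVec` among the generators of the RSVW formula. -/
def chiVecInr (σ : Particle k m → Spinor) (p : Fin m) (A : Fin 4) :
    Fin k × Fin 4 ⊕ Particle k m × Fin 4 → ℂ :=
  Pi.single (Sum.inr (Sum.inr p, A)) 1 -
    ∑ i : Fin k, (br (σ (Sum.inr p)) (σ (Sum.inl i)))⁻¹ • Pi.single (Sum.inr (Sum.inl i, A)) 1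

theorem rsvwFermi_eq (y : Particle k m → Spinor) (a : Particle k m) (A : Fin 4) :
    rsvwFermi y a A = ExteriorAlgebra.ι ℂ (rsvwFermiVec y a A) := by
  simp only [rsvwFermi, rsvwFermiVec, θ, map_sub, map_sum, map_smul, Finset.smul_sum, smul_smul]

theorem θ_sub_chiField {N : ℕ} (σ : Particle k m → Spinor) (p : Fin m) (A : Fin N) :
    θ (Sum.inr p, A) - chiField N σ (σ (Sum.inr p)) A = ExteriorAlgebra.ι ℂ (chiVec σ p A) := by
  simp only [chiField, chiVec, θ, map_sub, map_sum, map_smul]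

/-- By interpolation the fermionic moduli in the factors of R are combinations of those in the
factors of L. The difference lies in the span of the L-vectors and disappears after multiplication
by their product. -/
theorem rsvwFermiVec_sub_chiVecInr {y : Particle k m → Spinor} (hy : RsvwDomain y) (p : Fin m)
    (A : Fin 4) : rsvwFermiVec y (Sum.inr p) A - chiVecInr (rsvwMap y) p A =
      ∑ i : Fin k, (br (rsvwMap y (Sum.inr p)) (rsvwMap y (Sum.inl i)))⁻¹ •
        rsvwFermiVec y (Sum.inl i) A := by
  have h1 : ∑ r : Fin k, (y (Sum.inr p) 1 * y (Sum.inr p) 0 ^ (r : ℕ)) •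
      (Pi.single (Sum.inl (r, A)) 1 : Fin k × Fin 4 ⊕ Particle k m × Fin 4 → ℂ) =
      ∑ i : Fin k, (br (rsvwMap y (Sum.inr p)) (rsvwMap y (Sum.inl i)))⁻¹ •
        ∑ r : Fin k, (y (Sum.inl i) 1 * y (Sum.inl i) 0 ^ (r : ℕ)) •
          (Pi.single (Sum.inl (r, A)) 1 : Fin k × Fin 4 ⊕ Particle k m × Fin 4 → ℂ) := by
    simp only [Finset.smul_sum, smul_smul]
    rw [Finset.sum_comm]
    refine Finset.sum_congr rfl fun r _ => ?_
    rw [← rsvw_interpolation hy, Finset.sum_smul]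
  rw [rsvwFermiVec, chiVecInr, h1]
  simp only [rsvwFermiVec, smul_sub, Finset.sum_sub_distrib]
  abel

theorem funLeft_single {S T : Type} [DecidableEq S] [DecidableEq T] {f : S → T}
    (hf : Function.Injective f) (s : S) :
    LinearMap.funLeft ℂ ℂ f (Pi.single (f s) 1) = Pi.single s 1 := by
  funext s'
  simp [LinearMap.funLeft_apply, Pi.single_apply, hf.eq_iff]

theorem funLeft_chiVecInr (σ : Particle k m → Spinor) (p : Fin m) (A : Fin 4) :
    LinearMap.funLeft ℂ ℂ (Sum.inr : _ → Fin k × Fin 4 ⊕ Particle k m × Fin 4) (chiVecInr σ p A) =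
      chiVec σ p A := by
  rw [chiVecInr, chiVec, map_sub, map_sum, funLeft_single Sum.inr_injective]
  simp only [map_smul, funLeft_single Sum.inr_injective]

/-- The matrix is the negative transpose of the interpolation matrix tensored with the 4×4 identity;
the sign occurs 4k times. -/
theorem det_rsvwFermiVec (y : Particle k m → Spinor) :
    (Matrix.of fun n n' : Fin (k * 4) =>
      rsvwFermiVec y (Sum.inl (finProdFinEquiv.symm n').1) (finProdFinEquiv.symm n').2
        (Sum.inl (finProdFinEquiv.symm n))).det = (rsvwMatrix y).det ^ 4 := by
  have h1 : (Matrix.of fun n n' : Fin (k * 4) =>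
      rsvwFermiVec y (Sum.inl (finProdFinEquiv.symm n').1) (finProdFinEquiv.symm n').2
        (Sum.inl (finProdFinEquiv.symm n))) =
      ((-(rsvwMatrix y).transpose) ⊗ₖ (1 : Matrix (Fin 4) (Fin 4) ℂ)).submatrix
        finProdFinEquiv.symm finProdFinEquiv.symm := by
    ext n n'
    obtain ⟨⟨r, A⟩, rfl⟩ := finProdFinEquiv.surjective n
    obtain ⟨⟨i, A'⟩, rfl⟩ := finProdFinEquiv.surjective n'
    simp only [Matrix.of_apply, Matrix.submatrix_apply, Equiv.symm_apply_apply,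
      Matrix.kroneckerMap_apply, Matrix.neg_apply, Matrix.transpose_apply, rsvwFermiVec,
      Pi.sub_apply, Finset.sum_apply, Pi.smul_apply, smul_eq_mul, Matrix.one_apply, rsvwMatrix]
    by_cases hA : A = A'
    · subst hA
      rw [Finset.sum_eq_single r]
      · simp
      · intro b _ hb
        simp [hb.symm]
      · simp
    · simp [hA]
  rw [h1, Matrix.det_submatrix_equiv_self, Matrix.det_kronecker, Matrix.det_neg,
    Matrix.det_transpose, Matrix.det_one, one_pow, mul_one, Fintype.card_fin, Fintype.card_fin,
    mul_pow, ← pow_mul, mul_comm k 4, pow_mul]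
  norm_num

/-- Multiplied by the L-factors, the R-factors may be replaced by their ambitwistor counterparts,
which contain no fermionic moduli. The Berezin integral then acts on the L-factors only and yields a
determinant; its fourth power cancels the bosonic determinants, as four supersymmetries require. -/
theorem rsvwFermiIntegral_eq {y : Particle k m → Spinor} (hy : RsvwDomain y) :
    rsvwFermiIntegral y = (rsvwMatrix y).det ^ 4 •
      (List.ofFn fun p : Fin m => fermiDelta fun r : Fin 4 =>
        θ (Sum.inr p, r) - chiField 4 (rsvwMap y) (rsvwMap y (Sum.inr p)) r).prod := by
  have hL : (List.ofFn fun i : Fin k => fermiDelta (rsvwFermi y (Sum.inl i))).prod =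
      ExteriorAlgebra.ιMulti ℂ (k * 4) fun n => rsvwFermiVec y
        (Sum.inl (finProdFinEquiv.symm n).1) (finProdFinEquiv.symm n).2 := by
    rw [ExteriorAlgebra.ιMulti_apply]
    simp only [← rsvwFermi_eq]
    exact prod_ofFn_prod fun i A => rsvwFermi y (Sum.inl i) A
  have hR : (List.ofFn fun i : Fin m => fermiDelta (rsvwFermi y (Sum.inr i))).prod =
      ExteriorAlgebra.ιMulti ℂ (m * 4) fun n => rsvwFermiVec y
        (Sum.inr (finProdFinEquiv.symm n).1) (finProdFinEquiv.symm n).2 := by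
    rw [ExteriorAlgebra.ιMulti_apply]
    simp only [← rsvwFermi_eq]
    exact prod_ofFn_prod fun i A => rsvwFermi y (Sum.inr i) A
  have hA : (List.ofFn fun p : Fin m => fermiDelta fun r : Fin 4 =>
        θ (Sum.inr p, r) - chiField 4 (rsvwMap y) (rsvwMap y (Sum.inr p)) r).prod =
      ExteriorAlgebra.ιMulti ℂ (m * 4) fun n =>
        chiVec (rsvwMap y) (finProdFinEquiv.symm n).1 (finProdFinEquiv.symm n).2 := by
    rw [ExteriorAlgebra.ιMulti_apply]
    simp only [θ_sub_chiField]
    exact prod_ofFn_prod fun p A => ExteriorAlgebra.ι ℂ (chiVec (rsvwMap y) p A)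
  -- The exponent of the ordering sign is even.
  have hsign : (k * 4).choose 2 = 2 * (k * (k * 4 - 1)) := by
    rw [Nat.choose_two_right, show k * 4 * (k * 4 - 1) = 2 * (2 * (k * (k * 4 - 1))) by ring,
      Nat.mul_div_cancel_left _ two_pos]
  rw [rsvwFermiIntegral, hL, hR, hA, berezin_map, finRange_product, List.map_map, List.map_ofFn,
    ιMulti_mul_ιMulti_congr _ _ (fun n =>
      chiVecInr (rsvwMap y) (finProdFinEquiv.symm n).1 (finProdFinEquiv.symm n).2)]
  · rw [iteratedContraction_ιMulti_mul, map_smul, ExteriorAlgebra.map_apply_ιMulti, hsign, pow_mul]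
    · simp only [Function.comp_def, funLeft_chiVecInr, LinearMap.proj_apply, det_rsvwFermiVec]
      norm_num
    · intro n
      refine contraction_ιMulti_eq_zero _ _ fun n' => ?_
      simp [chiVecInr]
  · intro n
    -- Each term of the difference repeats a vector already present in the product over L.
    rw [rsvwFermiVec_sub_chiVecInr hy, map_sum, Finset.sum_mul]
    refine Finset.sum_eq_zero fun i _ => ?_
    rw [map_smul, smul_mul_assoc, ExteriorAlgebra.ιMulti_apply]
    have h1 := ExteriorAlgebra.ι_mul_prod_list (R := ℂ) (fun n => rsvwFermiVec y
        (Sum.inl (finProdFinEquiv.symm n).1) (finProdFinEquiv.symm n).2)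
        (finProdFinEquiv (i, (finProdFinEquiv.symm n).2))
    rw [Equiv.symm_apply_apply] at h1
    rw [h1, smul_zero]

end Ambitwistor

namespace Ambitwistor

variable {k m : ℕ}

/-! ### The ambitwistor string and the RSVW formula -/

/-- A shear brings all points of σ into the affine chart, where `rsvwMap` is onto; the moduli follow
from invertibility of the interpolation matrix. -/
theorem exists_rsvw_solution (ω : Fin (k + m) ≃ Particle k m) (hk : 1 ≤ k) (hm : 1 ≤ m)
    {κ : Kinematics k m} {σ : Particle k m → Spinor}
    (hσ : σ ∈ (ambitwistor k m 4 ω).solutions κ) :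
    ∃ x ∈ (rsvw k m ω).solutions κ,
      (ambitwistor k m 4 ω).GaugeEquiv (rsvwMap fun a => x (Sum.inr a)) σ := by
  have hσ' : ∀ a b, a ≠ b → br (σ a) (σ b) ≠ 0 := hσ.1
  have hσ0 : ∀ c, σ c ≠ 0 := fun c => by
    cases c with
    | inl l => exact ne_zero_of_br_ne_zero (hσ' (Sum.inl l) (Sum.inr ⟨0, by omega⟩) (by simp))
    | inr l => exact ne_zero_of_br_ne_zero (hσ' (Sum.inr l) (Sum.inl ⟨0, by omega⟩) (by simp))
  obtain ⟨s, hs⟩ := exists_shear hσ0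
  let h : Matrix (Fin 2) (Fin 2) ℂ := !![1, s; 0, 1]
  have hh : h.det = 1 := by simp [h, Matrix.det_fin_two]
  have hτ : actPoints h 1 σ ∈ (ambitwistor k m 4 ω).solutions κ :=
    actPoints_mem_solutions ω hh one_ne_zero hσ
  have h0 : ∀ a, actPoints h 1 σ a 0 ≠ 0 := fun a => by
    have h1 : actPoints h 1 σ a 0 = σ a 0 + s * σ a 1 := by
      rw [actPoints_apply]
      cases a <;> simp [glWeight, h, dotProduct]
    rw [h1]
    exact hs a
  obtain ⟨y, hy, he⟩ := exists_rsvwMap_eq (actPoints_mem_domain (N := 4) ω hh one_ne_zero hσ.1) h0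
  obtain ⟨ρ, hρ⟩ := matrixAct_surjective (det_rsvwMatrix_ne_zero hy) fun i => κ.1 (Sum.inl i)
  refine ⟨Sum.elim ρ y, ?_, ?_⟩
  · rw [rsvw_mem_solutions_iff (N := 4)]
    refine ⟨hy, hρ, ?_⟩
    rw [← he] at hτ
    exact hτ
  · refine (ambitwistor_equivalence ω).symm ((ambitwistor_gaugeEquiv_iff ω).2
      ⟨h, 1, hh, one_ne_zero, ?_⟩)
    exact he

open Classical in
/-- A solution of the RSVW equations over a solution of those of the ambitwistor string. -/
def rsvwFiber (ω : Fin (k + m) ≃ Particle k m) (κ : Kinematics k m) (hk : 1 ≤ k) (hm : 1 ≤ m)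
    (σ : Particle k m → Spinor) : Finset (Fin k ⊕ Particle k m → Spinor) :=
  if hσ : σ ∈ (ambitwistor k m 4 ω).solutions κ then {(exists_rsvw_solution ω hk hm hσ).choose}
  else ∅

theorem rsvwFiber_eq {ω : Fin (k + m) ≃ Particle k m} {κ : Kinematics k m} (hk : 1 ≤ k)
    (hm : 1 ≤ m) {σ : Particle k m → Spinor} (hσ : σ ∈ (ambitwistor k m 4 ω).solutions κ) :
    ∃ x ∈ (rsvw k m ω).solutions κ,
      (ambitwistor k m 4 ω).GaugeEquiv (rsvwMap fun a => x (Sum.inr a)) σ ∧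
      rsvwFiber ω κ hk hm σ = {x} := by
  have h := (exists_rsvw_solution ω hk hm hσ).choose_spec
  exact ⟨_, h.1, h.2, dif_pos hσ⟩

theorem rsvw_integrand_eq (ω : Fin (k + m) ≃ Particle k m) {x : Fin k ⊕ Particle k m → Spinor}
    (hx : RsvwDomain fun a => x (Sum.inr a)) :
    (rsvw k m ω).integrand x = ((∏ a, rsvwScale (fun a => x (Sum.inr a)) a) ^ 2 *
      (∏ a, (x (Sum.inr a) 1)⁻¹) * (rsvwMatrix fun a => x (Sum.inr a)).det ^ 4) •
        (ambitwistor k m 4 ω).integrand (rsvwMap fun a => x (Sum.inr a)) := by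
  have h1 := rsvwFermiIntegral_eq hx
  set y : Particle k m → Spinor := fun a => x (Sum.inr a)
  have h2 : (rsvw k m ω).integrand x = ((parkeTaylor ω fun a => affinePoint (y a 0))⁻¹ *
    ∏ a : Particle k m, (y a 1)⁻¹) • rsvwFermiIntegral y := rfl
  have h3 : parkeTaylor ω (rsvwMap y) =
    (∏ a, rsvwScale y a) ^ 2 * parkeTaylor ω fun a => affinePoint (y a 0) := parkeTaylor_smul ω _ _
  have h4 : (ambitwistor k m 4 ω).integrand (rsvwMap y) = (parkeTaylor ω (rsvwMap y))⁻¹ •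
    (List.ofFn fun p : Fin m => fermiDelta fun r : Fin 4 =>
      θ (Sum.inr p, r) - chiField 4 (rsvwMap y) (rsvwMap y (Sum.inr p)) r).prod := rfl
  have h5 : (∏ a, rsvwScale y a) ≠ 0 :=
    Finset.prod_ne_zero_iff.2 fun a _ => rsvwScale_ne_zero hx a
  rw [h2, h1, h4, h3, smul_smul, smul_smul]
  congr 1
  change _ = (∏ a, rsvwScale y a) ^ 2 * (∏ a, (y a 1)⁻¹) * (rsvwMatrix y).det ^ 4 * _
  rw [mul_inv]
  field_simp

/-- The relation between the ambitwistor string and the RSVW formula. -/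
def rsvwCorrespondence (ω : Fin (k + m) ≃ Particle k m) (κ : Kinematics k m) (hk : 1 ≤ k)
    (hm : 1 ≤ m) : DeltaIntegral.Correspondence (ambitwistor k m 4 ω) (rsvw k m ω) κ
      ((-1 : ℂ) ^ k • LinearMap.id) 1 where
  toFun x := rsvwMap fun a => x (Sum.inr a)
  fiber := rsvwFiber ω κ hk hm
  equivalence := ambitwistor_equivalence ω
  mem_solutions := ambitwistor_mem_solutions ω κ
  residue_eq := ambitwistor_residue_eq ω κ
  map_mem x hx := ((rsvw_mem_solutions_iff ω κ x).1 hx).2.2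
  map_equiv x hx y hy hxy := (rsvw_gaugeEquiv_iff ω hk hx hy).1 hxy
  symm' x hx y hy hxy := (rsvw_gaugeEquiv_iff ω hk hy hx).2
    ((ambitwistor_equivalence ω).symm ((rsvw_gaugeEquiv_iff ω hk hx hy).1 hxy))
  trans' x hx y hy z hz hxy hyz := (rsvw_gaugeEquiv_iff ω hk hx hz).2
    ((ambitwistor_equivalence ω).trans ((rsvw_gaugeEquiv_iff ω hk hx hy).1 hxy)
      ((rsvw_gaugeEquiv_iff ω hk hy hz).1 hyz))
  d_ne_zero := one_ne_zero
  fiber_mem σ hσ x hx := by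
    obtain ⟨y, hy, -, he⟩ := rsvwFiber_eq hk hm hσ
    rw [he, Finset.mem_singleton] at hx
    rwa [hx]
  fiber_equiv σ hσ x hx := by
    obtain ⟨y, -, hy, he⟩ := rsvwFiber_eq hk hm hσ
    rw [he, Finset.mem_singleton] at hx
    rwa [hx]
  fiber_card σ hσ := by
    obtain ⟨y, -, -, he⟩ := rsvwFiber_eq hk hm hσ
    rw [he, Finset.card_singleton]
  fiber_inj σ hσ x hx y hy _ := by
    obtain ⟨z, -, -, he⟩ := rsvwFiber_eq hk hm hσ
    rw [he, Finset.mem_singleton] at hx hy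
    rw [hx, hy]
  fiber_surj σ hσ x hx hxσ := by
    obtain ⟨y, hy, hyσ, he⟩ := rsvwFiber_eq hk hm hσ
    refine ⟨y, by rw [he, Finset.mem_singleton], (rsvw_gaugeEquiv_iff ω hk hy hx).2 ?_⟩
    exact (ambitwistor_equivalence ω).trans hyσ ((ambitwistor_equivalence ω).symm hxσ)
  jacobian_eq x hx := by
    have hy : RsvwDomain fun a => x (Sum.inr a) := hx.1
    have h1 : (∏ a, rsvwScale (fun a => x (Sum.inr a)) a) ≠ 0 :=
      Finset.prod_ne_zero_iff.2 fun a _ => rsvwScale_ne_zero hy a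
    have h2 := det_rsvwMatrix_ne_zero hy
    have h3 : ∏ a, (x (Sum.inr a) 1)⁻¹ ≠ 0 :=
      Finset.prod_ne_zero_iff.2 fun a _ => inv_ne_zero (hy.2 a)
    have h4 : ((-1 : ℂ) ^ k) * (-1) ^ k = 1 := by
      rw [← mul_pow]; simp
    have h5 : ((-1 : ℂ) ^ k) ≠ 0 := left_ne_zero_of_mul_eq_one h4
    have h6 : ((-1 : ℂ) ^ k)⁻¹ = (-1) ^ k := inv_eq_of_mul_eq_one_left h4
    refine ⟨(rsvwMatrix fun a => x (Sum.inr a)).det ^ 2 *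
        ((-1) ^ k * (∏ a, rsvwScale (fun a => x (Sum.inr a)) a) ^ 2 * ∏ a, (x (Sum.inr a) 1)⁻¹) *
        (rsvwMatrix fun a => x (Sum.inr a)).det ^ 2,
      mul_ne_zero (mul_ne_zero (pow_ne_zero _ h2) (mul_ne_zero (mul_ne_zero h5
        (pow_ne_zero _ h1)) h3)) (pow_ne_zero _ h2), fun J => ?_, ?_⟩
    · rw [← rsvw_hasJacobian_iff ω hk hx J, mul_assoc _ _ J]
    · rw [rsvw_integrand_eq ω hy, Nat.cast_one, inv_one, one_smul, LinearMap.smul_apply,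
        LinearMap.id_apply, smul_smul]
      congr 1
      generalize ∏ a, (x (Sum.inr a) 1)⁻¹ = T at h3 ⊢
      generalize (∏ a, rsvwScale (fun a => x (Sum.inr a)) a) = Γ at h1 ⊢
      simp only [mul_inv, h6]
      field_simp

theorem ambitwistor_iff_rsvw (ω : Fin (k + m) ≃ Particle k m) (κ : Kinematics k m) (hk : 1 ≤ k)
    (hm : 1 ≤ m) (v : Grassmann (Particle k m × Fin 4)) :
    (ambitwistor k m 4 ω).HasValue κ v ↔ (rsvw k m ω).HasValue κ ((-1 : ℂ) ^ k • v) := by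
  have h5 : ((-1 : ℂ) ^ k) ≠ 0 := pow_ne_zero _ (by simp)
  constructor
  · exact fun h => (rsvwCorrespondence ω κ hk hm).hasValue_map h
  · intro h
    obtain ⟨v', hv', he⟩ := (rsvwCorrespondence ω κ hk hm).exists_hasValue h
    rw [LinearMap.smul_apply, LinearMap.id_apply] at he
    rwa [smul_right_injective _ h5 he]

/-! ### Reduction to three supersymmetries -/

section Contraction

variable {M : Type*} [AddCommGroup M] [Module ℂ M]

theorem contraction_ιMulti_mul_of_eq_zero (d : M →ₗ[ℂ] ℂ) {N : ℕ} (w : Fin N → M)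
    (h : ∀ i, d (w i) = 0) (X : ExteriorAlgebra ℂ M) :
    contraction d (ExteriorAlgebra.ιMulti ℂ N w * X) =
      (-1 : ℂ) ^ N • (ExteriorAlgebra.ιMulti ℂ N w * contraction d X) := by
  induction N with
  | zero => simp
  | succ N ih =>
    rw [ExteriorAlgebra.ιMulti_succ_apply, mul_assoc, contraction_ι_mul, h, zero_smul, zero_sub,
      ih (Matrix.vecTail w) fun i => h _, mul_smul_comm, pow_succ, mul_smul, neg_one_smul, smul_neg, mul_assoc]

/-- Blocks of four generators are even, so the contraction passes them without sign. -/
theorem contraction_prod_mul_of_eq_zero (d : M →ₗ[ℂ] ℂ) (l : List (Fin 4 → M))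
    (h : ∀ w ∈ l, ∀ i, d (w i) = 0) (X : ExteriorAlgebra ℂ M) :
    contraction d ((l.map (ExteriorAlgebra.ιMulti ℂ 4)).prod * X) =
      (l.map (ExteriorAlgebra.ιMulti ℂ 4)).prod * contraction d X := by
  induction l with
  | nil => simp
  | cons w l ih =>
    rw [List.map_cons, List.prod_cons, mul_assoc,
      contraction_ιMulti_mul_of_eq_zero d w (h w (by simp)),
      ih fun w hw => h w (by simp [hw]), mul_assoc]
    norm_num

/-- Each integration removes the fourth factor of its own block, at the cost of moving past three
generators, whence one sign for each particle of R. -/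
theorem iteratedContraction_prod_mul {m : ℕ} (d : Fin m → M →ₗ[ℂ] ℂ) (w : Fin m → Fin 4 → M)
    (h : ∀ p q r, d p (w q r) = if p = q ∧ r = Fin.last 3 then 1 else 0)
    (Y : ExteriorAlgebra ℂ M) (hY : ∀ p, contraction (d p) Y = 0) :
    iteratedContraction (List.ofFn d)
      ((List.ofFn fun p => ExteriorAlgebra.ιMulti ℂ 4 (w p)).prod * Y) =
      (-1 : ℂ) ^ m • ((List.ofFn fun p =>
        ExteriorAlgebra.ιMulti ℂ 3 fun r => w p r.castSucc).prod * Y) := by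
  induction m generalizing Y with
  | zero => simp [iteratedContraction]
  | succ m ih =>
    have h1 : (List.ofFn fun p : Fin m => ExteriorAlgebra.ιMulti ℂ 4 (w p.castSucc)) =
        (List.ofFn fun p : Fin m => w p.castSucc).map (ExteriorAlgebra.ιMulti ℂ 4) := by
      rw [List.map_ofFn]
      rfl
    have h2 : contraction (d (Fin.last m)) (ExteriorAlgebra.ιMulti ℂ 4 (w (Fin.last m)) * Y) =
        -(ExteriorAlgebra.ιMulti ℂ 3 (fun r => w (Fin.last m) r.castSucc) * Y) := by
      -- Only the fourth vector of the block pairs with the form.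
      rw [contraction_ιMulti_mul _ (hY _), Finset.sum_eq_single (Fin.last 3)]
      · rw [h, if_pos ⟨rfl, rfl⟩, Fin.succAbove_last, Fin.val_last, mul_one]
        norm_num
      · intro j _ hj
        rw [h, if_neg fun h => hj h.2, mul_zero, zero_smul]
      · simp
    rw [List.ofFn_succ', List.ofFn_succ', List.ofFn_succ', iteratedContraction_concat]
    simp only [List.concat_eq_append, List.prod_append, List.prod_singleton, mul_assoc]
    rw [h1, contraction_prod_mul_of_eq_zero, h2, ← h1, mul_neg, map_neg,
      ih (fun p => d p.castSucc) (fun p => w p.castSucc), pow_succ, mul_smul, neg_one_smul, smul_neg]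
    · intro p q r
      simp [h]
    · intro p
      rw [contraction_ιMulti_mul_of_eq_zero, hY, mul_zero, smul_zero]
      intro r
      rw [h, if_neg]
      rintro ⟨h1, -⟩
      exact (Fin.castSucc_lt_last p).ne h1
    · intro v hv i
      obtain ⟨q, rfl⟩ := (List.mem_ofFn' _ _).1 hv
      rw [h, if_neg]
      rintro ⟨h1, -⟩
      exact (Fin.castSucc_lt_last q).ne h1.symm

end Contraction

theorem ambitwistor_integrand_eq {N : ℕ} (ω : Fin (k + m) ≃ Particle k m)
    (σ : Particle k m → Spinor) : (ambitwistor k m N ω).integrand σ = (parkeTaylor ω σ)⁻¹ •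
      (List.ofFn fun p : Fin m => ExteriorAlgebra.ιMulti ℂ N fun r => chiVec σ p r).prod := by
  simp only [ambitwistor, fermiDelta, θ_sub_chiField, ExteriorAlgebra.ιMulti_apply]

/-- η_p⁴ occurs only in the fourth factor of the block of p, so integrating it out removes that
factor together with all the η_i⁴ it contains. Setting η_i⁴ = 0 afterwards merely relabels the
generators that remain. -/
theorem fourToThree_integrand (ω : Fin (k + m) ≃ Particle k m) (σ : Particle k m → Spinor) :
    fourToThree k m ((ambitwistor k m 4 ω).integrand σ) =
      (-1 : ℂ) ^ m • (ambitwistor k m 3 ω).integrand σ := by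
  have hf : Function.Injective
      (Prod.map id Fin.castSucc : Particle k m × Fin 3 → Particle k m × Fin 4) :=
    Function.injective_id.prodMap (Fin.castSucc_injective 3)
  have h1 : ∀ (p : Fin m) (r : Fin 3), LinearMap.funLeft ℂ ℂ
      (Prod.map id Fin.castSucc : Particle k m × Fin 3 → Particle k m × Fin 4)
      (chiVec σ p r.castSucc) = chiVec σ p r := by
    intro p r
    have h2 := fun a : Particle k m => funLeft_single hf (a, r)
    simp only [Prod.map_apply, id] at h2
    rw [chiVec, chiVec, map_sub, map_sum, h2]
    simp only [map_smul, h2]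
  have h2 := iteratedContraction_prod_mul
    (fun p : Fin m => (LinearMap.proj (Sum.inr p, Fin.last 3) :
      (Particle k m × Fin 4 → ℂ) →ₗ[ℂ] ℂ)) (chiVec (N := 4) σ) ?_ 1
    (fun p => CliffordAlgebra.contractLeft_one _ _)
  · rw [mul_one, mul_one] at h2
    rw [ambitwistor_integrand_eq, ambitwistor_integrand_eq, map_smul, fourToThree,
      LinearMap.comp_apply, berezin_map, List.map_map, ← List.ofFn_eq_map]
    have h3 : ((fun s => (LinearMap.proj s : (Particle k m × Fin 4 → ℂ) →ₗ[ℂ] ℂ)) ∘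
      fun p : Fin m => ((Sum.inr p, Fin.last 3) : Particle k m × Fin 4)) =
        fun p => LinearMap.proj (Sum.inr p, Fin.last 3) := rfl
    rw [h3, h2, map_smul, AlgHom.toLinearMap_apply, map_list_prod, List.map_ofFn, smul_comm]
    simp only [Function.comp_def, ExteriorAlgebra.map_apply_ιMulti, h1]
  · intro p q r
    simp only [LinearMap.proj_apply, chiVec, Pi.sub_apply, Finset.sum_apply, Pi.smul_apply]
    by_cases h : p = q ∧ r = Fin.last 3
    · rw [if_pos h, h.1, h.2]
      simp
    · rw [if_neg h, Pi.single_eq_of_ne fun h' => ?_]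
      · simp
      · obtain ⟨h4, h5⟩ := Prod.mk.inj h'
        exact h ⟨Sum.inr_injective h4, h5.symm⟩

/-- Solutions, gauge orbits and Jacobians do not depend on 𝒩, so the same representatives serve on
both sides and only the integrand is mapped. -/
theorem ambitwistor_hasValue_map {N N' : ℕ} (ω : Fin (k + m) ≃ Particle k m) (κ : Kinematics k m)
    (f : Grassmann (Particle k m × Fin N) →ₗ[ℂ] Grassmann (Particle k m × Fin N'))
    (hf : ∀ σ, f ((ambitwistor k m N ω).integrand σ) = (ambitwistor k m N' ω).integrand σ)
    (v : Grassmann (Particle k m × Fin N')) : (ambitwistor k m N' ω).HasValue κ v ↔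
      ∃ w, (ambitwistor k m N ω).HasValue κ w ∧ v = f w := by
  constructor
  · rintro ⟨s, J, h1, h2, rfl⟩
    refine ⟨∑ x ∈ s, (J x)⁻¹ • (ambitwistor k m N ω).integrand x, ⟨s, J, h1, h2, rfl⟩, ?_⟩
    simp only [map_sum, map_smul, hf]
  · rintro ⟨w, ⟨s, J, h1, h2, rfl⟩, rfl⟩
    refine ⟨s, J, h1, h2, ?_⟩
    simp only [map_sum, map_smul, hf]

end Ambitwistor

end

/-! ### The theorem. -/

theorem mainTheorem8 (k m : ℕ) (hk : 2 ≤ k) (hm : 1 ≤ m)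
    (ω : Fin (k + m) ≃ Ambitwistor.Particle k m) (κ : Ambitwistor.Kinematics k m) :
    -- the ambitwistor-string formula is supported on the refined scattering equations
    (∀ (N : ℕ), ∀ σ ∈ (Ambitwistor.ambitwistor k m N ω).solutions κ,
      (∀ i : Fin k, Ambitwistor.br (κ.2 (Sum.inl i))
        (Ambitwistor.lamTildeField κ σ (σ (Sum.inl i))) = 0) ∧
      (∀ p : Fin m, Ambitwistor.br (κ.1 (Sum.inr p))
        (Ambitwistor.lamField κ σ (σ (Sum.inr p))) = 0)) ∧
    -- at `N = 0` it equals Witten's parity-invariant formula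
    (2 ≤ m → ∀ v : ℂ,
      (Ambitwistor.ambitwistor k m 0 ω).HasValue κ (algebraMap ℂ _ v) ↔
        (Ambitwistor.witten k m ω).HasValue κ ((-1) ^ (k + m - 1) * v)) ∧
    -- with four supersymmetries it equals the RSVW formula
    (∀ v, (Ambitwistor.ambitwistor k m 4 ω).HasValue κ v ↔
      (Ambitwistor.rsvw k m ω).HasValue κ ((-1 : ℂ) ^ k • v)) ∧
    -- at `N = 3` it equals the `N = 3` form of the RSVW formula
    (∀ v, (Ambitwistor.ambitwistor k m 3 ω).HasValue κ v ↔
      ∃ w, (Ambitwistor.rsvw k m ω).HasValue κ w ∧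
        v = (-1 : ℂ) ^ (k + m) • Ambitwistor.fourToThree k m w) := by
  have hsign : ∀ n : ℕ, ((-1 : ℂ) ^ n) * (-1) ^ n = 1 := fun n => by rw [← mul_pow]; simp
  refine ⟨fun N σ hσ => ⟨fun i => ?_, fun p => ?_⟩,
    fun hm' v => Ambitwistor.ambitwistor_iff_witten ω κ hk hm' v,
    fun v => Ambitwistor.ambitwistor_iff_rsvw ω κ (by omega) hm v, fun v => ?_⟩
  · have h : κ.2 (Sum.inl i) - Ambitwistor.lamTildeField κ σ (σ (Sum.inl i)) = 0 :=
      congrFun hσ.2 (Sum.inl i)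
    rw [← sub_eq_zero.1 h, Ambitwistor.br_self]
  · have h : κ.1 (Sum.inr p) - Ambitwistor.lamField κ σ (σ (Sum.inr p)) = 0 :=
      congrFun hσ.2 (Sum.inr p)
    rw [← sub_eq_zero.1 h, Ambitwistor.br_self]
  -- The factor (-1)^m undoes the Berezin sign, so 𝒩 = 4 integrands go exactly to 𝒩 = 3 integrands.
  -- Together with the (-1)^k of the RSVW comparison it gives (-1)^n.
  · rw [Ambitwistor.ambitwistor_hasValue_map ω κ ((-1 : ℂ) ^ m • Ambitwistor.fourToThree k m) fun σ => by
      rw [LinearMap.smul_apply, Ambitwistor.fourToThree_integrand, smul_smul, hsign, one_smul]]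
    constructor
    · rintro ⟨w, hw, rfl⟩
      refine ⟨(-1 : ℂ) ^ k • w, (Ambitwistor.ambitwistor_iff_rsvw ω κ (by omega) hm w).1 hw, ?_⟩
      rw [map_smul, smul_smul, LinearMap.smul_apply, pow_add, mul_right_comm, hsign, one_mul]
    · rintro ⟨w, hw, rfl⟩
      refine ⟨(-1 : ℂ) ^ k • w, (Ambitwistor.ambitwistor_iff_rsvw ω κ (by omega) hm _).2 ?_, ?_⟩
      · rwa [smul_smul, hsign, one_smul]
      · rw [map_smul, LinearMap.smul_apply, smul_smul, pow_add]
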